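/- **Setting.** Let $L$ be an even lattice of signature $(1,n)$, $n\ge 1$, with quadratic form $Q$, bilinear form $(x,y)=Q(x+y)-Q(x)-Q(y)$, dual lattice $L'$ and $V=L\otimes\mathbb R$; put $k=\frac{1-n}{2}$, $e(x)=e^{2\pi i x}$, $q=e(\tau)$, $\tau=u+iv\in\mathbb H$. For an even lattice $M$ of signature $(p,q)$ let $\rho_M$ be the Weil representation of $\mathrm{Mp}_2(\mathbb Z)$ on $\mathbb C[M'/M]$, given by $\rho_M(T)\mathfrak e_\gamma=e(Q(\gamma))\mathfrak e_\gamma$ and $\rho_M(S)\mathfrak e_\gamma=\frac{\sqrt i^{\,q-p}}{\sqrt{|M'/M|}}\sum_{\beta\in M'/M}e(-(\beta,\gamma))\mathfrak e_\beta$ for $T=(\begin{pmatrix}1&1\\0&1\end{pmatrix},1)$, $S=(\begin{pmatrix}0&-1\\1&0\end{pmatrix},\sqrt\tau)$. Let $M^-=(M,-Q)$, and let $\langle\cdot,\cdot\rangle$ be the standard inner product on $\mathbb C[M'/M]$, antilinear in the second variable. A harmonic Maass form of weight $\kappa\in\frac12\mathbb Z$ for $\rho_M$ is a smooth function $g:\mathbb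 H\to\mathbb C[M'/M]$ that transforms with weight $\kappa$ for $\rho_M$, is annihilated by the weight $\kappa$ Laplace operator $\Delta_\kappa=-v^2(\partial_u^2+\partial_v^2)+i\kappa v(\partial_u+i\partial_v)$, and grows at most linearly exponentially as $v\to\infty$. Let $\xi_\kappa=2iv^\kappa\overline{\partial/\partial\bar\tau}$, and let $H^{\mathrm{hol}}_{\kappa,M}$ (resp. $H^{\mathrm{cusp}}_{\kappa,M}$) be the space of such $g$ for which $\xi_\kappa g$ is a holomorphic modular form (resp. a cusp form) of weight $2-\kappa$ for $\rho_{M^-}$. For $\kappa\le 0$ or $\kappa=\frac32$, each $g\in H^{\mathrm{hol}}_{\kappa,M}$ has a Fourier expansion $g=g^++g^-$ with $$g^+=\sum_{\gamma\in M'/M}\sum_{m\gg-\infty}a_g^+(\gamma,m)q^m\mathfrak e_\gamma,\qquad g^-=\sum_{\gamma\in M'/M}\Big(a_g^-(\gamma,0)v^{1-\kappa}+\sum_{m<0}a_g^-(\gamma,m)\Gamma(1-\kappa,4\pi|m|v)q^m\Big)\mathfrak e_\gamma,$$ where $m$ runs over $Q(\gamma)+\mathbb Z$ and $\Gamma(s,x)=\int_x^\infty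 e^{-t}t^{s-1}dt$. For a positive line $z\subset V$ let $\Theta_L(\tau,z)=v^{n/2}\sum_{\lambda\in L'}e(Q(\lambda_z)\tau+Q(\lambda_{z^\perp})\bar\tau)\mathfrak e_{\lambda+L}$, and define $$\Phi(f,z)=\lim_{T\to\infty}\int_{\mathcal F_T}\langle f(\tau),\Theta_L(\tau,z)\rangle v^k\frac{du\,dv}{v^2},\qquad \mathcal F_T=\{\tau\in\mathbb H:|u|\le\tfrac12,\ |\tau|\ge1,\ v\le T\}.$$ Let $w$ be a special point, that is, a positive line in $V$ defined over $\mathbb Q$, and put $P=L\cap w$, $N=L\cap w^\perp$. For a positive definite lattice $M$ let $\Theta_M(\tau)=\sum_{\lambda\in M'}e(Q_M(\lambda)\tau)\mathfrak e_{\lambda+M}$, where $Q_M$ is the form of $M$; this defines $\Theta_P$ and, with $Q_{N^-}=-Q$, also $\Theta_{N^-}$. For $h$ with values in $\mathbb C[L'/L]$ let $h_{P\oplus N}$ be the function with values in $\mathbb C[(P\oplus N)'/(P\oplus N)]=\mathbb C[P'/P]\otimes\mathbb C[N'/N]$ whose component at $\gamma$ is $h_{\gamma+L}$ if $\gamma\in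 L'/(P\oplus N)$ and $0$ otherwise. Let $\mathrm{CT}$ denote the constant coefficient of a Fourier series in $q$. **Theorem.** Let $f\in H^{\mathrm{cusp}}_{k,L}$, let $w$ be a special point, and let $\widetilde\Theta_P\in H^{\mathrm{hol}}_{3/2,P^-}$ satisfy $\xi_{3/2}\widetilde\Theta_P=\Theta_P$. Then the limit defining $\Phi(f,w)$ and the limit below exist, and $$\Phi(f,w)=\mathrm{CT}\Big(\Big\langle f^+_{P\oplus N},\overline{\widetilde\Theta_P^+\otimes\Theta_{N^-}}\Big\rangle\Big)-\lim_{T\to\infty}\int_{\mathcal F_T}\Big\langle\widetilde\Theta_P(\tau)\otimes\Theta_{N^-}(\tau),\ \xi_kf_{P\oplus N}(\tau)\Big\rangle v^{2-k}\frac{du\,dv}{v^2}.$$ Moreover $$\mathrm{CT}\Big(\Big\langle f^+_{P\oplus N},\overline{\widetilde\Theta_P^+\otimes\Theta_{N^-}}\Big\rangle\Big)=\sum_{\substack{\alpha\in P'/P,\ \beta\in N'/N\\ \alpha+\beta\in L'}}\ \sum_{m\in\mathbb Z-Q(\alpha+\beta)}a_f^+(\alpha+\beta,-m)\sum_{\lambda\in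 N+\beta}a^+_{\widetilde\Theta_P}(\alpha,m+Q(\lambda)),$$ and only finitely many of the products $a_f^+(\alpha+\beta,-m)\,a^+_{\widetilde\Theta_P}(\alpha,m+Q(\lambda))$ are non-zero. -/

import Mathlib

open UpperHalfPlane MeasureTheory Filter Topology
open scoped Manifold ContDiff ComplexConjugate MatrixGroups

noncomputable section

namespace ThetaLift

/-- `e(x) = exp(2πix)`. -/
def e (x : ℂ) : ℂ := Complex.exp (2 * Real.pi * Complex.I * x)

/-! ### The metaplectic group `Mp₂(ℤ)` -/

/-- Pairs `(M, φ)` with `M ∈ SL₂(ℤ)` and `φ : ℍ → ℂ` holomorphic with `φ(τ)² = cτ + d`. -/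
@[ext]
structure Mp2 where
  mat : SL(2, ℤ)
  φ : ℍ → ℂ
  holo : MDifferentiable 𝓘(ℂ) 𝓘(ℂ) φ
  sq : ∀ τ : ℍ, φ τ ^ 2 = (mat 1 0 : ℂ) * τ + (mat 1 1 : ℂ)

namespace Mp2

lemma denom_eq (M : SL(2, ℤ)) (τ : ℍ) :
    denom (M : GL (Fin 2) ℝ) τ = (M 1 0 : ℂ) * τ + (M 1 1 : ℂ) := by
  simp [denom]

lemma mdiff_smul (M : SL(2, ℤ)) : MDifferentiable 𝓘(ℂ) 𝓘(ℂ) (fun τ : ℍ => M • τ) :=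
  mdifferentiable_smul (g := (M : GL (Fin 2) ℝ)) (by simp)

lemma φ_ne_zero (g : Mp2) (τ : ℍ) : g.φ τ ≠ 0 := by
  intro h
  have h1 := g.sq τ
  rw [h, ← denom_eq] at h1
  exact denom_ne_zero (g.mat : GL (Fin 2) ℝ) τ (by simpa using h1.symm)

lemma denom_mul (M N : SL(2, ℤ)) (τ : ℍ) :
    denom ((M * N : SL(2, ℤ)) : GL (Fin 2) ℝ) τ =
      denom (M : GL (Fin 2) ℝ) ↑(N • τ) * denom (N : GL (Fin 2) ℝ) τ := by
  have h := denom_cocycle_σ (M : GL (Fin 2) ℝ) (N : GL (Fin 2) ℝ) τ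
  have hs : σ (N : GL (Fin 2) ℝ) = ContinuousAlgEquiv.refl ℝ ℂ := by simp [σ]
  rw [hs] at h
  simpa using h

/-- `(M, φ)(N, ψ) = (MN, φ(Nτ)ψ(τ))`. -/
instance : Mul Mp2 where
  mul g h :=
    { mat := g.mat * h.mat
      φ := fun τ => g.φ (h.mat • τ) * h.φ τ
      holo := (g.holo.comp (mdiff_smul h.mat)).mul h.holo
      sq := fun τ => by
        rw [mul_pow, g.sq, h.sq, ← denom_eq, ← denom_eq, ← denom_eq, denom_mul] }

instance : One Mp2 where
  one :=
    { mat := 1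
      φ := fun _ => 1
      holo := mdifferentiable_const
      sq := fun τ => by simp }

instance : Inv Mp2 where
  inv g :=
    { mat := g.mat⁻¹
      φ := fun τ => (g.φ (g.mat⁻¹ • τ))⁻¹
      holo := by
        have h1 := (g.holo.comp (mdiff_smul g.mat⁻¹))
        rw [mdifferentiable_iff] at h1 ⊢
        exact h1.inv fun z _ => g.φ_ne_zero _
      sq := fun τ => by
        have h := denom_mul g.mat g.mat⁻¹ τ
        rw [mul_inv_cancel] at h
        rw [inv_pow, g.sq, ← denom_eq, ← denom_eq]
        refine inv_eq_of_mul_eq_one_right ?_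
        rw [← h]
        simp }

lemma mul_mat (g h : Mp2) : (g * h).mat = g.mat * h.mat := rfl
lemma mul_φ (g h : Mp2) (τ : ℍ) : (g * h).φ τ = g.φ (h.mat • τ) * h.φ τ := rfl

instance : Group Mp2 where
  mul_assoc a b c := by
    ext τ
    · simp only [mul_mat, mul_assoc]
    · simp only [mul_φ, mul_mat, mul_smul, mul_assoc]
  one_mul a := by
    ext τ
    · exact congrArg (fun M : SL(2, ℤ) => M _ _) (one_mul a.mat)
    · exact one_mul (a.φ τ)
  mul_one a := by
    ext τ
    · exact congrArg (fun M : SL(2, ℤ) => M _ _) (mul_one a.mat)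
    · change a.φ ((1 : SL(2, ℤ)) • τ) * 1 = a.φ τ
      simp
  inv_mul_cancel a := by
    ext τ
    · exact congrArg (fun M : SL(2, ℤ) => M _ _) (inv_mul_cancel a.mat)
    · change (a.φ (a.mat⁻¹ • a.mat • τ))⁻¹ * a.φ τ = 1
      rw [inv_smul_smul]
      exact inv_mul_cancel₀ (a.φ_ne_zero τ)

/-- The generator `T = ((1,1;0,1), 1)`. -/
def T : Mp2 where
  mat := ModularGroup.T
  φ := fun _ => 1
  holo := mdifferentiable_const
  sq := fun τ => by simp [ModularGroup.T]

/-- The generator `S = ((0,-1;1,0), √τ)`, with the principal branch of the root. -/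
def S : Mp2 where
  mat := ModularGroup.S
  φ := fun τ => (τ : ℂ) ^ (1 / 2 : ℂ)
  holo := by
    rw [mdifferentiable_iff]
    have h : DifferentiableOn ℂ (fun z : ℂ => z ^ (1 / 2 : ℂ)) {z | 0 < z.im} := fun z hz =>
      ((differentiableAt_id).cpow_const (Or.inr (ne_of_gt hz))).differentiableWithinAt
    refine h.congr fun z hz => ?_
    simp [Function.comp, ofComplex_apply_of_im_pos hz]
  sq := fun τ => by
    rw [← Complex.cpow_nat_mul]
    simp [ModularGroup.S]

end Mp2

/-! ### Lattices and discriminant groups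

Lattices are subgroups `M` of a real vector space `V` with a quadratic form `Q`, whose bilinear
form is `(x, y) = Q(x + y) - Q(x) - Q(y)`. The sign `ε = ±1` selects the lattice `(M, εQ)`, so that
`ε = -1` gives `M⁻ = (M, -Q)`; the dual lattices of `M` and `M⁻` coincide. -/

variable {V : Type*} [AddCommGroup V] [Module ℝ V]

/-- `L` is an even lattice of signature `(p, q)` with `L ⊗ ℝ = V`. -/
structure IsEvenLattice (Q : QuadraticForm ℝ V) (L : AddSubgroup V) (p q : ℕ) : Prop where
  basis : ∃ b : Module.Basis (Fin (p + q)) ℝ V, L = AddSubgroup.closure (Set.range b)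
  even : ∀ x ∈ L, ∃ m : ℤ, Q x = m
  sigPos_eq : sigPos Q = p
  sigNeg_eq : sigNeg Q = q

/-- The dual lattice `M' = {x ∈ M ⊗ ℝ : (x, M) ⊆ ℤ}`. -/
def dualLattice (Q : QuadraticForm ℝ V) (M : AddSubgroup V) : AddSubgroup V where
  carrier := {x | x ∈ Submodule.span ℝ (M : Set V) ∧
    ∀ y ∈ M, ∃ m : ℤ, QuadraticMap.polar Q x y = m}
  zero_mem' := ⟨Submodule.zero_mem _, fun y _ => ⟨0, by simp⟩⟩
  add_mem' := by
    rintro a b ⟨ha, ha'⟩ ⟨hb, hb'⟩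
    refine ⟨Submodule.add_mem _ ha hb, fun y hy => ?_⟩
    obtain ⟨m, hm⟩ := ha' y hy
    obtain ⟨k, hk⟩ := hb' y hy
    exact ⟨m + k, by rw [QuadraticMap.polar_add_left, hm, hk]; push_cast; rfl⟩
  neg_mem' := by
    rintro a ⟨ha, ha'⟩
    refine ⟨Submodule.neg_mem _ ha, fun y hy => ?_⟩
    obtain ⟨m, hm⟩ := ha' y hy
    exact ⟨-m, by rw [QuadraticMap.polar_neg_left, hm]; push_cast; rfl⟩

/-- The discriminant group `M'/M`. Elements of the group ring `ℂ[M'/M]` are given by their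
coordinates, as functions `Disc Q M → ℂ`. -/
abbrev Disc (Q : QuadraticForm ℝ V) (M : AddSubgroup V) : Type _ :=
  dualLattice Q M ⧸ M.addSubgroupOf (dualLattice Q M)

/-- A representative in `M'` of a class in `M'/M`. -/
def rep {Q : QuadraticForm ℝ V} {M : AddSubgroup V} (γ : Disc Q M) : V :=
  (Quotient.out γ : dualLattice Q M)

/-- The vectors of the coset `γ = λ + M` in `M'`. -/
abbrev Coset {Q : QuadraticForm ℝ V} {M : AddSubgroup V} (γ : Disc Q M) : Type _ :=
  {x : dualLattice Q M // (x : Disc Q M) = γ}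

/-- The natural inner product `⟨x, y⟩` on a group ring, antilinear in the second variable. -/
def pairing {ι : Type*} (x y : ι → ℂ) : ℂ := ∑ᶠ i, x i * conj (y i)

/-! ### The Weil representation -/

/-- `ρ(T) e_γ = e(εQ(γ)) e_γ`. -/
def weilT (Q : QuadraticForm ℝ V) (ε : ℤˣ) (M : AddSubgroup V) :
    Function.End (Disc Q M → ℂ) :=
  fun x γ => e ((ε : ℤ) * (Q (rep γ) : ℂ)) * x γ

/-- `ρ(S) e_γ = √i^(ε(q-p)) |M'/M|^(-1/2) ∑_β e(-ε(β, γ)) e_β`, where `(p, q)` is the signature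
of `(M, Q)`. -/
def weilS (Q : QuadraticForm ℝ V) (ε : ℤˣ) (M : AddSubgroup V) :
    Function.End (Disc Q M → ℂ) :=
  fun x β =>
    Complex.exp (Real.pi * Complex.I / 4) ^
        ((ε : ℤ) * ((sigNeg (Q.restrict (Submodule.span ℝ (M : Set V))) : ℤ) -
          (sigPos (Q.restrict (Submodule.span ℝ (M : Set V))) : ℤ))) /
      (Real.sqrt (Nat.card (Disc Q M)) : ℂ) *
    ∑ᶠ γ : Disc Q M, e (-((ε : ℤ) * ((QuadraticMap.polar Q (rep β) (rep γ) : ℝ) : ℂ))) * x γ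

/-- The graph `{(g, ρ(g)) : g ∈ Mp₂(ℤ)}` of the Weil representation `ρ` of `(M, εQ)`: it is
generated by `(T, ρ(T))` and `(S, ρ(S))`. Since `T` and `S` have inverses among the products of
`T` and `S`, the generated submonoid is the whole graph. -/
def weilGraph (Q : QuadraticForm ℝ V) (ε : ℤˣ) (M : AddSubgroup V) :
    Submonoid (Mp2 × Function.End (Disc Q M → ℂ)) :=
  Submonoid.closure {(Mp2.T, weilT Q ε M), (Mp2.S, weilS Q ε M)}

/-! ### Vector-valued modular forms

The weight is `k = κ/2` with an integer `κ`. -/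

/-- `f` transforms like a modular form of weight `k = κ/2` for the Weil representation `ρ` of
`(M, εQ)`, that is, `φ(τ)^(-2k) ρ(A, φ)⁻¹ f(Aτ) = f(τ)` for all `(A, φ) ∈ Mp₂(ℤ)`. -/
def TransformsLike (Q : QuadraticForm ℝ V) (ε : ℤˣ) (M : AddSubgroup V) (κ : ℤ)
    (f : ℍ → Disc Q M → ℂ) : Prop :=
  ∀ g ∈ weilGraph Q ε M, ∀ (τ : ℍ) (γ : Disc Q M),
    f (g.1.mat • τ) γ = g.1.φ τ ^ κ * g.2 (f τ) γ

/-- `∂/∂u` for `τ = u + iv`. -/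
def partialU (g : ℍ → ℂ) (τ : ℍ) : ℂ := fderiv ℝ (g ∘ ofComplex) (τ : ℂ) 1

/-- `∂/∂v` for `τ = u + iv`. -/
def partialV (g : ℍ → ℂ) (τ : ℍ) : ℂ := fderiv ℝ (g ∘ ofComplex) (τ : ℂ) Complex.I

/-- `∂/∂τ̄ = (∂/∂u + i ∂/∂v)/2`. -/
def partialBar (g : ℍ → ℂ) (τ : ℍ) : ℂ := (partialU g τ + Complex.I * partialV g τ) / 2

/-- The weight `k = κ/2` Laplace operator
`-v²(∂²/∂u² + ∂²/∂v²) + ikv(∂/∂u + i ∂/∂v)`. -/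
def laplace (κ : ℤ) (g : ℍ → ℂ) (τ : ℍ) : ℂ :=
  -(τ.im : ℂ) ^ 2 * (partialU (partialU g) τ + partialV (partialV g) τ) +
    Complex.I * ((κ : ℂ) / 2) * (τ.im : ℂ) * (partialU g τ + Complex.I * partialV g τ)

/-- `ξ_k = 2i v^k conj(∂/∂τ̄)` in weight `k = κ/2`, componentwise. -/
def xi {ι : Type*} (κ : ℤ) (f : ℍ → ι → ℂ) : ℍ → ι → ℂ := fun τ γ =>
  2 * Complex.I * ((τ.im ^ ((κ : ℝ) / 2) : ℝ) : ℂ) * conj (partialBar (fun σ => f σ γ) τ)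

/-- Harmonic Maass forms, the space `H_{k,(M,εQ)}` with `k = κ/2`. -/
structure IsHarmonicMaass (Q : QuadraticForm ℝ V) (ε : ℤˣ) (M : AddSubgroup V) (κ : ℤ)
    (f : ℍ → Disc Q M → ℂ) : Prop where
  smooth : ∀ γ, ContDiffOn ℝ ∞ ((fun τ => f τ γ) ∘ ofComplex) {z : ℂ | 0 < z.im}
  harmonic : ∀ γ τ, laplace κ (fun σ => f σ γ) τ = 0
  transforms : TransformsLike Q ε M κ f
  growth : ∃ C : ℝ, ∀ γ, (fun τ => f τ γ) =O[atImInfty] fun τ => Real.exp (C * τ.im)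

/-- Holomorphic modular forms, the space `M_{k,(M,εQ)}` with `k = κ/2`. -/
structure IsModularForm (Q : QuadraticForm ℝ V) (ε : ℤˣ) (M : AddSubgroup V) (κ : ℤ)
    (f : ℍ → Disc Q M → ℂ) : Prop where
  holo : ∀ γ, MDifferentiable 𝓘(ℂ) 𝓘(ℂ) (fun τ => f τ γ)
  transforms : TransformsLike Q ε M κ f
  bdd : ∀ γ, IsBoundedAtImInfty (fun τ => f τ γ)

/-- Cusp forms, the space `S_{k,(M,εQ)}` with `k = κ/2`. -/
structure IsCuspForm (Q : QuadraticForm ℝ V) (ε : ℤˣ) (M : AddSubgroup V) (κ : ℤ)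
    (f : ℍ → Disc Q M → ℂ) : Prop extends IsModularForm Q ε M κ f where
  zero : ∀ γ, IsZeroAtImInfty (fun τ => f τ γ)

/-- The space `H^hol_{k,(M,εQ)}` of harmonic Maass forms with `ξ_k f ∈ M_{2-k,(M,-εQ)}`. -/
structure IsHarmonicMaassHol (Q : QuadraticForm ℝ V) (ε : ℤˣ) (M : AddSubgroup V) (κ : ℤ)
    (f : ℍ → Disc Q M → ℂ) : Prop extends IsHarmonicMaass Q ε M κ f where
  xi_mem : IsModularForm Q (-ε) M (4 - κ) (xi κ f)

/-- The space `H^cusp_{k,(M,εQ)}` of harmonic Maass forms with `ξ_k f ∈ S_{2-k,(M,-εQ)}`. -/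
structure IsHarmonicMaassCusp (Q : QuadraticForm ℝ V) (ε : ℤˣ) (M : AddSubgroup V) (κ : ℤ)
    (f : ℍ → Disc Q M → ℂ) : Prop extends IsHarmonicMaass Q ε M κ f where
  xi_mem : IsCuspForm Q (-ε) M (4 - κ) (xi κ f)

/-! ### Fourier expansions -/

/-- The incomplete Gamma function `Γ(s, x) = ∫_x^∞ e^(-t) t^(s-1) dt`. -/
def incGamma (s x : ℝ) : ℝ := ∫ t in Set.Ioi x, Real.exp (-t) * t ^ (s - 1)

/-- The term `a(γ, n) q^n` of a holomorphic part. -/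
def plusTerm {ι : Type*} (a : ι → ℝ → ℂ) (τ : ℍ) (γ : ι) (n : ℝ) : ℂ := a γ n * e (n * τ)

/-- The term `a(γ, n) Γ(1-k, 4π|n|v) q^n` of a non-holomorphic part, `k = κ/2`. -/
def minusTerm {ι : Type*} (κ : ℤ) (a : ι → ℝ → ℂ) (τ : ℍ) (γ : ι) (n : ℝ) : ℂ :=
  a γ n * (incGamma (1 - (κ : ℝ) / 2) (4 * Real.pi * |n| * τ.im) : ℂ) * e (n * τ)

/-- `f⁺ = ∑_γ ∑_n a(γ, n) q^n e_γ`. -/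
def holPart {ι : Type*} (a : ι → ℝ → ℂ) (τ : ℍ) : ι → ℂ := fun γ => ∑' n : ℝ, plusTerm a τ γ n

/-- `f⁻ = ∑_γ (a(γ, 0) v^(1-k) + ∑_{n < 0} a(γ, n) Γ(1-k, 4π|n|v) q^n) e_γ`, `k = κ/2`. -/
def nonholPart {ι : Type*} (κ : ℤ) (a : ι → ℝ → ℂ) (τ : ℍ) : ι → ℂ := fun γ =>
  a γ 0 * ((τ.im ^ (1 - (κ : ℝ) / 2) : ℝ) : ℂ) +
    ∑' n : Set.Iio (0 : ℝ), minusTerm κ a τ γ n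

/-- `f = f⁺ + f⁻` with holomorphic and non-holomorphic parts with coefficients `aPlus` and
`aMinus`. As `f_γ(τ + 1) = e(εQ(γ)) f_γ(τ)`, the exponents `n` lie in `εQ(γ) + ℤ`, a set of
rational numbers when `(M, Q)` is an even lattice. -/
structure HasFourierExpansion (Q : QuadraticForm ℝ V) (ε : ℤˣ) (M : AddSubgroup V) (κ : ℤ)
    (f : ℍ → Disc Q M → ℂ) (aPlus aMinus : Disc Q M → ℝ → ℂ) : Prop where
  exponent_plus : ∀ γ n, aPlus γ n ≠ 0 → ∃ m : ℤ, n = (ε : ℤ) * Q (rep γ) + m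
  exponent_minus : ∀ γ n, aMinus γ n ≠ 0 → ∃ m : ℤ, n = (ε : ℤ) * Q (rep γ) + m
  bddBelow_plus : ∃ n₀ : ℝ, ∀ γ, ∀ n < n₀, aPlus γ n = 0
  summable_plus : ∀ τ γ, Summable (plusTerm aPlus τ γ)
  summable_minus : ∀ τ γ, Summable fun n : Set.Iio (0 : ℝ) => minusTerm κ aMinus τ γ n
  eq_add : ∀ τ γ, f τ γ = holPart aPlus τ γ + nonholPart κ aMinus τ γ

/-- `c` is the constant coefficient `CT(h)` of the Fourier series `h = ∑_{n ≫ -∞} a(n) q^n`. -/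
def HasConstantTerm (h : ℍ → ℂ) (c : ℂ) : Prop :=
  ∃ a : ℤ → ℂ, (∃ n₀ : ℤ, ∀ n < n₀, a n = 0) ∧
    (∀ τ : ℍ, HasSum (fun n : ℤ => a n * e (n * τ)) (h τ)) ∧ a 0 = c

/-! ### The Grassmannian and theta functions -/

/-- The orthogonal complement `z^⊥` with respect to `Q`. -/
def perp (Q : QuadraticForm ℝ V) (z : Submodule ℝ V) : Submodule ℝ V :=
  LinearMap.BilinForm.orthogonal Q.polarBilin z

/-- The Grassmannian of positive definite subspaces of `V` of maximal dimension `p`, where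
`(p, q)` is the signature of `(V, Q)`. -/
structure Grassmannian (Q : QuadraticForm ℝ V) where
  space : Submodule ℝ V
  finrank_eq : Module.finrank ℝ space = sigPos Q
  posDef : (Q.restrict space).PosDef

lemma Grassmannian.isCompl [FiniteDimensional ℝ V] {Q : QuadraticForm ℝ V} (z : Grassmannian Q) :
    IsCompl z.space (perp Q z.space) := by
  have hr : LinearMap.BilinForm.IsRefl Q.polarBilin := fun x y h => by
    change QuadraticMap.polar Q x y = 0 at h
    change QuadraticMap.polar Q y x = 0
    rwa [QuadraticMap.polar_comm]
  have key : ∀ x : z.space, (∀ y : z.space, QuadraticMap.polar Q (x : V) (y : V) = 0) →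
      x = 0 := by
    intro x h
    by_contra hx
    have hp := z.posDef x hx
    have h2 := h x
    rw [QuadraticMap.polar_self] at h2
    change 0 < Q (x : V) at hp
    rw [two_nsmul] at h2
    linarith
  refine LinearMap.BilinForm.isCompl_orthogonal_of_restrict_nondegenerate hr ⟨?_, ?_⟩
  · intro x h
    exact key x fun y => by simpa using h y
  · intro x h
    exact key x fun y => by
      rw [QuadraticMap.polar_comm]
      simpa using h y

/-- The orthogonal projection `λ ↦ λ_z`. -/
def Grassmannian.proj [FiniteDimensional ℝ V] {Q : QuadraticForm ℝ V} (z : Grassmannian Q) :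
    V →ₗ[ℝ] V :=
  z.space.projection (perp Q z.space) z.isCompl

/-- `w` is a special point: it is defined over `ℚ`, that is, spanned by vectors of `L ⊗ ℚ`. -/
def IsSpecial {Q : QuadraticForm ℝ V} (L : AddSubgroup V) (w : Grassmannian Q) : Prop :=
  Submodule.span ℝ ((w.space : Set V) ∩ {x | ∃ m : ℤ, m ≠ 0 ∧ m • x ∈ L}) = w.space

/-- The Siegel theta function
`Θ_L(τ, z) = v^(q/2) ∑_{λ ∈ L'} e(Q(λ_z)τ + Q(λ_{z^⊥})τ̄) e_{λ+L}` of a lattice with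
`L ⊗ ℝ = V`. -/
def siegelTheta [FiniteDimensional ℝ V] (Q : QuadraticForm ℝ V) (L : AddSubgroup V)
    (z : Grassmannian Q) (τ : ℍ) : Disc Q L → ℂ := fun γ =>
  ((τ.im ^ ((sigNeg Q : ℝ) / 2) : ℝ) : ℂ) *
    ∑' x : Coset γ, e ((Q (z.proj (x.1 : V)) : ℂ) * τ +
      (Q ((x.1 : V) - z.proj (x.1 : V)) : ℂ) * conj (τ : ℂ))

/-- The theta function `∑_{λ ∈ M'} e(εQ(λ)τ) e_{λ+M}` of a positive definite lattice `(M, εQ)`.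
It is the Siegel theta function of `(M, εQ)`, as `q = 0` and the only point of the Grassmannian is
`z = M ⊗ ℝ`. -/
def thetaSeries (Q : QuadraticForm ℝ V) (ε : ℤˣ) (M : AddSubgroup V) (τ : ℍ) :
    Disc Q M → ℂ := fun γ =>
  ∑' x : Coset γ, e ((ε : ℤ) * (Q (x.1 : V) : ℂ) * τ)

/-! ### The splitting at a special point -/

section Splitting

variable {Q : QuadraticForm ℝ V} (L : AddSubgroup V) (w : Grassmannian Q)

/-- `P = L ∩ w`. -/
def posPart : AddSubgroup V := L ⊓ w.space.toAddSubgroup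

/-- `N = L ∩ w^⊥`. -/
def negPart : AddSubgroup V := L ⊓ (perp Q w.space).toAddSubgroup

/-- `P ⊕ N`. -/
def sumPart : AddSubgroup V := posPart L w ⊔ negPart L w

lemma polar_eq_zero {x y : V} (hx : x ∈ w.space) (hy : y ∈ perp Q w.space) :
    QuadraticMap.polar Q x y = 0 := by
  have h := (LinearMap.BilinForm.mem_orthogonal_iff.mp hy) x hx
  exact h

lemma span_posPart_le : Submodule.span ℝ (posPart L w : Set V) ≤ w.space :=
  Submodule.span_le.mpr fun _ hx => hx.2

lemma span_negPart_le : Submodule.span ℝ (negPart L w : Set V) ≤ perp Q w.space :=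
  Submodule.span_le.mpr fun _ hx => hx.2

lemma dual_posPart_le : dualLattice Q (posPart L w) ≤ dualLattice Q (sumPart L w) := by
  rintro x ⟨hx, hx'⟩
  refine ⟨Submodule.span_mono (SetLike.coe_subset_coe.mpr le_sup_left) hx, fun y hy => ?_⟩
  obtain ⟨p, hp, m, hm, rfl⟩ := AddSubgroup.mem_sup.mp hy
  obtain ⟨k, hk⟩ := hx' p hp
  refine ⟨k, ?_⟩
  rw [QuadraticMap.polar_add_right, hk,
    polar_eq_zero w (span_posPart_le L w hx) hm.2, add_zero]

lemma dual_negPart_le : dualLattice Q (negPart L w) ≤ dualLattice Q (sumPart L w) := by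
  rintro x ⟨hx, hx'⟩
  refine ⟨Submodule.span_mono (SetLike.coe_subset_coe.mpr le_sup_right) hx, fun y hy => ?_⟩
  obtain ⟨p, hp, m, hm, rfl⟩ := AddSubgroup.mem_sup.mp hy
  obtain ⟨k, hk⟩ := hx' m hm
  refine ⟨k, ?_⟩
  rw [QuadraticMap.polar_add_right, hk, QuadraticMap.polar_comm,
    polar_eq_zero w hp.2 (span_negPart_le L w hx), zero_add]

/-- The map `P'/P × N'/N → (P ⊕ N)'/(P ⊕ N)`, `(α, β) ↦ α + β`. -/
def glue : Disc Q (posPart L w) × Disc Q (negPart L w) →+ Disc Q (sumPart L w) :=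
  AddMonoidHom.coprod
    (QuotientAddGroup.map _ _ (AddSubgroup.inclusion (dual_posPart_le L w))
      fun _ hx => AddSubgroup.mem_sup_left (T := negPart L w) hx)
    (QuotientAddGroup.map _ _ (AddSubgroup.inclusion (dual_negPart_le L w))
      fun _ hx => AddSubgroup.mem_sup_right (S := posPart L w) hx)

/-- The identification of `ℂ[(P ⊕ N)'/(P ⊕ N)]` with `ℂ[P'/P] ⊗ ℂ[N'/N]`, whose elements are given
by their coordinates with respect to the basis `e_α ⊗ e_β`. -/
def splitCoords (x : Disc Q (sumPart L w) → ℂ) :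
    Disc Q (posPart L w) × Disc Q (negPart L w) → ℂ := fun p => x (glue L w p)

end Splitting

/-- The coordinates of `x ⊗ y` with respect to the basis `e_α ⊗ e_β`. -/
def tensor {ι ι' : Type*} (x : ι → ℂ) (y : ι' → ℂ) : ι × ι' → ℂ := fun p => x p.1 * y p.2

open Classical in
/-- The restriction map `ℂ[L'/L] → ℂ[K'/K]`, `x ↦ x_K` for `K ⊆ L ⊆ L' ⊆ K'`: `(x_K)_γ` is `x_γ̄` for
`γ ∈ L'/K` and `0` otherwise. -/
def res {Q : QuadraticForm ℝ V} (L K : AddSubgroup V) (x : Disc Q L → ℂ) : Disc Q K → ℂ :=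
  fun γ => if h : rep γ ∈ dualLattice Q L then x ((⟨rep γ, h⟩ : dualLattice Q L) : Disc Q L) else 0

/-! ### The regularized theta lift -/

/-- The fundamental domain `{|u| ≤ 1/2, |τ| ≥ 1}` of `SL₂(ℤ)`, cut off at height `v = T`. -/
def truncFD (T : ℝ) : Set ℍ := {τ | τ ∈ ModularGroup.fd ∧ τ.im ≤ T}

/-- The integral of `⟨f(τ), Θ_L(τ, z)⟩ v^k` over `truncFD T` with `k = κ/2`. The volume on `ℍ` is
the invariant measure `du dv / v²`. -/
def truncLift [FiniteDimensional ℝ V] {Q : QuadraticForm ℝ V} (L : AddSubgroup V) (κ : ℤ)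
    (f : ℍ → Disc Q L → ℂ) (z : Grassmannian Q) (T : ℝ) : ℂ :=
  ∫ τ in truncFD T, pairing (f τ) (siegelTheta Q L z τ) * ((τ.im ^ ((κ : ℝ) / 2) : ℝ) : ℂ)

/-- The regularized theta lift `Φ(f, z)`, the limit of `truncLift` as `T → ∞`. -/
def thetaLift [FiniteDimensional ℝ V] {Q : QuadraticForm ℝ V} (L : AddSubgroup V) (κ : ℤ)
    (f : ℍ → Disc Q L → ℂ) (z : Grassmannian Q) : ℂ :=
  limUnder atTop (truncLift L κ f z)

/-- The integral of `⟨Θ̃(τ) ⊗ Θ_{N⁻}(τ), ξ_k f_{P⊕N}(τ)⟩ v^(2-k)` over `truncFD T` with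
`k = κ/2`. -/
def truncXiIntegral {Q : QuadraticForm ℝ V} (L : AddSubgroup V) (κ : ℤ)
    (f : ℍ → Disc Q L → ℂ) (w : Grassmannian Q) (Θt : ℍ → Disc Q (posPart L w) → ℂ)
    (T : ℝ) : ℂ :=
  ∫ τ in truncFD T,
    pairing (tensor (Θt τ) (thetaSeries Q (-1) (negPart L w) τ))
        (splitCoords L w (xi κ (fun σ => res L (sumPart L w) (f σ)) τ)) *
      ((τ.im ^ (2 - (κ : ℝ) / 2) : ℝ) : ℂ)

end ThetaLift

end

/-!
The theta function of `L` at a special point `w` splits as `Θ_P ⊗ conj Θ_{N⁻}`, up to the power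
`v ^ (n / 2)`, so that the integrand of the lift is
`v ^ (1 / 2) ∑ f_{α + β} conj Θ_{P, α} Θ_{N⁻, β}` (`pairing_siegelTheta`).
Since `Θ_P = ξ Θ̃_P`, the factor `conj Θ_P` is the derivative `∂Θ̃_P/∂τ̄`, up to a constant and a
power of `v`. Put `h = ∑ f_{α + β} Θ̃_{P, α} Θ_{N⁻, β}` (`liftSum`). As `Θ_{N⁻}` is
holomorphic, `-2i v² ∂h/∂τ̄` is the sum of the integrand of the lift and of the integrand
`⟨Θ̃_P ⊗ Θ_{N⁻}, ξ f⟩ v ^ (2 - k)` (`truncLift_add_truncXiIntegral`).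

The function `h` has weight `2`: it is invariant under `T` (`liftSum_T`), and under `S` it acquires
the factor `τ²` (`liftSum_S`). For the latter, `f` and `Θ̃_P` transform by the Weil representation,
and `Θ_{N⁻}` by Poisson summation (`gaussian_poisson`, `exists_thetaN_S`); the finite Fourier
transforms cancel by orthogonality of characters (`contract_fourier`). It suffices to know all
constants up to a nonnegative factor, because `S` acts on `ℍ` as an involution. Hence Stokes'
theorem on the truncated fundamental domain applies: the vertical edges cancel, the arc contributes
nothing, and the upper edge gives the constant Fourier coefficient of `h` at height `T` (`stokes_truncFD`).

A harmonic Maass form whose image under `ξ` is holomorphic and bounded has the asserted Fourier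
expansion, because its Fourier coefficients solve a first order differential equation in `v`
(`exists_fourierInt_eq_add`, `IsHarmonicMaass.exists_hasFourierExpansion`). The constant coefficient
of `h` at height `T` is obtained by multiplying the three expansions (`hasSum_liftTerm`). As
`T → ∞`, the incomplete Gamma factors tend to zero, as does `v ^ (1 - 3 / 2)`, and the coefficients
of `v ^ (1 - k)` in `f` vanish because `ξ f` is a cusp form
(`HasFourierExpansion.coeff_zero_eq_zero`). By dominated convergence the limit is the constant term
of the product of the holomorphic parts (`tendsto_integral_liftSum`), and it is a finite sum because
principal parts are finite and `N` is negative definite (`finite_liftTerm`).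

Finally, the limit defining the lift exists: the constant Fourier coefficients of the integrand are
`O(v ^ (1 / 2))` (`exists_norm_integral_le`), which is integrable against `dv / v²`
(`exists_tendsto_integral_truncFD`). The limit of the integral with `ξ f` then exists as well.
-/

open UpperHalfPlane MeasureTheory Filter Topology
open scoped Manifold ContDiff ComplexConjugate MatrixGroups

noncomputable section

namespace ThetaLift

/-! ### Poisson summation and Gaussian sums over lattices -/

lemma mFourier_coe_apply {ι : Type*} [Fintype ι] (m : ι → ℤ) (t : ι → ℝ) :
    UnitAddTorus.mFourier m (fun i => (t i : UnitAddCircle)) = e (∑ i, (m i : ℂ) * t i) := by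
  simp only [UnitAddTorus.mFourier, ContinuousMap.coe_mk, fourier_coe_apply, e, Finset.mul_sum,
    Complex.exp_sum]
  refine Finset.prod_congr rfl fun i _ => ?_
  congr 1
  push_cast
  ring

/-- A function on `ℝ^ι` invariant under `ℤ^ι` takes the same value at points that agree on the
torus. -/
lemma eq_of_toTorus_eq {ι : Type*} {F : (ι → ℝ) → ℂ}
    (hF : ∀ (t : ι → ℝ) (k : ι → ℤ), F (t + fun i => (k i : ℝ)) = F t) {s t : ι → ℝ}
    (h : (fun i => (s i : UnitAddCircle)) = fun i => (t i : UnitAddCircle)) : F s = F t := by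
  have h1 : ∀ i, ∃ k : ℤ, s i = t i + k := by
    intro i
    have h2 := congrFun h i
    rw [← sub_eq_zero, ← AddCircle.coe_sub, AddCircle.coe_eq_zero_iff] at h2
    obtain ⟨k, hk⟩ := h2
    refine ⟨k, ?_⟩
    simp only [zsmul_eq_mul, mul_one] at hk
    linarith
  choose k hk using h1
  rw [← hF t k]
  congr 1
  funext i
  exact hk i

/-- Poisson summation on `ℝ^ι`, for functions whose translates by `ℤ^ι` are dominated by a
summable sequence on every ball. -/
theorem poisson_summation_pi {ι : Type*} [Fintype ι] {f : (ι → ℝ) → ℂ} (hf : Continuous f)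
    (hi : Integrable f)
    (hs : ∀ R : ℝ, ∃ u : (ι → ℤ) → ℝ, Summable u ∧
      ∀ (k : ι → ℤ) (t : ι → ℝ), ‖t‖ ≤ R → ‖f (t + fun i => (k i : ℝ))‖ ≤ u k)
    (hF : Summable fun m : ι → ℤ => ∫ t : ι → ℝ, e (∑ i, ((-m i : ℤ) : ℂ) * t i) * f t)
    (t : ι → ℝ) :
    ∑' k : ι → ℤ, f (t + fun i => (k i : ℝ)) =
      ∑' m : ι → ℤ, (∫ t : ι → ℝ, e (∑ i, ((-m i : ℤ) : ℂ) * t i) * f t) *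
        e (∑ i, (m i : ℂ) * t i) := by
  classical
  set F : (ι → ℝ) → ℂ := fun t => ∑' k : ι → ℤ, f (t + fun i => (k i : ℝ)) with hFdef
  have hper : ∀ (t : ι → ℝ) (k : ι → ℤ), F (t + fun i => (k i : ℝ)) = F t := by
    intro t k
    simp only [hFdef]
    rw [← (Equiv.addLeft k).tsum_eq fun l : ι → ℤ => f (t + fun i => (l i : ℝ))]
    refine tsum_congr fun l => ?_
    congr 1
    funext i
    simp [add_assoc]
  have hcont : Continuous F := by
    refine continuous_iff_continuousAt.2 fun t₀ => ?_
    obtain ⟨u, hu, hle⟩ := hs (‖t₀‖ + 1)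
    have h1 : ContinuousOn F (Metric.closedBall 0 (‖t₀‖ + 1)) := by
      refine continuousOn_tsum (u := u) (fun k => ?_) hu fun k t ht => hle k t (by simpa using ht)
      exact (hf.comp (continuous_id.add continuous_const)).continuousOn
    refine h1.continuousAt (Filter.mem_of_superset
      (Metric.ball_mem_nhds t₀ one_pos) fun x hx => ?_)
    have := norm_le_norm_add_norm_sub' x t₀
    simp only [Metric.mem_ball, dist_eq_norm] at hx
    simp only [Metric.mem_closedBall, dist_zero_right]
    linarith
  let π : (ι → ℝ) → UnitAddTorus ι := fun t i => (t i : UnitAddCircle)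
  have hq : IsOpenQuotientMap π :=
    IsOpenQuotientMap.piMap (f := fun _ : ι => ((↑) : ℝ → UnitAddCircle)) fun _ =>
      QuotientAddGroup.isOpenQuotientMap_mk
  let G : UnitAddTorus ι → ℂ := fun θ => F (Function.surjInv hq.surjective θ)
  have hG : ∀ t, G (π t) = F t := fun t =>
    eq_of_toTorus_eq hper (Function.surjInv_eq hq.surjective (π t))
  have hGc : Continuous G := by
    rw [hq.isQuotientMap.continuous_iff]
    exact hcont.congr fun t => (hG t).symm
  have hcoeff : ∀ m : ι → ℤ, UnitAddTorus.mFourierCoeff (⟨G, hGc⟩ : C(UnitAddTorus ι, ℂ)) m =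
      ∫ t : ι → ℝ, e (∑ i, ((-m i : ℤ) : ℂ) * t i) * f t := by
    intro m
    set g : (ι → ℝ) → ℂ := fun t => e (∑ i, ((-m i : ℤ) : ℂ) * t i) * f t with hg
    have hec : Continuous fun t : ι → ℝ => e (∑ i, ((-m i : ℤ) : ℂ) * t i) := by
      unfold e; fun_prop
    have hen : ∀ t : ι → ℝ, ‖e (∑ i, ((-m i : ℤ) : ℂ) * t i)‖ = 1 := by
      intro t
      rw [e, Complex.norm_exp]
      simp
    have hgc : Continuous g := hec.mul hf
    have hgn : ∀ t, ‖g t‖ = ‖f t‖ := fun t => by rw [hg, norm_mul, hen, one_mul]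
    have hgi : Integrable g := by
      refine hi.mono hgc.aestronglyMeasurable (ae_of_all _ fun t => (hgn t).le)
    have hgk : ∀ (t : ι → ℝ) (k : ι → ℤ), g (t + fun i => (k i : ℝ)) =
        e (∑ i, ((-m i : ℤ) : ℂ) * t i) * f (t + fun i => (k i : ℝ)) := by
      intro t k
      simp only [hg]
      congr 1
      have h2 : (∑ i, ((-m i : ℤ) : ℂ) * ((t + fun i => (k i : ℝ)) i : ℝ)) =
          (∑ i, ((-m i : ℤ) : ℂ) * t i) + ((∑ i, -m i * k i : ℤ) : ℂ) := by
        push_cast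
        rw [← Finset.sum_add_distrib]
        refine Finset.sum_congr rfl fun i _ => ?_
        simp only [Pi.add_apply]
        push_cast
        ring
      rw [h2, e, mul_add, Complex.exp_add, mul_comm _ (((∑ i, -m i * k i : ℤ) : ℂ)),
        Complex.exp_int_mul_two_pi_mul_I, mul_one]
      rfl
    let b := Pi.basisFun ℝ ι
    have hfd := ZSpan.isAddFundamentalDomain b (volume : Measure (ι → ℝ))
    have hD : ZSpan.fundamentalDomain b =ᵐ[volume] Set.Icc (0 : ι → ℝ) 1 := by
      rw [ZSpan.fundamentalDomain_pi_basisFun]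
      exact Measure.univ_pi_Ico_ae_eq_Icc
    have hD' : {x : ι → ℝ | ∀ i, x i ∈ Set.Ioc ((0 : ι → ℝ) i) ((0 : ι → ℝ) i + 1)} =ᵐ[volume]
        Set.Icc (0 : ι → ℝ) 1 := by
      have : {x : ι → ℝ | ∀ i, x i ∈ Set.Ioc ((0 : ι → ℝ) i) ((0 : ι → ℝ) i + 1)} =
        Set.univ.pi fun i => Set.Ioc ((0 : ι → ℝ) i) ((1 : ι → ℝ) i) := by
        ext x; simp [Set.mem_pi]
      rw [this]
      exact Measure.univ_pi_Ioc_ae_eq_Icc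
    let φ : (ι → ℤ) ≃ Submodule.span ℤ (Set.range b) :=
      (b.restrictScalars ℤ).equivFun.symm.toEquiv
    have hφ : ∀ k, ((φ k : Submodule.span ℤ (Set.range b)) : ι → ℝ) = fun i => (k i : ℝ) := by
      intro k
      funext j
      simp only [φ, LinearEquiv.coe_toEquiv, Module.Basis.equivFun_symm_apply,
        Submodule.coe_sum, Submodule.coe_smul, Module.Basis.restrictScalars_apply, b,
        Finset.sum_apply, Pi.basisFun_apply, Pi.smul_apply]
      simp [Pi.single_apply]
    have : VAddInvariantMeasure (Submodule.span ℤ (Set.range b)) (ι → ℝ) volume :=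
      ⟨fun c s _ => measure_preimage_add volume (c : ι → ℝ) s⟩
    rw [UnitAddTorus.mFourierCoeff_eq_integral _ m 0, setIntegral_congr_set hD',
      hfd.integral_eq_tsum'' g hgi, ← φ.tsum_eq]
    have hterm : ∀ k : ι → ℤ, (∫ x in ZSpan.fundamentalDomain b, g (φ k +ᵥ x)) =
        ∫ x in Set.Icc (0 : ι → ℝ) 1, g (x + fun i => (k i : ℝ)) := by
      intro k
      rw [setIntegral_congr_set hD]
      refine integral_congr_ae (ae_of_all _ fun x => ?_)
      simp only [Submodule.vadd_def, hφ, vadd_eq_add, add_comm]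
    rw [tsum_congr hterm]
    obtain ⟨u, hu, hle⟩ := hs 1
    have hball : ∀ x ∈ Set.Icc (0 : ι → ℝ) 1, ‖x‖ ≤ 1 := by
      intro x hx
      rw [pi_norm_le_iff_of_nonneg zero_le_one]
      intro i
      rw [Real.norm_eq_abs, abs_le]
      have h1 := hx.1 i
      have h2 := hx.2 i
      simp only [Pi.zero_apply, Pi.one_apply] at h1 h2
      constructor <;> linarith
    have hgkc : ∀ k : ι → ℤ, Continuous fun x : ι → ℝ => g (x + fun i => (k i : ℝ)) := fun k =>
      hgc.comp (continuous_id.add continuous_const)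
    have hsum := hasSum_integral_of_summable_integral_norm
      (μ := volume.restrict (Set.Icc (0 : ι → ℝ) 1))
      (F := fun (k : ι → ℤ) (x : ι → ℝ) => g (x + fun i => (k i : ℝ)))
      (fun k => ((hgkc k).continuousOn.integrableOn_compact isCompact_Icc)) (by
        refine Summable.of_nonneg_of_le (fun k => integral_nonneg fun _ => norm_nonneg _)
          (fun k => ?_) (hu.mul_right ((volume (Set.Icc (0 : ι → ℝ) 1)).toReal))
        have h3 := norm_setIntegral_le_of_norm_le_const (μ := volume) (C := u k)
          (f := fun x : ι → ℝ => ‖g (x + fun i => (k i : ℝ))‖) (s := Set.Icc (0 : ι → ℝ) 1)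
          isCompact_Icc.measure_lt_top (fun x hx => by
            rw [norm_norm, hgn]; exact hle k x (hball x hx))
        exact (le_abs_self _).trans h3)
    rw [hsum.tsum_eq]
    refine integral_congr_ae (ae_of_all _ fun x => ?_)
    simp only [hgk, tsum_mul_left, ContinuousMap.coe_mk, smul_eq_mul]
    have h5 := mFourier_coe_apply (-m) x
    simp only [Pi.neg_apply] at h5
    rw [h5]
    congr 1
    exact hG x
  have hsm : Summable (UnitAddTorus.mFourierCoeff (⟨G, hGc⟩ : C(UnitAddTorus ι, ℂ))) :=
    hF.congr fun m => (hcoeff m).symm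
  have := (UnitAddTorus.hasSum_mFourier_series_apply_of_summable hsm (π t)).tsum_eq
  simp only [smul_eq_mul, ContinuousMap.coe_mk] at this hcoeff
  rw [hG] at this
  rw [← show F t = ∑' k : ι → ℤ, f (t + fun i => (k i : ℝ)) from rfl, ← this]
  exact tsum_congr fun m => by rw [hcoeff, ← mFourier_coe_apply]

section Gaussian

variable {ι W : Type*} [Fintype ι] [NormedAddCommGroup W] [InnerProductSpace ℝ W]

lemma exp_neg_mul_sq_le {c : ℝ} (hc : 0 < c) (N : ℕ) {x : ℝ} (hx : 0 < x) :
    Real.exp (-c * x ^ 2) ≤ (N.factorial / c ^ N) * x⁻¹ ^ (2 * N) := by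
  have h1 := Real.pow_div_factorial_le_exp (c * x ^ 2) (by positivity) N
  have hcx : 0 < (c * x ^ 2) ^ N / N.factorial := by positivity
  rw [neg_mul, Real.exp_neg]
  refine (inv_anti₀ hcx h1).trans_eq ?_
  rw [inv_pow, pow_mul, mul_pow]
  field_simp

/-- A Gaussian is summable over a lattice. -/
lemma summable_gaussian [FiniteDimensional ℝ W] (b : Module.Basis ι ℝ W) {c : ℝ} (hc : 0 < c) :
    Summable fun k : ι → ℤ => Real.exp (-c * ‖∑ i, (k i : ℝ) • b i‖ ^ 2) := by
  let Λ := Submodule.span ℤ (Set.range b)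
  let φ : (ι → ℤ) ≃ Λ := (b.restrictScalars ℤ).equivFun.symm.toEquiv
  have hφ : ∀ k, ((φ k : Λ) : W) = ∑ i, (k i : ℝ) • b i := by
    intro k
    simp [φ, Module.Basis.equivFun_symm_apply, Int.cast_smul_eq_zsmul]
  set N := Module.finrank ℤ Λ + 1
  have h1 := ZLattice.summable_norm_pow_inv Λ (2 * N) (by omega)
  suffices h : Summable fun z : Λ => Real.exp (-c * ‖(z : W)‖ ^ 2) by
    refine (φ.summable_iff.2 h).congr fun k => ?_
    simp only [Function.comp_apply, hφ]
  refine Summable.of_norm_bounded_eventually (h1.mul_left (N.factorial / c ^ N)) ?_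
  refine Set.Finite.subset (Set.finite_singleton (0 : Λ)) fun z hz => ?_
  by_contra h0
  refine hz ?_
  change ‖Real.exp _‖ ≤ _
  rw [Real.norm_eq_abs, abs_of_pos (Real.exp_pos _)]
  exact exp_neg_mul_sq_le hc N (norm_pos_iff.2 fun h => h0 (Subtype.ext h))

variable [FiniteDimensional ℝ W] [DecidableEq ι]

/-- Poisson summation for a Gaussian over a translate of a lattice. The constant `c` is the inverse
of the covolume; only its sign matters later. -/
theorem gaussian_poisson (b b' : Module.Basis ι ℝ W)
    (hb : ∀ i j, inner ℝ (b' i) (b j) = if i = j then (1 : ℝ) else 0) :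
    ∃ c : ℝ, 0 ≤ c ∧ ∀ B : ℂ, 0 < B.re → ∀ x : W,
      ∑' k : ι → ℤ, Complex.exp (-B * (‖x + ∑ i, (k i : ℝ) • b i‖ : ℂ) ^ 2) =
        c * (Real.pi / B) ^ (Module.finrank ℝ W / 2 : ℂ) *
          ∑' m : ι → ℤ, Complex.exp (-Real.pi ^ 2 * (‖∑ i, (m i : ℝ) • b' i‖ : ℂ) ^ 2 / B) *
            e (inner ℝ x (∑ i, (m i : ℝ) • b' i) : ℝ) := by
  borelize W
  let E : (ι → ℝ) ≃L[ℝ] W := b.equivFun.symm.toContinuousLinearEquiv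
  have hE : ∀ t, E t = ∑ i, t i • b i := fun t => b.equivFun_symm_apply t
  have hEm : MeasurableEmbedding E := E.toHomeomorph.measurableEmbedding
  obtain ⟨c, hmap⟩ : ∃ c : NNReal, Measure.map E volume = c • (volume : Measure W) := by
    have : (Measure.map E volume).IsAddHaarMeasure := E.isAddHaarMeasure_map volume
    exact ⟨_, Measure.isAddLeftInvariant_eq_smul _ _⟩
  have hint : ∀ g : W → ℂ, ∫ t : ι → ℝ, g (E t) = (c : ℝ) * ∫ w : W, g w := by
    intro g
    rw [← hEm.integral_map, hmap, integral_smul_nnreal_measure]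
    rfl
  refine ⟨c, c.2, fun B hB x => ?_⟩
  have hB0 : B ≠ 0 := by rintro rfl; simp at hB
  have hpair : ∀ (m : ι → ℤ) (t : ι → ℝ),
      inner ℝ (∑ i, (m i : ℝ) • b' i) (E t) = ∑ i, (m i : ℝ) * t i := by
    intro m t
    rw [hE, sum_inner]
    refine Finset.sum_congr rfl fun i _ => ?_
    simp [inner_sum, inner_smul_left, inner_smul_right, hb, mul_comm]
  let f : (ι → ℝ) → ℂ := fun t => Complex.exp (-B * (‖E t‖ : ℂ) ^ 2)
  have hfc : Continuous f := by
    have := E.continuous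
    simp only [f]
    fun_prop
  have hcoef : ∀ m : ι → ℤ, (∫ t : ι → ℝ, e (∑ i, ((-m i : ℤ) : ℂ) * t i) * f t) =
      c * ((Real.pi / B) ^ (Module.finrank ℝ W / 2 : ℂ) *
        Complex.exp (-Real.pi ^ 2 * (‖∑ i, (m i : ℝ) • b' i‖ : ℂ) ^ 2 / B)) := by
    intro m
    have h1 := GaussianFourier.integral_cexp_neg_mul_sq_norm_add hB (-(2 * Real.pi * Complex.I))
      (∑ i, (m i : ℝ) • b' i)
    have h2 : (-(2 * Real.pi * Complex.I)) ^ 2 * (‖∑ i, (m i : ℝ) • b' i‖ : ℂ) ^ 2 / (4 * B) =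
        -Real.pi ^ 2 * (‖∑ i, (m i : ℝ) • b' i‖ : ℂ) ^ 2 / B := by
      field_simp
      rw [Complex.I_sq]
      ring
    rw [h2] at h1
    rw [← h1, ← hint]
    refine integral_congr_ae (ae_of_all _ fun t => ?_)
    simp only [f, e]
    rw [← Complex.exp_add, hpair, add_comm]
    congr 2
    push_cast
    simp only [neg_mul, Finset.sum_neg_distrib]
    ring
  have hlow : ∀ R : ℝ, ∀ (k : ι → ℤ) (t : ι → ℝ), ‖E t‖ ≤ R →
      ‖f (t + fun i => (k i : ℝ))‖ ≤
        Real.exp (B.re * R ^ 2) * Real.exp (-(B.re / 2) * ‖∑ i, (k i : ℝ) • b i‖ ^ 2) := by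
    intro R k t ht
    simp only [f, Complex.norm_exp, map_add]
    rw [← Real.exp_add, Real.exp_le_exp, hE fun i => (k i : ℝ)]
    set y := ∑ i, (k i : ℝ) • b i
    have h3 : (-B * (‖E t + y‖ : ℂ) ^ 2).re = -B.re * ‖E t + y‖ ^ 2 := by
      rw [← Complex.ofReal_pow, Complex.re_mul_ofReal, Complex.neg_re]
    rw [h3]
    have h4 : ‖y‖ ≤ ‖E t + y‖ + R := by
      have := norm_sub_le (E t + y) (E t)
      rw [add_sub_cancel_left] at this
      linarith
    have h5 : ‖y‖ ^ 2 ≤ 2 * ‖E t + y‖ ^ 2 + 2 * R ^ 2 := by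
      have : ‖y‖ ^ 2 ≤ (‖E t + y‖ + R) ^ 2 := pow_le_pow_left₀ (norm_nonneg _) h4 2
      nlinarith [sq_nonneg (‖E t + y‖ - R)]
    nlinarith
  have hgs := summable_gaussian b (half_pos hB)
  have hi : Integrable f := by
    have h1 := (GaussianFourier.integrable_cexp_neg_mul_sq_norm_add (V := W) hB 0
      0).smul_measure_nnreal (c := c)
    rw [← hmap, hEm.integrable_map_iff] at h1
    simpa [Function.comp_def, f] using h1
  have hs : ∀ R : ℝ, ∃ u : (ι → ℤ) → ℝ, Summable u ∧
      ∀ (k : ι → ℤ) (t : ι → ℝ), ‖t‖ ≤ R → ‖f (t + fun i => (k i : ℝ))‖ ≤ u k := by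
    intro R
    refine ⟨_, hgs.mul_left (Real.exp (B.re * (‖(E : (ι → ℝ) →L[ℝ] W)‖ * R) ^ 2)),
      fun k t ht => hlow _ k t ?_⟩
    exact ((E : (ι → ℝ) →L[ℝ] W).le_opNorm t).trans
      (mul_le_mul_of_nonneg_left ht (norm_nonneg _))
  have hF : Summable fun m : ι → ℤ => ∫ t : ι → ℝ, e (∑ i, ((-m i : ℤ) : ℂ) * t i) * f t := by
    have hr : 0 < Real.pi ^ 2 * (B⁻¹).re := by
      rw [Complex.inv_re]
      have := Complex.normSq_pos.2 hB0
      positivity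
    have h7 : Summable fun m : ι → ℤ =>
        Complex.exp (-Real.pi ^ 2 * (‖∑ i, (m i : ℝ) • b' i‖ : ℂ) ^ 2 / B) := by
      refine Summable.of_norm ((summable_gaussian b' hr).congr fun m => ?_)
      rw [Complex.norm_exp]
      congr 1
      rw [div_eq_mul_inv, ← Complex.ofReal_pow, ← Complex.ofReal_pow, ← Complex.ofReal_neg,
        ← Complex.ofReal_mul, Complex.re_ofReal_mul]
      ring
    exact ((h7.mul_left _).mul_left _).congr fun m => (hcoef m).symm
  have key := poisson_summation_pi hfc hi hs hF (E.symm x)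
  have hl : ∀ k : ι → ℤ, f (E.symm x + fun i => (k i : ℝ)) =
      Complex.exp (-B * (‖x + ∑ i, (k i : ℝ) • b i‖ : ℂ) ^ 2) := by
    intro k
    simp only [f, map_add, E.apply_symm_apply, hE fun i => (k i : ℝ)]
  simp only [hl, hcoef] at key
  rw [key, ← tsum_mul_left]
  refine tsum_congr fun m => ?_
  have h6 : (∑ i, (m i : ℂ) * (E.symm x i : ℝ)) =
      ((inner ℝ x (∑ i, (m i : ℝ) • b' i) : ℝ) : ℂ) := by
    rw [real_inner_comm]
    conv_rhs => rw [← E.apply_symm_apply x, hpair]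
    push_cast
    rfl
  rw [h6]
  ring

end Gaussian

/-! ### Geometry of the lattice at a special point -/

section Geometry

variable {V : Type*} [AddCommGroup V] [Module ℝ V] [FiniteDimensional ℝ V]
  {Q : QuadraticForm ℝ V} (w : Grassmannian Q)

lemma Grassmannian.proj_mem (x : V) : w.proj x ∈ w.space :=
  Submodule.projection_apply_mem _ x

lemma Grassmannian.proj_of_mem {x : V} (hx : x ∈ w.space) : w.proj x = x :=
  Submodule.projection_apply_of_mem_left _ hx

lemma Grassmannian.proj_of_mem_perp {x : V} (hx : x ∈ perp Q w.space) : w.proj x = 0 :=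
  (Submodule.projection_apply_eq_zero_iff _).2 hx

lemma Grassmannian.sub_proj_mem (x : V) : x - w.proj x ∈ perp Q w.space := by
  rw [← Submodule.projection_apply_eq_zero_iff w.isCompl]
  change w.proj (x - w.proj x) = 0
  rw [map_sub, w.proj_of_mem (w.proj_mem x), sub_self]

omit [FiniteDimensional ℝ V] in
lemma map_add_of_mem {x y : V} (hx : x ∈ w.space) (hy : y ∈ perp Q w.space) :
    Q (x + y) = Q x + Q y := by
  have h := polar_eq_zero w hx hy
  rw [QuadraticMap.polar] at h
  linarith

lemma map_eq_add (x : V) : Q x = Q (w.proj x) + Q (x - w.proj x) := by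
  rw [← map_add_of_mem w (w.proj_mem x) (w.sub_proj_mem x), add_sub_cancel]

omit [FiniteDimensional ℝ V] in
lemma map_pos_of_mem {x : V} (hx : x ∈ w.space) (h0 : x ≠ 0) : 0 < Q x :=
  w.posDef ⟨x, hx⟩ fun h => h0 (congrArg Subtype.val h)

omit [FiniteDimensional ℝ V] in
lemma map_nonneg_of_mem {x : V} (hx : x ∈ w.space) : 0 ≤ Q x := by
  by_cases h0 : x = 0
  · simp [h0]
  · exact (map_pos_of_mem w hx h0).le

/-- On the complement of a maximal positive definite subspace of a nondegenerate space the form is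
negative definite: a negative definite subspace of maximal dimension projects onto it, and the
projection does not increase `Q`. -/
lemma map_neg_of_mem_perp (hfin : Module.finrank ℝ V = sigPos Q + sigNeg Q) {x : V}
    (hx : x ∈ perp Q w.space) (h0 : x ≠ 0) : Q x < 0 := by
  obtain ⟨U, hU, hneg⟩ := (sigNeg_isGreatest Q).1
  have hUneg : ∀ y ∈ U, y ≠ 0 → Q y < 0 := by
    intro y hy hy0
    have := hneg ⟨y, hy⟩ fun h => hy0 (congrArg Subtype.val h)
    change 0 < -Q y at this
    linarith
  let g : U →ₗ[ℝ] perp Q w.space :=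
    ((LinearMap.id - w.proj).comp U.subtype).codRestrict _ fun y => w.sub_proj_mem y
  have hle : ∀ y : V, Q (y - w.proj y) ≤ Q y := by
    intro y
    rw [map_eq_add w y]
    by_cases h : w.proj y = 0
    · simp [h]
    · linarith [map_pos_of_mem w (w.proj_mem y) h]
  have hginj : Function.Injective g := by
    rw [← LinearMap.ker_eq_bot, LinearMap.ker_eq_bot']
    intro y hy
    by_contra hy0
    have hy0' : (y : V) ≠ 0 := fun h => hy0 (Subtype.ext h)
    have h1 : (y : V) - w.proj y = 0 := congrArg Subtype.val hy
    have h2 : (y : V) ∈ w.space := by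
      rw [sub_eq_zero.1 h1]
      exact w.proj_mem _
    exact lt_asymm (hUneg y y.2 hy0') (map_pos_of_mem w h2 hy0')
  have hdim : Module.finrank ℝ U = Module.finrank ℝ (perp Q w.space) := by
    have h1 := Submodule.finrank_add_eq_of_isCompl w.isCompl
    rw [w.finrank_eq] at h1
    omega
  have hgsurj : Function.Surjective g :=
    (LinearMap.injective_iff_surjective_of_finrank_eq_finrank hdim).1 hginj
  obtain ⟨y, hy⟩ := hgsurj ⟨x, hx⟩
  have h1 : (y : V) - w.proj y = x := congrArg Subtype.val hy
  have hy0 : (y : V) ≠ 0 := by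
    intro h
    rw [h, map_zero, sub_zero] at h1
    exact h0 h1.symm
  rw [← h1]
  exact (hle y).trans_lt (hUneg y y.2 hy0)

end Geometry

/-- The pair of an even lattice `L` of signature `(1, n)` and a special point `w`. -/
structure IsSpecialSetting {V : Type*} [AddCommGroup V] [Module ℝ V]
    (Q : QuadraticForm ℝ V) (L : AddSubgroup V) (n : ℕ) (w : Grassmannian Q) : Prop where
  lattice : IsEvenLattice Q L 1 n
  special : IsSpecial L w

namespace IsSpecialSetting

variable {V : Type*} [AddCommGroup V] [Module ℝ V] [FiniteDimensional ℝ V]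
  {Q : QuadraticForm ℝ V} {L : AddSubgroup V} {n : ℕ} {w : Grassmannian Q}
  (H : IsSpecialSetting Q L n w)

include H

omit [FiniteDimensional ℝ V] in
lemma finrank_eq : Module.finrank ℝ V = sigPos Q + sigNeg Q := by
  obtain ⟨b, -⟩ := H.lattice.basis
  rw [H.lattice.sigPos_eq, H.lattice.sigNeg_eq, Module.finrank_eq_card_basis b, Fintype.card_fin]

lemma map_neg {x : V} (hx : x ∈ perp Q w.space) (h0 : x ≠ 0) : Q x < 0 :=
  map_neg_of_mem_perp w H.finrank_eq hx h0

lemma map_nonpos {x : V} (hx : x ∈ perp Q w.space) : Q x ≤ 0 := by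
  by_cases h0 : x = 0
  · simp [h0]
  · exact (H.map_neg hx h0).le

omit [FiniteDimensional ℝ V] in
lemma finrank_space : Module.finrank ℝ w.space = 1 := by
  rw [w.finrank_eq, H.lattice.sigPos_eq]

lemma finrank_perp : Module.finrank ℝ (perp Q w.space) = n := by
  have h1 := Submodule.finrank_add_eq_of_isCompl w.isCompl
  have h2 := H.finrank_eq
  rw [H.lattice.sigPos_eq, H.lattice.sigNeg_eq] at h2
  rw [H.finrank_space] at h1
  omega

lemma nondegenerate : LinearMap.BilinForm.Nondegenerate Q.polarBilin := by
  have key : ∀ x : V, (∀ y, QuadraticMap.polar Q x y = 0) → x = 0 := by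
    intro x hx
    have hp : ∀ y ∈ w.space, QuadraticMap.polar Q (w.proj x) y = 0 := by
      intro y hy
      have := hx y
      rwa [← add_sub_cancel (w.proj x) x, QuadraticMap.polar_add_left,
        QuadraticMap.polar_comm _ (x - w.proj x), polar_eq_zero w hy (w.sub_proj_mem x),
        add_zero] at this
    have hn : ∀ y ∈ perp Q w.space, QuadraticMap.polar Q (x - w.proj x) y = 0 := by
      intro y hy
      have := hx y
      rwa [← add_sub_cancel (w.proj x) x, QuadraticMap.polar_add_left,
        polar_eq_zero w (w.proj_mem x) hy, zero_add] at this
    have h1 : w.proj x = 0 := by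
      by_contra h
      have h2 := hp _ (w.proj_mem x)
      rw [QuadraticMap.polar_self, two_nsmul] at h2
      linarith [map_pos_of_mem w (w.proj_mem x) h]
    have h2 : x - w.proj x = 0 := by
      by_contra h
      have h2 := hn _ (w.sub_proj_mem x)
      rw [QuadraticMap.polar_self, two_nsmul] at h2
      linarith [H.map_neg (w.sub_proj_mem x) h]
    rwa [h1, sub_zero] at h2
  exact ⟨fun x hx => key x hx, fun x hx => key x fun y => by
    rw [QuadraticMap.polar_comm]; exact hx y⟩

omit [FiniteDimensional ℝ V] in
lemma polar_int {x y : V} (hx : x ∈ L) (hy : y ∈ L) :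
    ∃ m : ℤ, QuadraticMap.polar Q x y = m := by
  obtain ⟨a, ha⟩ := H.lattice.even _ (L.add_mem hx hy)
  obtain ⟨b, hb⟩ := H.lattice.even _ hx
  obtain ⟨c, hc⟩ := H.lattice.even _ hy
  exact ⟨a - b - c, by rw [QuadraticMap.polar, ha, hb, hc]; push_cast; ring⟩

omit [FiniteDimensional ℝ V] in
lemma span_eq_top : Submodule.span ℝ (L : Set V) = ⊤ := by
  obtain ⟨b, hb⟩ := H.lattice.basis
  rw [eq_top_iff, ← b.span_eq]
  refine Submodule.span_mono ?_
  rw [hb]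
  exact AddSubgroup.subset_closure

omit [FiniteDimensional ℝ V] in
lemma span_posPart : Submodule.span ℝ (posPart L w : Set V) = w.space := by
  refine le_antisymm (span_posPart_le L w) ?_
  conv_lhs => rw [← H.special]
  rw [Submodule.span_le]
  rintro x ⟨hx, m, hm, hmx⟩
  have hm' : (m : ℝ) ≠ 0 := by exact_mod_cast hm
  have h1 : (m : ℝ) • x ∈ posPart L w := by
    rw [Int.cast_smul_eq_zsmul]
    exact ⟨hmx, w.space.toAddSubgroup.zsmul_mem hx m⟩
  rw [← inv_smul_smul₀ hm' x]
  exact Submodule.smul_mem _ _ (Submodule.subset_span h1)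

omit [FiniteDimensional ℝ V] in
lemma exists_pos_vector : ∃ p ∈ posPart L w, p ≠ 0 := by
  by_contra! h
  have h1 : Submodule.span ℝ (posPart L w : Set V) = ⊥ := by
    rw [Submodule.span_eq_bot]
    exact h
  have h2 := H.finrank_space
  rw [← H.span_posPart, h1, finrank_bot] at h2
  exact zero_ne_one h2

/-- `P ⊕ N` has finite index in `L`: with `p` a generator of the line `w` and `D = (p, p)`, the
vector `Dx` is the sum of `(x, p)p ∈ P` and of `Dx - (x, p)p ∈ N`. -/
lemma exists_smul_mem : ∃ D : ℤ, D ≠ 0 ∧ ∀ x ∈ L,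
    D • w.proj x ∈ posPart L w ∧ D • (x - w.proj x) ∈ negPart L w := by
  obtain ⟨p, hp, hp0⟩ := H.exists_pos_vector
  obtain ⟨d, hd⟩ := H.polar_int hp.1 hp.1
  have hQp := map_pos_of_mem w hp.2 hp0
  have hd2 : (d : ℝ) = 2 * Q p := by
    rw [← hd, QuadraticMap.polar_self, two_nsmul]
    ring
  have hd0 : d ≠ 0 := by
    rintro rfl
    push_cast at hd2
    linarith
  refine ⟨d, hd0, fun x hx => ?_⟩
  obtain ⟨m, hm⟩ := H.polar_int hx hp.1
  -- the projection to the line is `(x, p) / (p, p) • p`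
  have hproj : d • w.proj x = m • p := by
    obtain ⟨c, hc⟩ := (finrank_eq_one_iff_of_nonzero' (⟨p, hp.2⟩ : w.space)
      (fun h => hp0 (congrArg Subtype.val h))).1 H.finrank_space ⟨w.proj x, w.proj_mem x⟩
    have hc' : c • p = w.proj x := congrArg Subtype.val hc
    have h1 : QuadraticMap.polar Q x p = c * d := by
      conv_lhs => rw [← add_sub_cancel (w.proj x) x, QuadraticMap.polar_add_left,
        QuadraticMap.polar_comm _ (x - w.proj x), polar_eq_zero w hp.2 (w.sub_proj_mem x),
        add_zero, ← hc', QuadraticMap.polar_smul_left, hd]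
      rfl
    rw [← hc', ← Int.cast_smul_eq_zsmul ℝ, ← Int.cast_smul_eq_zsmul ℝ, smul_smul, ← hm, h1,
      mul_comm]
  have hP : d • w.proj x ∈ posPart L w := by
    rw [hproj]
    exact (posPart L w).zsmul_mem hp m
  refine ⟨hP, ?_, (perp Q w.space).toAddSubgroup.zsmul_mem (w.sub_proj_mem x) d⟩
  change d • (x - w.proj x) ∈ L
  rw [smul_sub]
  exact L.sub_mem (L.zsmul_mem hx d) hP.1

lemma span_negPart : Submodule.span ℝ (negPart L w : Set V) = perp Q w.space := by
  refine le_antisymm (span_negPart_le L w) fun x hx => ?_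
  obtain ⟨D, hD, hDL⟩ := H.exists_smul_mem
  have hD' : (D : ℝ) ≠ 0 := by exact_mod_cast hD
  have h1 : ∀ y ∈ Submodule.span ℝ (L : Set V),
      y - w.proj y ∈ Submodule.span ℝ (negPart L w : Set V) := by
    intro y hy
    induction hy using Submodule.span_induction with
    | mem y hy =>
      rw [← inv_smul_smul₀ hD' (y - w.proj y), Int.cast_smul_eq_zsmul]
      exact Submodule.smul_mem _ _ (Submodule.subset_span (hDL y hy).2)
    | zero => simp
    | add a b _ _ ha hb =>
      rw [map_add, add_sub_add_comm]
      exact Submodule.add_mem _ ha hb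
    | smul a x _ hx =>
      rw [map_smul, ← smul_sub]
      exact Submodule.smul_mem _ _ hx
  have h2 := h1 x (by rw [H.span_eq_top]; trivial)
  rwa [w.proj_of_mem_perp hx, sub_zero] at h2

lemma span_sumPart : Submodule.span ℝ (sumPart L w : Set V) = ⊤ := by
  rw [eq_top_iff, ← w.isCompl.sup_eq_top, sup_le_iff, ← H.span_negPart]
  refine ⟨?_, Submodule.span_mono (SetLike.coe_subset_coe.mpr le_sup_right)⟩
  conv_lhs => rw [← H.span_posPart]
  exact Submodule.span_mono (SetLike.coe_subset_coe.mpr le_sup_left)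

omit [FiniteDimensional ℝ V] H in
lemma sumPart_le : sumPart L w ≤ L := sup_le inf_le_left inf_le_left

omit [FiniteDimensional ℝ V] in
lemma mem_dualLattice {x : V} :
    x ∈ dualLattice Q L ↔ ∀ y ∈ L, ∃ m : ℤ, QuadraticMap.polar Q x y = m :=
  ⟨fun h => h.2, fun h => ⟨by rw [H.span_eq_top]; trivial, h⟩⟩

lemma mem_dual_sumPart {x : V} :
    x ∈ dualLattice Q (sumPart L w) ↔
      ∀ y ∈ sumPart L w, ∃ m : ℤ, QuadraticMap.polar Q x y = m :=
  ⟨fun h => h.2, fun h => ⟨by rw [H.span_sumPart]; trivial, h⟩⟩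

omit [FiniteDimensional ℝ V] in
lemma le_dual : L ≤ dualLattice Q L := fun _ hx =>
  H.mem_dualLattice.2 fun _ hy => H.polar_int hx hy

lemma dual_le_dual : dualLattice Q L ≤ dualLattice Q (sumPart L w) := fun _ hx =>
  H.mem_dual_sumPart.2 fun y hy => hx.2 y (sumPart_le hy)

omit [FiniteDimensional ℝ V] in
lemma posPart_le_dual : posPart L w ≤ dualLattice Q (posPart L w) := fun _ hx =>
  ⟨Submodule.subset_span hx, fun _ hy => H.polar_int hx.1 hy.1⟩

omit [FiniteDimensional ℝ V] in
lemma negPart_le_dual : negPart L w ≤ dualLattice Q (negPart L w) := fun _ hx =>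
  ⟨Submodule.subset_span hx, fun _ hy => H.polar_int hx.1 hy.1⟩

lemma proj_mem_dual {x : V} (hx : x ∈ dualLattice Q (sumPart L w)) :
    w.proj x ∈ dualLattice Q (posPart L w) := by
  refine ⟨by rw [H.span_posPart]; exact w.proj_mem x, fun y hy => ?_⟩
  obtain ⟨m, hm⟩ := hx.2 y (AddSubgroup.mem_sup_left hy)
  refine ⟨m, ?_⟩
  rwa [← add_sub_cancel (w.proj x) x, QuadraticMap.polar_add_left,
    QuadraticMap.polar_comm _ (x - w.proj x), polar_eq_zero w hy.2 (w.sub_proj_mem x),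
    add_zero] at hm

lemma sub_proj_mem_dual {x : V} (hx : x ∈ dualLattice Q (sumPart L w)) :
    x - w.proj x ∈ dualLattice Q (negPart L w) := by
  refine ⟨by rw [H.span_negPart]; exact w.sub_proj_mem x, fun y hy => ?_⟩
  obtain ⟨m, hm⟩ := hx.2 y (AddSubgroup.mem_sup_right hy)
  refine ⟨m, ?_⟩
  rwa [← add_sub_cancel (w.proj x) x, QuadraticMap.polar_add_left,
    polar_eq_zero w (w.proj_mem x) hy.2, zero_add] at hm

/-- `L'' = L`. -/
lemma mem_of_polar_int {x : V}
    (hx : ∀ y ∈ dualLattice Q L, ∃ m : ℤ, QuadraticMap.polar Q x y = m) : x ∈ L := by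
  obtain ⟨b, hb⟩ := H.lattice.basis
  have hL : ∀ y, y ∈ L ↔ y ∈ Submodule.span ℤ (Set.range b) := by
    intro y
    rw [hb, ← Submodule.mem_toAddSubgroup, Submodule.span_int_eq_addSubgroupClosure]
  have hsymm : LinearMap.BilinForm.IsSymm Q.polarBilin :=
    ⟨fun x y => QuadraticMap.polar_comm Q x y⟩
  rw [hL, ← LinearMap.BilinForm.dualSubmodule_dualSubmodule_of_basis _ H.nondegenerate hsymm b]
  intro y hy
  obtain ⟨m, hm⟩ := hx y (H.mem_dualLattice.2 fun z hz => by
    obtain ⟨m, hm⟩ := Submodule.mem_one.1 (hy z ((hL z).1 hz))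
    exact ⟨m, hm.symm⟩)
  exact Submodule.mem_one.2 ⟨m, hm.symm⟩

/-- The dual of `P ⊕ N` lies in a lattice spanned by a basis of `V`. -/
lemma exists_basis_dual : ∃ b : Module.Basis (Fin (1 + n)) ℝ V,
    ∀ x ∈ dualLattice Q (sumPart L w), x ∈ Submodule.span ℤ (Set.range b) := by
  obtain ⟨b, hb⟩ := H.lattice.basis
  obtain ⟨D, hD, hDL⟩ := H.exists_smul_mem
  have hD' : (D : ℝ) ≠ 0 := by exact_mod_cast hD
  let b' := b.isUnitSMul (w := fun _ => (D : ℝ)) fun _ => isUnit_iff_ne_zero.2 hD'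
  have hb' : ∀ i, b' i ∈ sumPart L w := by
    intro i
    have hi : b i ∈ L := by
      rw [hb]
      exact AddSubgroup.subset_closure ⟨i, rfl⟩
    have h1 : b' i = D • w.proj (b i) + D • (b i - w.proj (b i)) := by
      rw [← smul_add, add_sub_cancel, ← Int.cast_smul_eq_zsmul ℝ]
      exact Module.Basis.isUnitSMul_apply _ _
    rw [h1]
    exact AddSubgroup.add_mem _ (AddSubgroup.mem_sup_left (hDL _ hi).1)
      (AddSubgroup.mem_sup_right (hDL _ hi).2)
  refine ⟨LinearMap.BilinForm.dualBasis Q.polarBilin H.nondegenerate b', fun x hx => ?_⟩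
  rw [← LinearMap.BilinForm.dualSubmodule_span_of_basis]
  intro y hy
  have hy' : y ∈ sumPart L w := by
    induction hy using Submodule.span_induction with
    | mem y hy => obtain ⟨i, rfl⟩ := hy; exact hb' i
    | zero => exact AddSubgroup.zero_mem _
    | add a b _ _ ha hb => exact AddSubgroup.add_mem _ ha hb
    | smul a x _ hx => exact AddSubgroup.zsmul_mem _ hx a
  obtain ⟨m, hm⟩ := hx.2 y hy'
  exact Submodule.mem_one.2 ⟨m, hm.symm⟩

end IsSpecialSetting

/-! ### Lattice sums in the majorant norm -/

section Majorant

variable {V : Type*} [AddCommGroup V] [Module ℝ V] [FiniteDimensional ℝ V]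
  {Q : QuadraticForm ℝ V} {L : AddSubgroup V} {n : ℕ} {w : Grassmannian Q}

/-- The positive definite majorant `Q(x_w) - Q(x_{w^⊥})` of `Q` at `w`. -/
def Grassmannian.majorant (w : Grassmannian Q) (x : V) : ℝ :=
  Q (w.proj x) - Q (x - w.proj x)

/-- The inner product on `V` whose square norm is twice the majorant of `Q` at `w`. -/
@[reducible]
def IsSpecialSetting.core (H : IsSpecialSetting Q L n w) : InnerProductSpace.Core ℝ V where
  inner x y := QuadraticMap.polar Q (w.proj x) (w.proj y) -
    QuadraticMap.polar Q (x - w.proj x) (y - w.proj y)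
  conj_inner_symm x y := by
    simp [QuadraticMap.polar_comm Q (w.proj y), QuadraticMap.polar_comm Q (y - w.proj y)]
  re_inner_nonneg x := by
    simp only [QuadraticMap.polar_self, two_nsmul, RCLike.re_to_real]
    linarith [map_nonneg_of_mem w (w.proj_mem x), H.map_nonpos (w.sub_proj_mem x)]
  definite x hx := by
    simp only [QuadraticMap.polar_self, two_nsmul] at hx
    have h1 : w.proj x = 0 := by
      by_contra h
      linarith [map_pos_of_mem w (w.proj_mem x) h, H.map_nonpos (w.sub_proj_mem x)]
    have h2 : x - w.proj x = 0 := by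
      by_contra h
      linarith [map_nonneg_of_mem w (w.proj_mem x), H.map_neg (w.sub_proj_mem x) h]
    rwa [h1, sub_zero] at h2
  add_left x y z := by
    rw [map_add, add_sub_add_comm, QuadraticMap.polar_add_left, QuadraticMap.polar_add_left]
    ring
  smul_left x y r := by
    rw [map_smul, ← smul_sub, QuadraticMap.polar_smul_left, QuadraticMap.polar_smul_left]
    simp only [smul_eq_mul, conj_trivial]
    ring

/-- A discrete subgroup has finite index in a discrete group contained in its real span. -/
lemma finite_quotient_of_discrete {E : Type*} [NormedAddCommGroup E] [NormedSpace ℝ E]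
    [FiniteDimensional ℝ E] {ι : Type*} [Finite ι] (b : Module.Basis ι ℝ E)
    (M M' : AddSubgroup E) (h : M ≤ M')
    (hb : ∀ x ∈ M', x ∈ Submodule.span ℤ (Set.range b))
    (hs : ∀ x ∈ M', x ∈ Submodule.span ℝ (M : Set E)) :
    Finite (M' ⧸ M.addSubgroupOf M') := by
  have hdisc : ∀ A : AddSubgroup E, A ≤ M' →
      DiscreteTopology (Submodule.span ℤ (A : Set E)) := by
    intro A hA
    have hle : Submodule.span ℤ (A : Set E) ≤ Submodule.span ℤ (Set.range b) :=
      Submodule.span_le.2 fun x hx => hb x (hA hx)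
    exact DiscreteTopology.of_continuous_injective
      (f := fun x : Submodule.span ℤ (A : Set E) =>
        (⟨x, hle x.2⟩ : Submodule.span ℤ (Set.range b)))
      (continuous_subtype_val.subtype_mk _)
      fun x y hxy => Subtype.ext (Subtype.mk.inj hxy)
  have hmem : ∀ A : AddSubgroup E, ∀ x, x ∈ Submodule.span ℤ (A : Set E) ↔ x ∈ A := by
    intro A x
    rw [← Submodule.mem_toAddSubgroup, Submodule.span_int_eq]
  have d1 := hdisc M h
  have d2 := hdisc M' le_rfl
  let N' := Submodule.span ℤ (M' : Set E)
  let N : Submodule ℤ N' := (Submodule.span ℤ (M : Set E)).submoduleOf N'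
  have hfr : Module.finrank ℤ N = Module.finrank ℤ N' := by
    have hle : Submodule.span ℤ (M : Set E) ≤ N' := Submodule.span_mono h
    rw [(Submodule.submoduleOfEquivOfLe hle).finrank_eq]
    have e1 := Real.finrank_eq_int_finrank_of_discrete (s := (M : Set E)) d1
    have e2 := Real.finrank_eq_int_finrank_of_discrete (s := (M' : Set E)) d2
    have e3 : Submodule.span ℝ (M : Set E) = Submodule.span ℝ (M' : Set E) :=
      le_antisymm (Submodule.span_mono h) (Submodule.span_le.2 hs)
    simp only [Set.finrank] at e1 e2
    rw [← e1, ← e2, e3]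
  have : Finite (N' ⧸ N) := Submodule.finiteQuotientOfFreeOfRankEq N hfr
  let F : M' →+ N' ⧸ N := N.mkQ.toAddMonoidHom.comp
    ⟨⟨fun x => (⟨x, Submodule.subset_span x.2⟩ : N'), rfl⟩, fun _ _ => rfl⟩
  have hker : F.ker = M.addSubgroupOf M' := by
    ext x
    rw [AddMonoidHom.mem_ker, AddSubgroup.mem_addSubgroupOf]
    change N.mkQ _ = 0 ↔ _
    rw [Submodule.mkQ_apply, Submodule.Quotient.mk_eq_zero]
    exact hmem M x
  rw [← hker]
  exact Finite.of_injective _ (QuotientAddGroup.kerLift_injective F)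

namespace IsSpecialSetting

variable (H : IsSpecialSetting Q L n w)
include H

lemma finite_quotient (M M' : AddSubgroup V) (h : M ≤ M')
    (hM' : M' ≤ dualLattice Q (sumPart L w))
    (hs : ∀ x ∈ M', x ∈ Submodule.span ℝ (M : Set V)) :
    Finite (M' ⧸ M.addSubgroupOf M') := by
  let := H.core.toNormedAddCommGroup
  let : InnerProductSpace ℝ V := InnerProductSpace.ofCore H.core.toCore
  obtain ⟨b, hb⟩ := H.exists_basis_dual
  exact finite_quotient_of_discrete b M M' h (fun x hx => hb x (hM' hx)) hs

lemma finite_disc : Finite (Disc Q L) :=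
  H.finite_quotient _ _ H.le_dual H.dual_le_dual fun _ hx => hx.1

lemma finite_disc_posPart : Finite (Disc Q (posPart L w)) :=
  H.finite_quotient _ _ H.posPart_le_dual (dual_posPart_le L w) fun _ hx => hx.1

lemma finite_disc_negPart : Finite (Disc Q (negPart L w)) :=
  H.finite_quotient _ _ H.negPart_le_dual (dual_negPart_le L w) fun _ hx => hx.1

lemma summable_exp_majorant {c : ℝ} (hc : 0 < c) :
    Summable fun x : dualLattice Q (sumPart L w) => Real.exp (-c * w.majorant (x : V)) := by
  let := H.core.toNormedAddCommGroup
  let : InnerProductSpace ℝ V := InnerProductSpace.ofCore H.core.toCore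
  obtain ⟨b, hb⟩ := H.exists_basis_dual
  have h1 := summable_gaussian b (half_pos hc)
  have hex : ∀ x : dualLattice Q (sumPart L w), ∃ k : Fin (1 + n) → ℤ,
      ∑ i, (k i : ℝ) • b i = x := by
    intro x
    obtain ⟨k, hk⟩ := (Submodule.mem_span_range_iff_exists_fun ℤ).1 (hb x x.2)
    exact ⟨k, by simpa only [Int.cast_smul_eq_zsmul] using hk⟩
  choose k hk using hex
  have hinj : Function.Injective k := fun x y hxy => Subtype.ext (by rw [← hk x, ← hk y, hxy])
  refine (h1.comp_injective hinj).congr fun x => ?_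
  simp only [Function.comp_apply, hk]
  congr 1
  have h2 : ‖(x : V)‖ ^ 2 = 2 * w.majorant (x : V) := by
    rw [← real_inner_self_eq_norm_sq]
    change QuadraticMap.polar Q _ _ - QuadraticMap.polar Q _ _ = _
    rw [QuadraticMap.polar_self, QuadraticMap.polar_self, Grassmannian.majorant, two_nsmul,
      two_nsmul]
    ring
  rw [h2]
  ring

end IsSpecialSetting

end Majorant

section NegativePart

/-- Poisson summation for the Gaussian of the negative definite lattice `N`, in a space where the
norm on `w^⊥` comes from `-Q`. -/
lemma poisson_negPart_of_inner {V : Type*} [NormedAddCommGroup V] [InnerProductSpace ℝ V]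
    [FiniteDimensional ℝ V] {Q : QuadraticForm ℝ V} {L : AddSubgroup V} {n : ℕ}
    {w : Grassmannian Q} (H : IsSpecialSetting Q L n w)
    (hin : ∀ x ∈ perp Q w.space, ∀ y ∈ perp Q w.space,
      inner ℝ x y = -QuadraticMap.polar Q x y) :
    ∃ c : ℝ, 0 ≤ c ∧ ∀ B : ℂ, 0 < B.re → ∀ x ∈ perp Q w.space,
      ∑' y : negPart L w, Complex.exp (2 * B * (Q (x + y) : ℂ)) =
        c * (Real.pi / B) ^ (n / 2 : ℂ) *
          ∑' y : dualLattice Q (negPart L w), Complex.exp (2 * Real.pi ^ 2 * (Q (y : V) : ℂ) / B) *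
            e (-((QuadraticMap.polar Q x (y : V) : ℝ) : ℂ)) := by
  classical
  let W := perp Q w.space
  let N : Submodule ℤ W :=
    (AddSubgroup.toIntSubmodule (negPart L w)).comap (W.subtype.restrictScalars ℤ)
  have hN : ∀ x : W, x ∈ N ↔ (x : V) ∈ negPart L w := fun x => Iff.rfl
  obtain ⟨bV, hbV⟩ := H.exists_basis_dual
  have hdisc : DiscreteTopology N := by
    have hmem : ∀ x : N, ((x : W) : V) ∈ Submodule.span ℤ (Set.range bV) := fun x =>
      hbV _ (dual_negPart_le L w (H.negPart_le_dual x.2))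
    exact DiscreteTopology.of_continuous_injective
      (f := fun x : N => (⟨((x : W) : V), hmem x⟩ : Submodule.span ℤ (Set.range bV)))
      ((continuous_subtype_val.comp continuous_subtype_val).subtype_mk _)
      fun x y hxy => Subtype.ext (Subtype.ext (Subtype.mk.inj hxy))
  have hz : IsZLattice ℝ N := by
    refine ⟨Submodule.map_injective_of_injective W.injective_subtype ?_⟩
    rw [Submodule.map_span, Submodule.map_top, Submodule.range_subtype]
    refine Eq.trans ?_ H.span_negPart
    congr 1
    ext x
    constructor
    · rintro ⟨y, hy, rfl⟩
      exact hy
    · intro hx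
      exact ⟨⟨x, hx.2⟩, hx, rfl⟩
  have hff : Module.Free ℤ N := inferInstance
  let bN := Module.Free.chooseBasis ℤ N
  let b := bN.ofZLatticeBasis ℝ N
  have hbN : Submodule.span ℤ (Set.range b) = N := bN.ofZLatticeBasis_span ℝ
  have hnd : LinearMap.BilinForm.Nondegenerate (innerₗ W) :=
    ⟨fun x hx => inner_self_eq_zero.1 (hx x), fun x hx => inner_self_eq_zero.1 (hx x)⟩
  let b' := LinearMap.BilinForm.dualBasis (innerₗ W) hnd b
  have hb' : ∀ i j, inner ℝ (b' i) (b j) = if i = j then (1 : ℝ) else 0 := by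
    intro i j
    have := LinearMap.BilinForm.apply_dualBasis_left hnd b i j
    simp only [eq_comm (a := i)]
    exact this
  obtain ⟨c, hc, hP⟩ := gaussian_poisson b b' hb'
  have hnorm : ∀ x : W, ((‖x‖ : ℝ) : ℂ) ^ 2 = -2 * (Q (x : V) : ℂ) := by
    intro x
    have h1 : ‖(x : V)‖ ^ 2 = -2 * Q (x : V) := by
      rw [← real_inner_self_eq_norm_sq, hin x x.2 x x.2, QuadraticMap.polar_self, two_nsmul]
      ring
    have h2 := congrArg (fun r : ℝ => (r : ℂ)) h1
    push_cast at h2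
    exact h2
  have hN' : ∀ x : W, (x : V) ∈ dualLattice Q (negPart L w) ↔
      x ∈ Submodule.span ℤ (Set.range b') := by
    intro x
    rw [← LinearMap.BilinForm.dualSubmodule_span_of_basis, hbN]
    constructor
    · intro hx y hy
      obtain ⟨m, hm⟩ := hx.2 y hy
      refine Submodule.mem_one.2 ⟨-m, ?_⟩
      have h1 : inner ℝ (x : V) (y : V) = -QuadraticMap.polar Q x y := hin x x.2 y y.2
      rw [hm] at h1
      change _ = inner ℝ (x : V) (y : V)
      rw [h1]
      simp
    · intro hx
      refine ⟨by rw [H.span_negPart]; exact x.2, fun y hy => ?_⟩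
      obtain ⟨m, hm⟩ := Submodule.mem_one.1 (hx ⟨y, hy.2⟩ hy)
      refine ⟨-m, ?_⟩
      have h1 : inner ℝ (x : V) y = -QuadraticMap.polar Q (x : V) y := hin x x.2 y hy.2
      have h2 : ((m : ℤ) : ℝ) = inner ℝ (x : V) y := hm
      push_cast
      rw [h2, h1, neg_neg]
  -- coordinates on `N` and on its dual
  let φ : (Module.Free.ChooseBasisIndex ℤ N → ℤ) ≃ negPart L w :=
    (b.restrictScalars ℤ).equivFun.symm.toEquiv.trans
      { toFun := fun x => ⟨((x : W) : V), (hN x).1 (hbN.le x.2)⟩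
        invFun := fun y => ⟨⟨y, y.2.2⟩, by rw [hbN]; exact y.2⟩
        left_inv := fun _ => rfl
        right_inv := fun _ => rfl }
  have hφ : ∀ k, ((φ k : negPart L w) : V) = ((∑ i, (k i : ℝ) • b i : W) : V) := by
    intro k
    simp only [φ, Equiv.trans_apply, LinearEquiv.coe_toEquiv, Module.Basis.equivFun_symm_apply,
      Equiv.coe_fn_mk, Submodule.coe_sum, Submodule.coe_smul, Module.Basis.restrictScalars_apply,
      Int.cast_smul_eq_zsmul]
  let ψ : (Module.Free.ChooseBasisIndex ℤ N → ℤ) ≃ dualLattice Q (negPart L w) :=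
    (b'.restrictScalars ℤ).equivFun.symm.toEquiv.trans
      { toFun := fun x => ⟨((x : W) : V), (hN' x).2 x.2⟩
        invFun := fun y => ⟨⟨y, span_negPart_le L w y.2.1⟩, (hN' _).1 y.2⟩
        left_inv := fun _ => rfl
        right_inv := fun _ => rfl }
  have hψ : ∀ k, ((ψ k : dualLattice Q (negPart L w)) : V) =
      ((∑ i, (k i : ℝ) • b' i : W) : V) := by
    intro k
    simp only [ψ, Equiv.trans_apply, LinearEquiv.coe_toEquiv, Module.Basis.equivFun_symm_apply,
      Equiv.coe_fn_mk, Submodule.coe_sum, Submodule.coe_smul, Module.Basis.restrictScalars_apply,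
      Int.cast_smul_eq_zsmul]
  refine ⟨c, hc, fun B hB x hx => ?_⟩
  have key := hP B hB ⟨x, hx⟩
  rw [H.finrank_perp] at key
  rw [← φ.tsum_eq, ← ψ.tsum_eq]
  refine (Eq.trans (tsum_congr fun k => ?_) key).trans ?_
  · rw [hφ, hnorm]
    congr 1
    push_cast
    ring
  · congr 1
    refine tsum_congr fun k => ?_
    rw [hψ, hnorm]
    have h1 : inner ℝ (⟨x, hx⟩ : W) (∑ i, (k i : ℝ) • b' i) =
        -QuadraticMap.polar Q x ((∑ i, (k i : ℝ) • b' i : W) : V) :=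
      hin x hx _ (Submodule.coe_mem _)
    rw [h1]
    congr 2
    · push_cast
      ring
    · push_cast
      rfl

variable {V : Type*} [AddCommGroup V] [Module ℝ V] [FiniteDimensional ℝ V]
  {Q : QuadraticForm ℝ V} {L : AddSubgroup V} {n : ℕ} {w : Grassmannian Q}

lemma IsSpecialSetting.poisson_negPart (H : IsSpecialSetting Q L n w) :
    ∃ c : ℝ, 0 ≤ c ∧ ∀ B : ℂ, 0 < B.re → ∀ x ∈ perp Q w.space,
      ∑' y : negPart L w, Complex.exp (2 * B * (Q (x + y) : ℂ)) =
        c * (Real.pi / B) ^ (n / 2 : ℂ) *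
          ∑' y : dualLattice Q (negPart L w), Complex.exp (2 * Real.pi ^ 2 * (Q (y : V) : ℂ) / B) *
            e (-((QuadraticMap.polar Q x (y : V) : ℝ) : ℂ)) := by
  let := H.core.toNormedAddCommGroup
  let : InnerProductSpace ℝ V := InnerProductSpace.ofCore H.core.toCore
  refine poisson_negPart_of_inner H fun x hx y hy => ?_
  change QuadraticMap.polar Q _ _ - QuadraticMap.polar Q _ _ = _
  rw [w.proj_of_mem_perp hx, w.proj_of_mem_perp hy]
  simp

end NegativePart

/-! ### Discriminant groups and theta series -/

lemma e_add (x y : ℂ) : e (x + y) = e x * e y := by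
  rw [e, e, e, mul_add, Complex.exp_add]

lemma e_intCast (m : ℤ) : e m = 1 := by
  rw [e, mul_comm, Complex.exp_int_mul_two_pi_mul_I]

lemma e_add_int (x : ℂ) (m : ℤ) : e (x + m) = e x := by
  rw [e_add, e_intCast, mul_one]

lemma e_neg_mul_e (x : ℂ) : e (-x) * e x = 1 := by
  rw [← e_add, neg_add_cancel, show (0 : ℂ) = ((0 : ℤ) : ℂ) by simp, e_intCast]

lemma norm_e (x : ℂ) : ‖e x‖ = Real.exp (-(2 * Real.pi * x.im)) := by
  rw [e, Complex.norm_exp]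
  congr 1
  simp

lemma norm_e_real (x : ℝ) : ‖e x‖ = 1 := by simp [norm_e]

lemma conj_e (x : ℂ) : conj (e x) = e (-conj x) := by
  rw [e, e, ← Complex.exp_conj]
  congr 1
  simp [Complex.conj_ofNat]

lemma continuous_e : Continuous e := by unfold e; fun_prop

lemma differentiable_e : Differentiable ℂ e := by unfold e; fun_prop

section Disc

variable {V : Type*} [AddCommGroup V] [Module ℝ V] {Q : QuadraticForm ℝ V} {M : AddSubgroup V}

lemma rep_mem (γ : Disc Q M) : rep γ ∈ dualLattice Q M := (Quotient.out γ).2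

lemma mk_rep (γ : Disc Q M) : ((⟨rep γ, rep_mem γ⟩ : dualLattice Q M) : Disc Q M) = γ :=
  Quotient.out_eq' γ

lemma mk_eq_mk_iff {x y : dualLattice Q M} : (x : Disc Q M) = y ↔ (x : V) - y ∈ M := by
  rw [eq_comm, QuotientAddGroup.eq, AddSubgroup.mem_addSubgroupOf]
  simp [sub_eq_neg_add]

lemma mk_eq_iff {x : dualLattice Q M} {γ : Disc Q M} :
    (x : Disc Q M) = γ ↔ (x : V) - rep γ ∈ M := by
  conv_lhs => rw [← mk_rep γ]
  exact mk_eq_mk_iff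

/-- `Q` is well defined modulo `ℤ` on `M'/M`. -/
lemma map_sub_map_int (hM : ∀ x ∈ M, ∃ m : ℤ, Q x = m) {x y : V} (hy : y ∈ dualLattice Q M)
    (h : x - y ∈ M) : ∃ m : ℤ, Q x = Q y + m := by
  obtain ⟨a, ha⟩ := hM _ h
  obtain ⟨b, hb⟩ := hy.2 _ h
  refine ⟨a + b, ?_⟩
  rw [QuadraticMap.polar, add_sub_cancel, ha] at hb
  push_cast
  linarith

/-- The bilinear form is well defined modulo `ℤ` on `M'/M`. -/
lemma polar_sub_polar_int {x y z : V} (hz : z ∈ dualLattice Q M) (h : x - y ∈ M) :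
    ∃ m : ℤ, QuadraticMap.polar Q x z = QuadraticMap.polar Q y z + m := by
  obtain ⟨b, hb⟩ := hz.2 _ h
  refine ⟨b, ?_⟩
  rw [← hb, QuadraticMap.polar_comm Q z, ← QuadraticMap.polar_add_left, add_sub_cancel]

/-- A summable family over `M'` is summed by cosets of `M`. -/
lemma tsum_dual_eq_sum_coset [Fintype (Disc Q M)] {g : dualLattice Q M → ℂ} (hg : Summable g) :
    ∑' x, g x = ∑ γ : Disc Q M, ∑' x : Coset γ, g x.1 := by
  rw [← (Equiv.sigmaFiberEquiv fun x : dualLattice Q M => (x : Disc Q M)).tsum_eq g]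
  rw [Summable.tsum_sigma, tsum_fintype]
  · rfl
  · exact (Equiv.summable_iff _).2 hg

/-- The coset of `γ` is the translate of `M` by a representative. -/
def cosetEquiv (h : M ≤ dualLattice Q M) (γ : Disc Q M) : M ≃ Coset γ where
  toFun y := ⟨⟨rep γ + y, (dualLattice Q M).add_mem (rep_mem γ) (h y.2)⟩,
    mk_eq_iff.2 (by simp)⟩
  invFun x := ⟨x.1 - rep γ, mk_eq_iff.1 x.2⟩
  left_inv y := by simp
  right_inv x := by simp

end Disc

namespace IsSpecialSetting

variable {V : Type*} [AddCommGroup V] [Module ℝ V] [FiniteDimensional ℝ V]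
  {Q : QuadraticForm ℝ V} {L : AddSubgroup V} {n : ℕ} {w : Grassmannian Q}
  (H : IsSpecialSetting Q L n w)
include H

omit [FiniteDimensional ℝ V] in
lemma even_posPart : ∀ x ∈ posPart L w, ∃ m : ℤ, Q x = m := fun x hx => H.lattice.even x hx.1

omit [FiniteDimensional ℝ V] in
lemma even_negPart : ∀ x ∈ negPart L w, ∃ m : ℤ, Q x = m := fun x hx => H.lattice.even x hx.1

omit [FiniteDimensional ℝ V] H in
lemma mem_perp_of_dual {x : V} (hx : x ∈ dualLattice Q (negPart L w)) : x ∈ perp Q w.space :=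
  span_negPart_le L w hx.1

omit [FiniteDimensional ℝ V] H in
lemma mem_space_of_dual {x : V} (hx : x ∈ dualLattice Q (posPart L w)) : x ∈ w.space :=
  span_posPart_le L w hx.1

lemma summable_negPart {c : ℝ} (hc : 0 < c) :
    Summable fun x : dualLattice Q (negPart L w) => Real.exp (c * Q (x : V)) := by
  refine ((H.summable_exp_majorant hc).comp_injective
    (AddSubgroup.inclusion_injective (dual_negPart_le L w))).congr fun x => ?_
  simp only [Function.comp_apply, AddSubgroup.coe_inclusion, Grassmannian.majorant,
    w.proj_of_mem_perp (mem_perp_of_dual x.2), map_zero, sub_zero]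
  congr 1
  ring

lemma summable_posPart {c : ℝ} (hc : 0 < c) :
    Summable fun x : dualLattice Q (posPart L w) => Real.exp (-c * Q (x : V)) := by
  refine ((H.summable_exp_majorant hc).comp_injective
    (AddSubgroup.inclusion_injective (dual_posPart_le L w))).congr fun x => ?_
  simp only [Function.comp_apply, AddSubgroup.coe_inclusion, Grassmannian.majorant,
    w.proj_of_mem (mem_space_of_dual x.2), map_zero, sub_zero, sub_self]

omit [FiniteDimensional ℝ V] H in
lemma thetaSeries_neg (τ : ℍ) (β : Disc Q (negPart L w)) :
    thetaSeries Q (-1) (negPart L w) τ β = ∑' x : Coset β, e (-(Q (x.1 : V) : ℂ) * τ) := by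
  simp [thetaSeries]

omit [FiniteDimensional ℝ V] H in
lemma norm_e_neg (x : V) (z : ℂ) :
    ‖e (-(Q x : ℂ) * z)‖ = Real.exp (2 * Real.pi * z.im * Q x) := by
  rw [norm_e]
  congr 1
  simp
  ring

lemma summable_thetaN {z : ℂ} (hz : 0 < z.im) :
    Summable fun x : dualLattice Q (negPart L w) => e (-(Q (x : V) : ℂ) * z) := by
  refine Summable.of_norm ((H.summable_negPart (c := 2 * Real.pi * z.im) (by positivity)).congr
    fun x => ?_)
  rw [norm_e_neg]

lemma differentiableOn_thetaN (β : Disc Q (negPart L w)) :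
    DifferentiableOn ℂ (fun z : ℂ => ∑' x : Coset β, e (-(Q (x.1 : V) : ℂ) * z))
      {z : ℂ | 0 < z.im} := by
  intro z hz
  have hz2 : 0 < z.im / 2 := half_pos hz
  have ho : IsOpen {y : ℂ | z.im / 2 < y.im} := isOpen_lt continuous_const Complex.continuous_im
  have hs : Summable fun x : Coset β => Real.exp (2 * Real.pi * (z.im / 2) * Q (x.1 : V)) :=
    (H.summable_negPart (c := 2 * Real.pi * (z.im / 2)) (by positivity)).comp_injective
      Subtype.val_injective
  refine (DifferentiableOn.differentiableAt (Complex.differentiableOn_tsum_of_summable_norm hs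
    (fun x => ?_) ho fun x y hy => ?_) (ho.mem_nhds (by
      change z.im / 2 < z.im; linarith [hz2]))).differentiableWithinAt
  · exact (differentiable_e.comp (by fun_prop)).differentiableOn
  · rw [norm_e_neg]
    have h1 := H.map_nonpos (mem_perp_of_dual x.1.2)
    refine Real.exp_le_exp.2 (mul_le_mul_of_nonpos_right ?_ h1)
    have : z.im / 2 < y.im := hy
    gcongr

omit [FiniteDimensional ℝ V] in
lemma thetaN_T (τ : ℍ) (β : Disc Q (negPart L w)) :
    thetaSeries Q (-1) (negPart L w) (ModularGroup.T • τ) β =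
      e (-(Q (rep β) : ℂ)) * thetaSeries Q (-1) (negPart L w) τ β := by
  rw [thetaSeries_neg, thetaSeries_neg, ← tsum_mul_left]
  refine tsum_congr fun x => ?_
  obtain ⟨m, hm⟩ := map_sub_map_int H.even_negPart (rep_mem β) (mk_eq_iff.1 x.2)
  rw [← e_add]
  have h1 : ((ModularGroup.T • τ : ℍ) : ℂ) = 1 + τ := by
    rw [modular_T_smul, coe_vadd]
    simp
  rw [h1, ← e_add_int (-(Q (rep β) : ℂ) + -(Q (x.1 : V) : ℂ) * τ) (-m)]
  congr 1
  have h2 : (Q (x.1 : V) : ℂ) = (Q (rep β) : ℂ) + m := by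
    rw [hm]; push_cast; rfl
  push_cast
  linear_combination -h2

/-- The transformation of `Θ_{N⁻}` under `S`, up to a nonnegative factor. -/
lemma exists_thetaN_S [Fintype (Disc Q (negPart L w))] :
    ∃ c : ℝ, 0 ≤ c ∧ ∀ (τ : ℍ) (β : Disc Q (negPart L w)),
    thetaSeries Q (-1) (negPart L w) (ModularGroup.S • τ) β =
      c * (-Complex.I * τ) ^ (n / 2 : ℂ) * ∑ β' : Disc Q (negPart L w),
        e ((QuadraticMap.polar Q (rep β) (rep β') : ℝ) : ℂ) *
          thetaSeries Q (-1) (negPart L w) τ β' := by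
  obtain ⟨c, hc, hP⟩ := H.poisson_negPart
  refine ⟨c, hc, fun τ β => ?_⟩
  have hτ : (τ : ℂ) ≠ 0 := ne_zero τ
  have hS : ((ModularGroup.S • τ : ℍ) : ℂ) = -1 / τ := by
    rw [modular_S_smul]
    simp [neg_div]
  let B : ℂ := Real.pi * Complex.I / τ
  have hB : 0 < B.re := by
    have h1 : B.re = Real.pi * (τ.im / Complex.normSq τ) := by
      simp only [B, div_eq_mul_inv, Complex.inv_def, mul_assoc, Complex.re_ofReal_mul]
      congr 1
      rw [Complex.I_mul_re, Complex.mul_im]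
      simp
    rw [h1]
    have := Complex.normSq_pos.2 hτ
    have := τ.im_pos
    positivity
  have hπ : (Real.pi : ℂ) ≠ 0 := by exact_mod_cast Real.pi_ne_zero
  have hBi : Real.pi / B = -Complex.I * τ := by
    simp only [B]
    field_simp
    rw [Complex.I_sq]
    ring
  have hl : thetaSeries Q (-1) (negPart L w) (ModularGroup.S • τ) β =
      ∑' y : negPart L w, Complex.exp (2 * B * (Q (rep β + y) : ℂ)) := by
    rw [thetaSeries_neg, ← (cosetEquiv H.negPart_le_dual β).tsum_eq]
    refine tsum_congr fun y => ?_
    rw [hS, e]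
    congr 1
    simp only [B, cosetEquiv, Equiv.coe_fn_mk]
    field_simp
  have hs := H.summable_thetaN τ.im_pos
  have hterm : ∀ y : dualLattice Q (negPart L w),
      Complex.exp (2 * Real.pi ^ 2 * (Q (y : V) : ℂ) / B) = e (-(Q (y : V) : ℂ) * τ) := by
    intro y
    rw [e]
    congr 1
    have h3 : 2 * (Real.pi : ℂ) ^ 2 * (Q (y : V) : ℂ) / B =
      2 * Real.pi * (Q (y : V) : ℂ) * (Real.pi / B) := by ring
    rw [h3, hBi]
    ring
  have hs2 : Summable fun y : dualLattice Q (negPart L w) =>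
      Complex.exp (2 * Real.pi ^ 2 * (Q (y : V) : ℂ) / B) *
        e (-((QuadraticMap.polar Q (rep β) (y : V) : ℝ) : ℂ)) := by
    refine Summable.of_norm (hs.norm.congr fun y => ?_)
    have h4 := norm_e_real (-QuadraticMap.polar Q (rep β) (y : V))
    push_cast at h4
    rw [norm_mul, h4, mul_one, hterm]
  -- the dual lattice is symmetric, so the sign of the character does not matter
  have hneg : ∑' y : dualLattice Q (negPart L w),
      Complex.exp (2 * Real.pi ^ 2 * (Q (y : V) : ℂ) / B) *
        e (-((QuadraticMap.polar Q (rep β) (y : V) : ℝ) : ℂ)) =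
      ∑' y : dualLattice Q (negPart L w), e (-(Q (y : V) : ℂ) * τ) *
        e ((QuadraticMap.polar Q (rep β) (y : V) : ℝ) : ℂ) := by
    rw [← (Equiv.neg _).tsum_eq]
    refine tsum_congr fun y => ?_
    rw [hterm]
    simp [QuadraticMap.polar_neg_right]
  rw [hl, hP B hB _ (mem_perp_of_dual (rep_mem β)), hBi, hneg, tsum_dual_eq_sum_coset]
  · congr 1
    refine Finset.sum_congr rfl fun β' _ => ?_
    rw [thetaSeries_neg, ← tsum_mul_left]
    refine tsum_congr fun x => ?_
    rw [mul_comm]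
    congr 1
    obtain ⟨m, hm⟩ := polar_sub_polar_int (rep_mem β) (mk_eq_iff.1 x.2)
    rw [QuadraticMap.polar_comm, hm, QuadraticMap.polar_comm]
    push_cast
    rw [e_add_int]
  · refine Summable.of_norm (hs.norm.congr fun y => ?_)
    rw [norm_mul, norm_e_real, mul_one]

end IsSpecialSetting

/-! ### Splitting along `P ⊕ N` and modular invariance -/

section Signature

variable {V : Type*} [AddCommGroup V] [Module ℝ V] {Q : QuadraticForm ℝ V}

lemma restrict_top_equivalent {S : Submodule ℝ V} (hS : S = ⊤) :
    QuadraticMap.Equivalent (Q.restrict S) Q := by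
  subst hS
  exact ⟨⟨Submodule.topEquiv, fun _ => rfl⟩⟩

lemma sigPos_eq_finrank_of_posDef [FiniteDimensional ℝ V] (h : Q.PosDef) :
    sigPos Q = Module.finrank ℝ V := by
  refine le_antisymm (sigPos_le_finrank Q) ?_
  rw [← finrank_top ℝ V]
  exact le_sigPos_of_posDef Q fun x hx => h x fun h0 => hx (Subtype.ext h0)

lemma sigNeg_eq_zero_of_posDef [FiniteDimensional ℝ V] (h : Q.PosDef) : sigNeg Q = 0 := by
  have h1 := QuadraticForm.sigPos_add_sigNeg_add_radical (Q := Q)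
  rw [sigPos_eq_finrank_of_posDef h] at h1
  omega

end Signature

namespace IsSpecialSetting

variable {V : Type*} [AddCommGroup V] [Module ℝ V] [FiniteDimensional ℝ V]
  {Q : QuadraticForm ℝ V} {L : AddSubgroup V} {n : ℕ} {w : Grassmannian Q}
  (H : IsSpecialSetting Q L n w)
include H

omit [FiniteDimensional ℝ V] in
lemma sigPos_restrict_span : sigPos (Q.restrict (Submodule.span ℝ (L : Set V))) = 1 := by
  rw [(restrict_top_equivalent H.span_eq_top).sigPos_eq, H.lattice.sigPos_eq]

omit [FiniteDimensional ℝ V] in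
lemma sigNeg_restrict_span : sigNeg (Q.restrict (Submodule.span ℝ (L : Set V))) = n := by
  rw [(restrict_top_equivalent H.span_eq_top).sigNeg_eq, H.lattice.sigNeg_eq]

lemma sigPos_restrict_posPart :
    sigPos (Q.restrict (Submodule.span ℝ (posPart L w : Set V))) = 1 := by
  rw [H.span_posPart, sigPos_eq_finrank_of_posDef w.posDef, H.finrank_space]

lemma sigNeg_restrict_posPart :
    sigNeg (Q.restrict (Submodule.span ℝ (posPart L w : Set V))) = 0 := by
  rw [H.span_posPart, sigNeg_eq_zero_of_posDef w.posDef]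

open Classical in
omit [FiniteDimensional ℝ V] in
/-- The coordinates of `x_{P ⊕ N}` in terms of arbitrary representatives. -/
lemma res_glue (F : Disc Q L → ℂ) (x : dualLattice Q (posPart L w))
    (y : dualLattice Q (negPart L w)) :
    res L (sumPart L w) F (glue L w (x, y)) =
      if h : (x : V) + y ∈ dualLattice Q L then
        F ((⟨(x : V) + y, h⟩ : dualLattice Q L) : Disc Q L) else 0 := by
  set γ := glue L w (x, y) with hγ
  have h1 : γ = ((⟨(x : V) + y, (dualLattice Q (sumPart L w)).add_mem
      (dual_posPart_le L w x.2) (dual_negPart_le L w y.2)⟩ : dualLattice Q (sumPart L w)) :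
        Disc Q (sumPart L w)) := rfl
  have h2 : (x : V) + y - rep γ ∈ sumPart L w := mk_eq_iff.1 h1.symm
  have h3 : (x : V) + y - rep γ ∈ L := sumPart_le h2
  have h4 : rep γ ∈ dualLattice Q L ↔ (x : V) + y ∈ dualLattice Q L := by
    rw [← sub_add_cancel ((x : V) + y) (rep γ)]
    exact ((dualLattice Q L).add_mem_cancel_left (H.le_dual h3)).symm
  unfold res
  by_cases h5 : rep γ ∈ dualLattice Q L
  · rw [dif_pos h5, dif_pos (h4.1 h5)]
    congr 1
    exact (mk_eq_mk_iff.2 h3).symm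
  · rw [dif_neg h5, dif_neg fun h => h5 (h4.2 h)]

open Classical in
omit [FiniteDimensional ℝ V] in
lemma res_glue_rep (F : Disc Q L → ℂ) (p : Disc Q (posPart L w) × Disc Q (negPart L w)) :
    res L (sumPart L w) F (glue L w p) =
      if h : rep p.1 + rep p.2 ∈ dualLattice Q L then
        F ((⟨rep p.1 + rep p.2, h⟩ : dualLattice Q L) : Disc Q L) else 0 := by
  have h1 := H.res_glue F ⟨rep p.1, rep_mem p.1⟩ ⟨rep p.2, rep_mem p.2⟩
  rwa [mk_rep, mk_rep] at h1

omit [FiniteDimensional ℝ V] H in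
/-- A sum over `P' × N'` is summed by cosets of `P × N`. -/
lemma tsum_prod_eq_sum_coset [Fintype (Disc Q (posPart L w))] [Fintype (Disc Q (negPart L w))]
    (r : Disc Q (posPart L w) × Disc Q (negPart L w) → ℂ)
    {a : dualLattice Q (posPart L w) → ℂ} {b : dualLattice Q (negPart L w) → ℂ}
    (ha : Summable fun x => ‖a x‖) (hb : Summable fun x => ‖b x‖) :
    ∑' z : dualLattice Q (posPart L w) × dualLattice Q (negPart L w),
        r (z.1, z.2) * (a z.1 * b z.2) =
      ∑ p, r p * ((∑' x : Coset p.1, a x.1) * ∑' y : Coset p.2, b y.1) := by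
  obtain ⟨R, hR⟩ : ∃ R : ℝ, ∀ p, ‖r p‖ ≤ R := by
    obtain ⟨R, hR⟩ := (Set.finite_range fun p => ‖r p‖).bddAbove
    exact ⟨R, fun p => hR ⟨p, rfl⟩⟩
  have hab : Summable fun z : dualLattice Q (posPart L w) × dualLattice Q (negPart L w) =>
      ‖a z.1 * b z.2‖ := by
    simp only [norm_mul]
    exact ha.mul_of_nonneg hb (fun _ => norm_nonneg _) fun _ => norm_nonneg _
  have hs : Summable fun z : dualLattice Q (posPart L w) × dualLattice Q (negPart L w) =>
      r (z.1, z.2) * (a z.1 * b z.2) := by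
    refine Summable.of_norm_bounded (hab.mul_left R) fun z => ?_
    rw [norm_mul]
    exact mul_le_mul_of_nonneg_right (hR _) (norm_nonneg _)
  rw [hs.tsum_prod]
  have hin : ∀ x : dualLattice Q (posPart L w),
      ∑' y : dualLattice Q (negPart L w), r (x, y) * (a x * b y) =
        a x * ∑ β : Disc Q (negPart L w), r (x, β) * ∑' y : Coset β, b y.1 := by
    intro x
    have h1 : Summable fun y : dualLattice Q (negPart L w) => r (x, y) * b y := by
      refine Summable.of_norm_bounded (hb.mul_left R) fun z => ?_
      rw [norm_mul]
      exact mul_le_mul_of_nonneg_right (hR _) (norm_nonneg _)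
    have h2 := tsum_dual_eq_sum_coset h1
    rw [show ∑' y : dualLattice Q (negPart L w), r (x, y) * (a x * b y) =
      a x * ∑' y : dualLattice Q (negPart L w), r (x, y) * b y by
        rw [← tsum_mul_left]; exact tsum_congr fun y => by ring, h2]
    congr 1
    refine Finset.sum_congr rfl fun β _ => ?_
    rw [← tsum_mul_left]
    exact tsum_congr fun y => by rw [y.2]
  simp only [hin]
  obtain ⟨R', hR'⟩ : ∃ R' : ℝ, ∀ α : Disc Q (posPart L w),
      ‖∑ β : Disc Q (negPart L w), r (α, β) * ∑' y : Coset β, b y.1‖ ≤ R' := by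
    obtain ⟨R, hR⟩ := (Set.finite_range fun α : Disc Q (posPart L w) =>
      ‖∑ β : Disc Q (negPart L w), r (α, β) * ∑' y : Coset β, b y.1‖).bddAbove
    exact ⟨R, fun p => hR ⟨p, rfl⟩⟩
  have h3 : Summable fun x : dualLattice Q (posPart L w) =>
      a x * ∑ β : Disc Q (negPart L w), r (x, β) * ∑' y : Coset β, b y.1 := by
    refine Summable.of_norm_bounded (ha.mul_right R') fun z => ?_
    rw [norm_mul]
    exact mul_le_mul_of_nonneg_left (hR' _) (norm_nonneg _)
  rw [tsum_dual_eq_sum_coset h3, Fintype.sum_prod_type]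
  refine Finset.sum_congr rfl fun α _ => ?_
  have h4 : ∑' x : Coset α, a x.1 * ∑ β : Disc Q (negPart L w),
      r (((x.1 : dualLattice Q (posPart L w)) : Disc Q (posPart L w)), β) *
        ∑' y : Coset β, b y.1 =
      (∑' x : Coset α, a x.1) * ∑ β : Disc Q (negPart L w), r (α, β) * ∑' y : Coset β, b y.1 := by
    rw [← tsum_mul_right]
    exact tsum_congr fun x => by rw [x.2]
  rw [h4, Finset.mul_sum]
  exact Finset.sum_congr rfl fun β _ => by ring

omit [FiniteDimensional ℝ V] H in
lemma norm_conj_e_mul (x : V) (z : ℂ) :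
    ‖conj (e ((Q x : ℂ) * z))‖ = Real.exp (-(2 * Real.pi * z.im) * Q x) := by
  rw [RCLike.norm_conj, norm_e]
  congr 1
  simp
  ring

omit [FiniteDimensional ℝ V] H in
lemma thetaP_eq (τ : ℍ) (α : Disc Q (posPart L w)) :
    thetaSeries Q 1 (posPart L w) τ α = ∑' x : Coset α, e ((Q (x.1 : V) : ℂ) * τ) := by
  simp [thetaSeries]

/-- `⟨x, Θ_L(τ, w)⟩ = v^(n/2) ⟨x_{P ⊕ N}, Θ_P ⊗ conj Θ_{N⁻}⟩`. -/
lemma pairing_siegelTheta [Fintype (Disc Q L)] [Fintype (Disc Q (posPart L w))]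
    [Fintype (Disc Q (negPart L w))] (F : Disc Q L → ℂ) (τ : ℍ) :
    pairing F (siegelTheta Q L w τ) =
      ((τ.im ^ ((n : ℝ) / 2) : ℝ) : ℂ) * ∑ p : Disc Q (posPart L w) × Disc Q (negPart L w),
        res L (sumPart L w) F (glue L w p) *
          (conj (thetaSeries Q 1 (posPart L w) τ p.1) *
            thetaSeries Q (-1) (negPart L w) τ p.2) := by
  classical
  have hτ : 0 < 2 * Real.pi * τ.im := by have := τ.im_pos; positivity
  let a : dualLattice Q (posPart L w) → ℂ := fun x => conj (e ((Q (x : V) : ℂ) * τ))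
  let b : dualLattice Q (negPart L w) → ℂ := fun y => e (-(Q (y : V) : ℂ) * τ)
  have ha : Summable fun x => ‖a x‖ :=
    (H.summable_posPart hτ).congr fun x => (norm_conj_e_mul _ _).symm
  have hb : Summable fun x => ‖b x‖ := (H.summable_thetaN τ.im_pos).norm
  let r : Disc Q (posPart L w) × Disc Q (negPart L w) → ℂ := fun p =>
    res L (sumPart L w) F (glue L w p)
  have key := tsum_prod_eq_sum_coset r ha hb
  -- vectors of `L'` are the pairs in `P' × N'` with sum in `L'`
  let j : dualLattice Q L → dualLattice Q (posPart L w) × dualLattice Q (negPart L w) := fun x =>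
    (⟨w.proj x, H.proj_mem_dual (H.dual_le_dual x.2)⟩,
      ⟨x - w.proj x, H.sub_proj_mem_dual (H.dual_le_dual x.2)⟩)
  have hj : Function.Injective j := by
    intro x y hxy
    have h1 : w.proj x = w.proj y := congrArg (fun z => (z.1 : V)) hxy
    have h2 : (x : V) - w.proj x = y - w.proj y := congrArg (fun z => (z.2 : V)) hxy
    rw [h1] at h2
    exact Subtype.ext (sub_left_injective h2)
  have hsupp : Function.support (fun z : dualLattice Q (posPart L w) ×
      dualLattice Q (negPart L w) => r (z.1, z.2) * (a z.1 * b z.2)) ⊆ Set.range j := by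
    intro z hz
    have h1 : r (z.1, z.2) ≠ 0 := left_ne_zero_of_mul hz
    simp only [r, H.res_glue] at h1
    have h2 : (z.1 : V) + z.2 ∈ dualLattice Q L := by
      by_contra h
      rw [dif_neg h] at h1
      exact h1 rfl
    have h3 : w.proj ((z.1 : V) + z.2) = z.1 := by
      rw [map_add, w.proj_of_mem (mem_space_of_dual z.1.2),
        w.proj_of_mem_perp (mem_perp_of_dual z.2.2), add_zero]
    refine ⟨⟨_, h2⟩, Prod.ext (Subtype.ext h3) (Subtype.ext ?_)⟩
    change (z.1 : V) + z.2 - w.proj ((z.1 : V) + z.2) = z.2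
    rw [h3, add_sub_cancel_left]
  rw [← hj.tsum_eq hsupp] at key
  have hterm : ∀ x : dualLattice Q L, r ((j x).1, (j x).2) * (a (j x).1 * b (j x).2) =
      F x * conj (e ((Q (w.proj (x : V)) : ℂ) * τ +
      (Q ((x : V) - w.proj (x : V)) : ℂ) * conj (τ : ℂ))) := by
    intro x
    have h1 : ((j x).1 : V) + (j x).2 = x := add_sub_cancel _ _
    have h2 : r ((j x).1, (j x).2) = F x := by
      simp only [r, H.res_glue]
      rw [dif_pos (h1 ▸ x.2)]
      congr 2
      exact Subtype.ext h1
    rw [h2, e_add, map_mul]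
    congr 2
    simp only [b, j]
    rw [conj_e]
    simp
  simp only [hterm] at key
  have hs : Summable fun x : dualLattice Q L => F x * conj (e ((Q (w.proj (x : V)) : ℂ) * τ +
      (Q ((x : V) - w.proj (x : V)) : ℂ) * conj (τ : ℂ))) := by
    obtain ⟨R, hR⟩ : ∃ R : ℝ, ∀ p, ‖F p‖ ≤ R := by
      obtain ⟨R, hR⟩ := (Set.finite_range fun p => ‖F p‖).bddAbove
      exact ⟨R, fun p => hR ⟨p, rfl⟩⟩
    have h1 := (ha.mul_of_nonneg hb (fun _ => norm_nonneg _) fun _ => norm_nonneg _).comp_injective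
      hj
    refine Summable.of_norm_bounded (h1.mul_left R) fun x => ?_
    rw [← hterm, norm_mul, norm_mul]
    refine mul_le_mul_of_nonneg_right ?_ (by positivity)
    simp only [r, H.res_glue]
    split_ifs
    · exact hR _
    · rw [norm_zero]; exact (norm_nonneg _).trans (hR 0)
  rw [tsum_dual_eq_sum_coset hs] at key
  rw [pairing, finsum_eq_sum_of_fintype]
  have hsn : sigNeg Q = n := H.lattice.sigNeg_eq
  have hl : ∀ γ : Disc Q L, F γ * conj (siegelTheta Q L w τ γ) = ((τ.im ^ ((n : ℝ) / 2) : ℝ) : ℂ) *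
      ∑' x : Coset γ, F (x.1 : Disc Q L) * conj (e ((Q (w.proj (x.1 : V)) : ℂ) * τ +
      (Q ((x.1 : V) - w.proj (x.1 : V)) : ℂ) * conj (τ : ℂ))) := by
    intro γ
    have h1 : ∀ x : Coset γ, F (x.1 : Disc Q L) * conj (e ((Q (w.proj (x.1 : V)) : ℂ) * τ +
      (Q ((x.1 : V) - w.proj (x.1 : V)) : ℂ) * conj (τ : ℂ))) =
      F γ * conj (e ((Q (w.proj (x.1 : V)) : ℂ) * τ +
      (Q ((x.1 : V) - w.proj (x.1 : V)) : ℂ) * conj (τ : ℂ))) := fun x => by rw [x.2]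
    rw [tsum_congr h1, tsum_mul_left, siegelTheta, map_mul, Complex.conj_ofReal, hsn,
      Complex.conj_tsum]
    ring
  rw [Finset.sum_congr rfl fun γ _ => hl γ, ← Finset.mul_sum, key]
  congr 1
  refine Finset.sum_congr rfl fun p _ => ?_
  rw [thetaP_eq, thetaSeries_neg, Complex.conj_tsum]

end IsSpecialSetting

section Contraction

variable {V : Type*} [AddCommGroup V] [Module ℝ V] {Q : QuadraticForm ℝ V}

open Classical in
/-- The number of pairs `(α, β) ∈ P'/P × N'/N` with `α + β ∈ L'/(P ⊕ N)`. -/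
def pairCount (L : AddSubgroup V) (w : Grassmannian Q) [Fintype (Disc Q (posPart L w))]
    [Fintype (Disc Q (negPart L w))] : ℕ :=
  (Finset.univ.filter fun p : Disc Q (posPart L w) × Disc Q (negPart L w) =>
    rep p.1 + rep p.2 ∈ dualLattice Q L).card

/-- The contraction of `x_{P ⊕ N}` with `y ⊗ z`. -/
def contract (L : AddSubgroup V) (w : Grassmannian Q) (x : Disc Q L → ℂ)
    (y : Disc Q (posPart L w) → ℂ) (z : Disc Q (negPart L w) → ℂ)
    [Fintype (Disc Q (posPart L w))] [Fintype (Disc Q (negPart L w))] : ℂ :=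
  ∑ p : Disc Q (posPart L w) × Disc Q (negPart L w),
    res L (sumPart L w) x (glue L w p) * (y p.1 * z p.2)

/-- The function `∑ f_{α + β} g_α Θ_{N⁻, β}`. For `g = Θ̃_P` it has weight `2`, and Stokes' theorem
is applied to it. -/
def liftSum (L : AddSubgroup V) (w : Grassmannian Q)
    [Fintype (Disc Q (posPart L w))] [Fintype (Disc Q (negPart L w))]
    (f : ℍ → Disc Q L → ℂ) (g : ℍ → Disc Q (posPart L w) → ℂ) (τ : ℍ) : ℂ :=
  contract L w (f τ) (g τ) (thetaSeries Q (-1) (negPart L w) τ)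

lemma TransformsLike.apply_T {M : AddSubgroup V} {ε : ℤˣ} {κ : ℤ} {f : ℍ → Disc Q M → ℂ}
    (h : TransformsLike Q ε M κ f) (τ : ℍ) (γ : Disc Q M) :
    f (ModularGroup.T • τ) γ = e ((ε : ℤ) * (Q (rep γ) : ℂ)) * f τ γ := by
  have h1 := h (Mp2.T, weilT Q ε M) (Submonoid.subset_closure (by simp)) τ γ
  change f (ModularGroup.T • τ) γ = 1 ^ κ * weilT Q ε M (f τ) γ at h1
  rw [h1, one_zpow, one_mul, weilT]

lemma TransformsLike.apply_S {M : AddSubgroup V} {ε : ℤˣ} {κ : ℤ} {f : ℍ → Disc Q M → ℂ}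
    (h : TransformsLike Q ε M κ f) (τ : ℍ) (γ : Disc Q M) :
    f (ModularGroup.S • τ) γ = ((τ : ℂ) ^ (1 / 2 : ℂ)) ^ κ * weilS Q ε M (f τ) γ :=
  h (Mp2.S, weilS Q ε M) (Submonoid.subset_closure (by simp)) τ γ

end Contraction

namespace IsSpecialSetting

variable {V : Type*} [AddCommGroup V] [Module ℝ V] [FiniteDimensional ℝ V]
  {Q : QuadraticForm ℝ V} {L : AddSubgroup V} {n : ℕ} {w : Grassmannian Q}
  (H : IsSpecialSetting Q L n w)

omit [FiniteDimensional ℝ V] in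
lemma e_real_eq_one_iff {t : ℝ} : e t = 1 ↔ ∃ m : ℤ, t = m := by
  rw [e, Complex.exp_eq_one_iff]
  constructor
  · rintro ⟨m, hm⟩
    refine ⟨m, ?_⟩
    have h2 : (2 * Real.pi * Complex.I : ℂ) ≠ 0 := Complex.two_pi_I_ne_zero
    rw [mul_comm] at hm
    exact_mod_cast mul_right_cancel₀ h2 hm
  · rintro ⟨m, rfl⟩
    exact ⟨m, by push_cast; ring⟩

omit [FiniteDimensional ℝ V] in
lemma e_real_congr {s t : ℝ} (h : ∃ m : ℤ, s = t + m) : e s = e t := by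
  obtain ⟨m, rfl⟩ := h
  push_cast
  exact e_add_int _ _

include H

omit [FiniteDimensional ℝ V] H in
lemma rep_add_mem {p q : Disc Q (posPart L w) × Disc Q (negPart L w)} :
    rep (p + q).1 + rep (p + q).2 - ((rep p.1 + rep p.2) + (rep q.1 + rep q.2)) ∈
      sumPart L w := by
  have h1 : rep p.1 + rep q.1 - rep (p + q).1 ∈ posPart L w := by
    refine (mk_eq_iff (x := ⟨rep p.1, rep_mem _⟩ + ⟨rep q.1, rep_mem _⟩)).1 ?_
    rw [QuotientAddGroup.mk_add, mk_rep, mk_rep]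
    rfl
  have h2 : rep p.2 + rep q.2 - rep (p + q).2 ∈ negPart L w := by
    refine (mk_eq_iff (x := ⟨rep p.2, rep_mem _⟩ + ⟨rep q.2, rep_mem _⟩)).1 ?_
    rw [QuotientAddGroup.mk_add, mk_rep, mk_rep]
    rfl
  have h3 := (sumPart L w).neg_mem ((sumPart L w).add_mem (AddSubgroup.mem_sup_left h1)
    (AddSubgroup.mem_sup_right h2))
  convert h3 using 1
  abel

omit [FiniteDimensional ℝ V] H in
lemma rep_add_rep_mem (p : Disc Q (posPart L w) × Disc Q (negPart L w)) :
    rep p.1 + rep p.2 ∈ dualLattice Q (sumPart L w) :=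
  AddSubgroup.add_mem _ (dual_posPart_le L w (rep_mem _)) (dual_negPart_le L w (rep_mem _))

open Classical in
/-- Orthogonality of the characters of `L'/(P ⊕ N)`; only those given by vectors of `L'' = L` are
trivial. -/
lemma character_sum [Fintype (Disc Q (posPart L w))] [Fintype (Disc Q (negPart L w))] {v : V}
    (hv : v ∈ dualLattice Q (sumPart L w)) :
    ∑ p : Disc Q (posPart L w) × Disc Q (negPart L w),
      (if rep p.1 + rep p.2 ∈ dualLattice Q L then
        e ((QuadraticMap.polar Q (rep p.1 + rep p.2) v : ℝ) : ℂ) else 0) =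
      if v ∈ L then (pairCount L w : ℂ) else 0 := by
  split_ifs with hvL
  · rw [pairCount, Finset.card_filter]
    push_cast
    refine Finset.sum_congr rfl fun p _ => ?_
    split_ifs with hp
    · exact e_real_eq_one_iff.2 (hp.2 v hvL)
    · rfl
  · obtain ⟨y, hy, hym⟩ : ∃ y ∈ dualLattice Q L, ¬ ∃ m : ℤ, QuadraticMap.polar Q v y = m := by
      by_contra! h
      exact hvL (H.mem_of_polar_int fun y hy => by
        obtain ⟨m, hm⟩ := h y hy
        exact ⟨m, hm⟩)
    have hyK := H.dual_le_dual hy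
    let q : Disc Q (posPart L w) × Disc Q (negPart L w) :=
      (((⟨w.proj y, H.proj_mem_dual hyK⟩ : dualLattice Q (posPart L w)) : Disc Q (posPart L w)),
        ((⟨y - w.proj y, H.sub_proj_mem_dual hyK⟩ : dualLattice Q (negPart L w)) :
          Disc Q (negPart L w)))
    have hq : y - (rep q.1 + rep q.2) ∈ sumPart L w := by
      have h1 : w.proj y - rep q.1 ∈ posPart L w :=
        (mk_eq_iff (x := ⟨w.proj y, H.proj_mem_dual hyK⟩)).1 rfl
      have h2 : y - w.proj y - rep q.2 ∈ negPart L w :=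
        (mk_eq_iff (x := ⟨y - w.proj y, H.sub_proj_mem_dual hyK⟩)).1 rfl
      have h3 := (sumPart L w).add_mem (AddSubgroup.mem_sup_left h1)
        (AddSubgroup.mem_sup_right h2)
      convert h3 using 1
      abel
    have hpq : ∀ p : Disc Q (posPart L w) × Disc Q (negPart L w),
        rep (p + q).1 + rep (p + q).2 - (rep p.1 + rep p.2 + y) ∈ sumPart L w := by
      intro p
      have h3 := (sumPart L w).sub_mem (rep_add_mem (p := p) (q := q)) hq
      convert h3 using 1
      abel
    set S := ∑ p : Disc Q (posPart L w) × Disc Q (negPart L w),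
      (if rep p.1 + rep p.2 ∈ dualLattice Q L then
        e ((QuadraticMap.polar Q (rep p.1 + rep p.2) v : ℝ) : ℂ) else 0) with hS
    have hinv : S = e ((QuadraticMap.polar Q y v : ℝ) : ℂ) * S := by
      conv_rhs => rw [hS, Finset.mul_sum]
      rw [hS, ← Equiv.sum_comp (Equiv.addRight q)]
      refine Finset.sum_congr rfl fun p _ => ?_
      change (if rep (p + q).1 + rep (p + q).2 ∈ dualLattice Q L then
        e ((QuadraticMap.polar Q (rep (p + q).1 + rep (p + q).2) v : ℝ) : ℂ) else 0) = _
      have hiff : rep (p + q).1 + rep (p + q).2 ∈ dualLattice Q L ↔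
          rep p.1 + rep p.2 ∈ dualLattice Q L := by
        have h1 := H.le_dual (sumPart_le (hpq p))
        rw [← sub_add_cancel (rep (p + q).1 + rep (p + q).2) (rep p.1 + rep p.2 + y),
          (dualLattice Q L).add_mem_cancel_left h1, (dualLattice Q L).add_mem_cancel_right hy]
      by_cases hp : rep p.1 + rep p.2 ∈ dualLattice Q L
      · rw [if_pos (hiff.2 hp), if_pos hp, ← e_add, ← Complex.ofReal_add]
        refine e_real_congr ?_
        obtain ⟨m, hm⟩ := polar_sub_polar_int hv (hpq p)
        refine ⟨m, ?_⟩
        rw [hm, QuadraticMap.polar_add_left]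
        ring
      · rw [if_neg fun h => hp (hiff.1 h), if_neg hp, mul_zero]
    have hne : e ((QuadraticMap.polar Q y v : ℝ) : ℂ) ≠ 1 := by
      rw [Ne, e_real_eq_one_iff, QuadraticMap.polar_comm]
      exact hym
    have h1 : (e ((QuadraticMap.polar Q y v : ℝ) : ℂ) - 1) * S = 0 := by
      rw [sub_mul, one_mul, ← hinv, sub_self]
    exact (mul_eq_zero.1 h1).resolve_left (sub_ne_zero.2 hne)

/-- The contraction is invariant, up to a positive factor, under the discrete Fourier
transforms on `L'/L`, `P'/P` and `N'/N`. -/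
lemma contract_fourier [Fintype (Disc Q L)] [Fintype (Disc Q (posPart L w))]
    [Fintype (Disc Q (negPart L w))] (x : Disc Q L → ℂ) (y : Disc Q (posPart L w) → ℂ)
    (z : Disc Q (negPart L w) → ℂ) :
    contract L w (fun γ => ∑ γ', e (-((QuadraticMap.polar Q (rep γ) (rep γ') : ℝ) : ℂ)) * x γ')
      (fun α => ∑ α', e ((QuadraticMap.polar Q (rep α) (rep α') : ℝ) : ℂ) * y α')
      (fun β => ∑ β', e ((QuadraticMap.polar Q (rep β) (rep β') : ℝ) : ℂ) * z β') =
    pairCount L w * contract L w x y z := by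
  classical
  have hA : ∀ p : Disc Q (posPart L w) × Disc Q (negPart L w),
      res L (sumPart L w) (fun γ => ∑ γ' : Disc Q L,
          e (-((QuadraticMap.polar Q (rep γ) (rep γ') : ℝ) : ℂ)) * x γ') (glue L w p) *
        ((∑ α', e ((QuadraticMap.polar Q (rep p.1) (rep α') : ℝ) : ℂ) * y α') *
        ∑ β', e ((QuadraticMap.polar Q (rep p.2) (rep β') : ℝ) : ℂ) * z β') =
      ∑ p' : Disc Q (posPart L w) × Disc Q (negPart L w), ∑ γ' : Disc Q L,
        x γ' * (y p'.1 * z p'.2) * (if rep p.1 + rep p.2 ∈ dualLattice Q L then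
          e ((QuadraticMap.polar Q (rep p.1 + rep p.2)
            (rep p'.1 + rep p'.2 - rep γ') : ℝ) : ℂ) else 0) := by
    intro p
    rw [H.res_glue_rep, Finset.sum_mul_sum, ← Fintype.sum_prod_type'
      (f := fun α' β' => e ((QuadraticMap.polar Q (rep p.1) (rep α') : ℝ) : ℂ) * y α' *
        (e ((QuadraticMap.polar Q (rep p.2) (rep β') : ℝ) : ℂ) * z β')), Finset.mul_sum]
    refine Finset.sum_congr rfl fun p' _ => ?_
    split_ifs with hp
    · rw [Finset.sum_mul]
      refine Finset.sum_congr rfl fun γ' _ => ?_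
      set γ : Disc Q L := ((⟨rep p.1 + rep p.2, hp⟩ : dualLattice Q L) : Disc Q L)
      have h1 : rep p.1 + rep p.2 - rep γ ∈ L :=
        (mk_eq_iff (x := ⟨rep p.1 + rep p.2, hp⟩)).1 rfl
      obtain ⟨m, hm⟩ := polar_sub_polar_int (rep_mem γ') h1
      have h2 : QuadraticMap.polar Q (rep p.1 + rep p.2) (rep p'.1 + rep p'.2 - rep γ') =
          -QuadraticMap.polar Q (rep γ) (rep γ') + QuadraticMap.polar Q (rep p.1) (rep p'.1) +
            QuadraticMap.polar Q (rep p.2) (rep p'.2) + (-m : ℤ) := by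
        rw [QuadraticMap.polar_sub_right, hm, QuadraticMap.polar_add_right,
          QuadraticMap.polar_add_left, QuadraticMap.polar_add_left,
          polar_eq_zero w (mem_space_of_dual (rep_mem p.1)) (mem_perp_of_dual (rep_mem p'.2)),
          QuadraticMap.polar_comm _ (rep p.2) (rep p'.1),
          polar_eq_zero w (mem_space_of_dual (rep_mem p'.1)) (mem_perp_of_dual (rep_mem p.2))]
        push_cast
        ring
      rw [e_real_congr ⟨-m, h2⟩]
      push_cast
      rw [e_add, e_add]
      ring
    · simp
  have hK : ∀ (p' : Disc Q (posPart L w) × Disc Q (negPart L w)) (γ' : Disc Q L),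
      rep p'.1 + rep p'.2 - rep γ' ∈ dualLattice Q (sumPart L w) := fun p' γ' =>
    (dualLattice Q (sumPart L w)).sub_mem (rep_add_rep_mem p') (H.dual_le_dual (rep_mem γ'))
  rw [contract, Finset.sum_congr rfl fun p _ => hA p, Finset.sum_comm, contract, Finset.mul_sum]
  refine Finset.sum_congr rfl fun p' _ => ?_
  rw [Finset.sum_comm]
  simp only [← Finset.mul_sum]
  rw [Finset.sum_congr rfl fun γ' _ => by rw [H.character_sum (hK p' γ')], H.res_glue_rep]
  split_ifs with hp'
  · set γ : Disc Q L := ((⟨rep p'.1 + rep p'.2, hp'⟩ : dualLattice Q L) : Disc Q L) with hγ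
    rw [Finset.sum_eq_single γ]
    · rw [if_pos ((mk_eq_iff (x := ⟨rep p'.1 + rep p'.2, hp'⟩)).1 rfl)]
      ring
    · intro γ' _ hne
      rw [if_neg fun h => hne ((mk_eq_iff (x := ⟨rep p'.1 + rep p'.2, hp'⟩)).2 h).symm, mul_zero]
    · intro h
      exact absurd (Finset.mem_univ _) h
  · rw [zero_mul, mul_zero]
    refine Finset.sum_eq_zero fun γ' _ => ?_
    rw [if_neg fun h => hp' ?_, mul_zero]
    rw [← sub_add_cancel (rep p'.1 + rep p'.2) (rep γ')]
    exact (dualLattice Q L).add_mem (H.le_dual h) (rep_mem γ')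

omit [FiniteDimensional ℝ V] in
lemma contract_smul [Fintype (Disc Q (posPart L w))] [Fintype (Disc Q (negPart L w))]
    (a b c : ℂ) (x : Disc Q L → ℂ) (y : Disc Q (posPart L w) → ℂ)
    (z : Disc Q (negPart L w) → ℂ) :
    contract L w (fun γ => a * x γ) (fun α => b * y α) (fun β => c * z β) =
      a * b * c * contract L w x y z := by
  rw [contract, contract, Finset.mul_sum]
  refine Finset.sum_congr rfl fun p _ => ?_
  rw [H.res_glue_rep, H.res_glue_rep]
  split_ifs <;> ring

omit [FiniteDimensional ℝ V] in
lemma liftSum_T [Fintype (Disc Q (posPart L w))] [Fintype (Disc Q (negPart L w))]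
    {κ κ' : ℤ} {f : ℍ → Disc Q L → ℂ} {g : ℍ → Disc Q (posPart L w) → ℂ}
    (hf : TransformsLike Q 1 L κ f) (hg : TransformsLike Q (-1) (posPart L w) κ' g) (τ : ℍ) :
    liftSum L w f g (ModularGroup.T • τ) = liftSum L w f g τ := by
  classical
  unfold liftSum contract
  refine Finset.sum_congr rfl fun p _ => ?_
  rw [H.res_glue_rep, H.res_glue_rep, H.thetaN_T, hg.apply_T]
  split_ifs with hp
  · set γ : Disc Q L := ((⟨rep p.1 + rep p.2, hp⟩ : dualLattice Q L) : Disc Q L)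
    rw [hf.apply_T]
    have h1 : rep p.1 + rep p.2 - rep γ ∈ L :=
      (mk_eq_iff (x := ⟨rep p.1 + rep p.2, hp⟩)).1 rfl
    obtain ⟨m, hm⟩ := map_sub_map_int H.lattice.even (rep_mem γ) h1
    rw [map_add_of_mem w (mem_space_of_dual (rep_mem p.1)) (mem_perp_of_dual (rep_mem p.2))]
      at hm
    have h2 : e (Q (rep γ) : ℂ) = e (Q (rep p.1) : ℂ) * e (Q (rep p.2) : ℂ) := by
      rw [← e_add, ← Complex.ofReal_add, hm]
      push_cast
      rw [e_add_int]
    simp only [Units.val_one, Int.cast_one, one_mul, Units.val_neg, Int.cast_neg, neg_mul]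
    rw [h2]
    linear_combination (f τ γ * (g τ p.1 * thetaSeries Q (-1) (negPart L w) τ p.2)) *
      (e (-(Q (rep p.2) : ℂ)) * e (Q (rep p.2) : ℂ) * e_neg_mul_e (Q (rep p.1) : ℂ) +
        e_neg_mul_e (Q (rep p.2) : ℂ))
  · rw [zero_mul, zero_mul]

omit H [FiniteDimensional ℝ V] in
lemma cpow_half_neg_I_mul (τ : ℍ) :
    (-Complex.I * τ) ^ (n / 2 : ℂ) =
      ((τ : ℂ) ^ (1 / 2 : ℂ)) ^ (n : ℤ) * Complex.exp (Real.pi * Complex.I / 4) ^ (-(n : ℤ)) := by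
  have hτ : (τ : ℂ) ≠ 0 := ne_zero τ
  have hne : -Complex.I * (τ : ℂ) ≠ 0 := mul_ne_zero (neg_ne_zero.2 Complex.I_ne_zero) hτ
  have hlog : Complex.log (-Complex.I * τ) = Complex.log τ - Real.pi / 2 * Complex.I := by
    have h1 : -Complex.I * (τ : ℂ) = Complex.exp (Complex.log τ - Real.pi / 2 * Complex.I) := by
      rw [Complex.exp_sub, Complex.exp_log hτ, Complex.exp_pi_div_two_mul_I]
      field_simp
      rw [Complex.I_sq]
      ring
    have harg : 0 < Complex.arg τ ∧ Complex.arg τ < Real.pi := by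
      have him : 0 < (τ : ℂ).im := τ.im_pos
      refine ⟨lt_of_le_of_ne (Complex.arg_nonneg_iff.2 him.le) fun h => ?_,
        lt_of_le_of_ne (Complex.arg_le_pi _) fun h => ?_⟩
      · exact him.ne' (Complex.arg_eq_zero_iff.1 h.symm).2
      · exact him.ne' (Complex.arg_eq_pi_iff.1 h).2
    have him : (Complex.log τ - Real.pi / 2 * Complex.I).im = Complex.arg τ - Real.pi / 2 := by
      simp [Complex.log_im]
    have hπ := Real.pi_pos
    rw [h1, Complex.log_exp]
    · rw [him]; linarith
    · rw [him]; linarith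
  rw [Complex.cpow_def_of_ne_zero hne, Complex.cpow_def_of_ne_zero hτ, hlog, ← Complex.exp_int_mul,
    ← Complex.exp_int_mul, ← Complex.exp_add]
  congr 1
  push_cast
  ring

/-- The contraction transforms under `S` with weight `2`. The automorphy factors and the eighth
roots of unity cancel up to a constant `C ≥ 0`, and `S² = 1` on `ℍ` forces `C² = 1` unless the
function vanishes. -/
lemma liftSum_S [Fintype (Disc Q L)] [Fintype (Disc Q (posPart L w))]
    [Fintype (Disc Q (negPart L w))]
    {f : ℍ → Disc Q L → ℂ} {g : ℍ → Disc Q (posPart L w) → ℂ}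
    (hf : TransformsLike Q 1 L (1 - n) f) (hg : TransformsLike Q (-1) (posPart L w) 3 g) (τ : ℍ) :
    liftSum L w f g (ModularGroup.S • τ) = (τ : ℂ) ^ 2 * liftSum L w f g τ := by
  obtain ⟨c, hc, hN⟩ := H.exists_thetaN_S
  obtain ⟨C, hC, hS⟩ : ∃ C : ℝ, 0 ≤ C ∧ ∀ τ : ℍ,
      liftSum L w f g (ModularGroup.S • τ) = C * (τ : ℂ) ^ 2 * liftSum L w f g τ := by
    refine ⟨(Real.sqrt (Nat.card (Disc Q L)))⁻¹ *
      (Real.sqrt (Nat.card (Disc Q (posPart L w))))⁻¹ * c * pairCount L w, by positivity,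
      fun τ => ?_⟩
    have hφ0 : (τ : ℂ) ^ (1 / 2 : ℂ) ≠ 0 := by
      rw [Ne, Complex.cpow_eq_zero_iff]
      exact fun h => ne_zero τ h.1
    have hφ2 : ((τ : ℂ) ^ (1 / 2 : ℂ)) ^ 2 = τ := by
      rw [← Complex.cpow_nat_mul]
      simp
    set φ := (τ : ℂ) ^ (1 / 2 : ℂ) with hφ
    set ζ := Complex.exp (Real.pi * Complex.I / 4) with hζ
    have hζ0 : ζ ≠ 0 := Complex.exp_ne_zero _
    unfold liftSum
    have h1 : f (ModularGroup.S • τ) = fun γ => (φ ^ (1 - (n : ℤ)) * ζ ^ ((n : ℤ) - 1) /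
        (Real.sqrt (Nat.card (Disc Q L)) : ℂ)) *
        ∑ γ', e (-((QuadraticMap.polar Q (rep γ) (rep γ') : ℝ) : ℂ)) * f τ γ' := by
      funext γ
      rw [hf.apply_S, weilS, H.sigPos_restrict_span, H.sigNeg_restrict_span,
        finsum_eq_sum_of_fintype]
      simp only [Units.val_one, one_mul, Nat.cast_one, Int.cast_one]
      ring
    have h2 : g (ModularGroup.S • τ) = fun α => (φ ^ (3 : ℤ) * ζ ^ (1 : ℤ) /
        (Real.sqrt (Nat.card (Disc Q (posPart L w))) : ℂ)) *
        ∑ α', e ((QuadraticMap.polar Q (rep α) (rep α') : ℝ) : ℂ) * g τ α' := by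
      funext α
      rw [hg.apply_S, weilS, H.sigPos_restrict_posPart, H.sigNeg_restrict_posPart,
        finsum_eq_sum_of_fintype]
      simp only [Units.val_neg, Units.val_one, Nat.cast_one, Int.cast_one, Nat.cast_zero,
        zero_sub, neg_mul, one_mul, neg_neg, Int.cast_neg]
      ring
    have h3 : thetaSeries Q (-1) (negPart L w) (ModularGroup.S • τ) = fun β =>
        (c * (φ ^ (n : ℤ) * ζ ^ (-(n : ℤ)))) *
        ∑ β', e ((QuadraticMap.polar Q (rep β) (rep β') : ℝ) : ℂ) *
          thetaSeries Q (-1) (negPart L w) τ β' := by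
      funext β
      rw [hN, cpow_half_neg_I_mul]
    rw [h1, h2, h3, H.contract_smul, H.contract_fourier]
    have hφ4 : φ ^ (1 - (n : ℤ)) * φ ^ (3 : ℤ) * φ ^ (n : ℤ) = (τ : ℂ) ^ 2 := by
      rw [← zpow_add₀ hφ0, ← zpow_add₀ hφ0, ← hφ2, ← pow_mul, ← zpow_natCast]
      congr 1
      push_cast
      ring
    have hζ1 : ζ ^ ((n : ℤ) - 1) * ζ ^ (1 : ℤ) * ζ ^ (-(n : ℤ)) = 1 := by
      rw [← zpow_add₀ hζ0, ← zpow_add₀ hζ0, show (n : ℤ) - 1 + 1 + -n = 0 by ring, zpow_zero]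
    push_cast
    simp only [div_eq_mul_inv]
    linear_combination ((Real.sqrt (Nat.card (Disc Q L)) : ℂ)⁻¹ *
      (Real.sqrt (Nat.card (Disc Q (posPart L w))) : ℂ)⁻¹ * c * pairCount L w *
      contract L w (f τ) (g τ) (thetaSeries Q (-1) (negPart L w) τ)) *
      (ζ ^ ((n : ℤ) - 1) * ζ ^ (1 : ℤ) * ζ ^ (-(n : ℤ)) * hφ4 + (τ : ℂ) ^ 2 * hζ1)
  have hτ : (τ : ℂ) ≠ 0 := ne_zero τ
  have hSτ : ((ModularGroup.S • τ : ℍ) : ℂ) = -1 / τ := by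
    rw [modular_S_smul]
    simp [neg_div]
  have hSS : ModularGroup.S • ModularGroup.S • τ = τ := by
    ext1
    rw [modular_S_smul]
    change (-((ModularGroup.S • τ : ℍ) : ℂ))⁻¹ = τ
    rw [hSτ]
    field_simp
  have h2 := hS (ModularGroup.S • τ)
  rw [hSS, hSτ, hS τ] at h2
  have h3 : liftSum L w f g τ = (C : ℂ) ^ 2 * liftSum L w f g τ := by
    refine h2.trans ?_
    field_simp
  by_cases h0 : liftSum L w f g τ = 0
  · rw [hS, h0, mul_zero, mul_zero]
  · have h4 : (C : ℂ) ^ 2 = 1 := by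
      have h5 : ((C : ℂ) ^ 2 - 1) * liftSum L w f g τ = 0 := by linear_combination -h3
      exact sub_eq_zero.1 ((mul_eq_zero.1 h5).resolve_right h0)
    have h6 : C = 1 := by
      have h7 : C ^ 2 = 1 := by exact_mod_cast h4
      nlinarith
    rw [hS, h6]
    simp

end IsSpecialSetting

/-! ### Integration over the truncated fundamental domain -/

section FundamentalDomain

lemma mem_truncFD_iff {T : ℝ} {τ : ℍ} :
    τ ∈ truncFD T ↔ |τ.re| ≤ 1 / 2 ∧ √(1 - τ.re ^ 2) ≤ τ.im ∧ τ.im ≤ T := by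
  have h1 : 1 ≤ Complex.normSq (τ : ℂ) ↔ √(1 - τ.re ^ 2) ≤ τ.im := by
    rw [Real.sqrt_le_left τ.im_pos.le, Complex.normSq_apply]
    simp only [coe_re, coe_im]
    constructor <;> intro h <;> nlinarith
  change (1 ≤ Complex.normSq (τ : ℂ) ∧ |τ.re| ≤ 1 / 2) ∧ τ.im ≤ T ↔ _
  rw [h1]
  tauto

lemma half_lt_sqrt {u : ℝ} (hu : |u| ≤ 1 / 2) : 1 / 2 < √(1 - u ^ 2) := by
  rw [Real.lt_sqrt (by norm_num)]
  have := abs_le.1 hu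
  nlinarith

lemma sqrt_one_sub_sq_le_one (u : ℝ) : √(1 - u ^ 2) ≤ 1 := by
  rw [Real.sqrt_le_left zero_le_one]
  nlinarith [sq_nonneg u]

/-- Integrals over the truncated fundamental domain as iterated integrals. -/
lemma integral_truncFD {G : ℂ → ℂ} (hG : ContinuousOn G {z : ℂ | 0 < z.im}) {T : ℝ} (hT : 1 ≤ T) :
    ∫ τ in truncFD T, G τ = ∫ u in (-1 / 2 : ℝ)..(1 / 2), ∫ v in √(1 - u ^ 2)..T,
      ((v : ℂ) ^ 2)⁻¹ * G (u + v * Complex.I) := by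
  let D' : Set (ℝ × ℝ) := {p | |p.1| ≤ 1 / 2 ∧ √(1 - p.1 ^ 2) ≤ p.2 ∧ p.2 ≤ T}
  have hD'c : IsClosed D' := by
    have c1 : IsClosed {p : ℝ × ℝ | |p.1| ≤ 1 / 2} := isClosed_le (by fun_prop) (by fun_prop)
    have c2 : IsClosed {p : ℝ × ℝ | √(1 - p.1 ^ 2) ≤ p.2} := isClosed_le (by fun_prop) (by fun_prop)
    have c3 : IsClosed {p : ℝ × ℝ | p.2 ≤ T} := isClosed_le (by fun_prop) (by fun_prop)
    exact c1.inter (c2.inter c3)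
  have hD'k : IsCompact D' := by
    refine (isCompact_Icc (a := (((-1 / 2 : ℝ), (0 : ℝ)) : ℝ × ℝ))
      (b := (1 / 2, T))).of_isClosed_subset hD'c fun p hp => ?_
    obtain ⟨h1, h2, h3⟩ := hp
    have h4 := abs_le.1 h1
    exact ⟨⟨by linarith [h4.1], (Real.sqrt_nonneg _).trans h2⟩, ⟨h4.2, h3⟩⟩
  have hpre : UpperHalfPlane.coe ⁻¹' (Complex.measurableEquivRealProd ⁻¹' D') = truncFD T := by
    ext τ
    rw [mem_truncFD_iff]
    rfl
  have hDm : MeasurableSet (Complex.measurableEquivRealProd ⁻¹' D') :=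
    Complex.measurableEquivRealProd.measurable hD'c.measurableSet
  have hDr : Complex.measurableEquivRealProd ⁻¹' D' ⊆ Set.range UpperHalfPlane.coe := by
    rintro z ⟨h1, h2, -⟩
    have h3 : 0 < z.im := lt_of_lt_of_le (by norm_num) ((half_lt_sqrt h1).le.trans h2)
    exact ⟨⟨z, h3⟩, rfl⟩
  have hts : MeasurableSet (truncFD T) := by
    rw [← hpre]
    exact measurable_coe hDm
  have hmeas : Measurable fun z : ℍ => (1 / NNReal.mk z.im z.im_pos.le : NNReal) ^ 2 := by
    have : Measurable fun z : ℍ => NNReal.mk z.im z.im_pos.le :=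
      Measurable.subtype_mk UpperHalfPlane.continuous_im.measurable
    exact (measurable_const.div this).pow_const 2
  let g : ℂ → ℂ := fun z => ((z.im : ℂ) ^ 2)⁻¹ * G z
  have e1 : ∫ τ in truncFD T, G τ = ∫ z in Complex.measurableEquivRealProd ⁻¹' D', g z := by
    have h1 := setIntegral_withDensity_eq_setIntegral_smul (μ := volume.comap UpperHalfPlane.coe)
      hmeas (fun τ : ℍ => G τ) hts
    rw [← volume_def] at h1
    rw [h1]
    have h2 : ∫ z in Complex.measurableEquivRealProd ⁻¹' D', g z =
        ∫ z in Complex.measurableEquivRealProd ⁻¹' D', g z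
          ∂(Measure.map UpperHalfPlane.coe (volume.comap UpperHalfPlane.coe)) := by
      rw [measurableEmbedding_coe.map_comap, Measure.restrict_restrict hDm,
        Set.inter_eq_left.2 hDr]
    rw [h2, measurableEmbedding_coe.setIntegral_map, hpre]
    refine setIntegral_congr_fun hts fun τ _ => ?_
    simp only [g, NNReal.smul_def]
    push_cast
    simp [Complex.real_smul]
  have e2 : ∫ z in Complex.measurableEquivRealProd ⁻¹' D', g z =
      ∫ p in D', g ((p.1 : ℂ) + p.2 * Complex.I) := by
    have h1 := Complex.volume_preserving_equiv_real_prod.setIntegral_preimage_emb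
      Complex.measurableEquivRealProd.measurableEmbedding
      (fun p : ℝ × ℝ => g ((p.1 : ℂ) + p.2 * Complex.I)) D'
    rw [← h1]
    refine setIntegral_congr_fun hDm fun z _ => ?_
    simp only [Complex.measurableEquivRealProd_apply, Complex.re_add_im]
  let k : ℝ × ℝ → ℂ := fun p => g ((p.1 : ℂ) + p.2 * Complex.I)
  have hk : ContinuousOn k D' := by
    have h0 : ∀ p ∈ D', 0 < p.2 := fun p hp =>
      lt_of_lt_of_le (by norm_num) ((half_lt_sqrt hp.1).le.trans hp.2.1)
    have h1 : ContinuousOn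
        (fun p : ℝ × ℝ => ((((p.1 : ℂ) + p.2 * Complex.I).im : ℂ) ^ 2)⁻¹) D' := by
      refine ContinuousOn.inv₀ (by fun_prop) fun p hp => ?_
      have := (h0 p hp).ne'
      simpa using this
    refine h1.mul (hG.comp (by fun_prop) fun p hp => ?_)
    simpa using h0 p hp
  have hki : Integrable (D'.indicator k) (volume.prod volume) :=
    (hk.integrableOn_compact hD'k).integrable_indicator hD'c.measurableSet
  rw [e1, e2, ← integral_indicator hD'c.measurableSet]
  change ∫ p, D'.indicator k p ∂(volume.prod volume) = _
  rw [integral_prod _ hki, intervalIntegral.integral_of_le (by norm_num),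
    ← integral_Icc_eq_integral_Ioc, ← integral_indicator measurableSet_Icc]
  refine integral_congr_ae (ae_of_all _ fun u => ?_)
  by_cases hu : |u| ≤ 1 / 2
  · have hu' : u ∈ Set.Icc (-1 / 2 : ℝ) (1 / 2) := by
      have := abs_le.1 hu
      exact ⟨by linarith [this.1], this.2⟩
    simp only [Set.indicator_of_mem hu']
    rw [intervalIntegral.integral_of_le ((sqrt_one_sub_sq_le_one u).trans hT),
      ← integral_Icc_eq_integral_Ioc, ← integral_indicator measurableSet_Icc]
    refine integral_congr_ae (ae_of_all _ fun v => ?_)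
    by_cases hv : v ∈ Set.Icc (√(1 - u ^ 2)) T
    · simp only [Set.indicator_of_mem hv, Set.indicator_of_mem (show (u, v) ∈ D' from ⟨hu, hv⟩)]
      simp [k, g]
    · simp only [Set.indicator_of_notMem hv,
        Set.indicator_of_notMem (show (u, v) ∉ D' from fun h => hv h.2)]
  · have hu' : u ∉ Set.Icc (-1 / 2 : ℝ) (1 / 2) := fun h =>
      hu (abs_le.2 ⟨by linarith [h.1], h.2⟩)
    simp only [Set.indicator_of_notMem hu']
    rw [integral_congr_ae (ae_of_all _ fun v =>
      Set.indicator_of_notMem (show (u, v) ∉ D' from fun h => hu h.1) k)]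
    simp

end FundamentalDomain

/-! ### Stokes' theorem on the truncated fundamental domain -/

section Stokes

/-- `∂F/∂z̄`, for functions on the upper half plane extended to `ℂ`. -/
def dbar (F : ℂ → ℂ) (z : ℂ) : ℂ := (fderiv ℝ F z 1 + Complex.I * fderiv ℝ F z Complex.I) / 2

/-- Parametrization of the truncated fundamental domain by a rectangle. -/
def fdParam (T : ℝ) (p : ℝ × ℝ) : ℂ :=
  p.1 + (√(1 - p.1 ^ 2) + p.2 * (T - √(1 - p.1 ^ 2)) : ℝ) * Complex.I

lemma hasDerivAt_sqrt_one_sub_sq {u : ℝ} (hu : 0 < 1 - u ^ 2) :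
    HasDerivAt (fun u : ℝ => √(1 - u ^ 2)) (-u / √(1 - u ^ 2)) u := by
  have h1 : HasDerivAt (fun u : ℝ => 1 - u ^ 2) (-(2 * u)) u := by
    simpa using ((hasDerivAt_id u).pow 2).const_sub 1
  convert h1.sqrt hu.ne' using 1
  field_simp

lemma contDiffAt_sqrt_one_sub_sq {p : ℝ × ℝ} (hp : 0 < 1 - p.1 ^ 2) :
    ContDiffAt ℝ 1 (fun p : ℝ × ℝ => √(1 - p.1 ^ 2)) p := by
  have h1 : ContDiffAt ℝ 1 (fun p : ℝ × ℝ => 1 - p.1 ^ 2) p := by fun_prop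
  exact h1.sqrt hp.ne'

lemma contDiff_ofReal : ContDiff ℝ 1 (fun x : ℝ => (x : ℂ)) := Complex.ofRealCLM.contDiff

/-- The integral over the unit circle arc of the fundamental domain vanishes for a form of
weight `2`, since `S` maps the arc to itself with reversed orientation. -/
lemma integral_arc_eq_zero {F : ℂ → ℂ}
    (hS : ∀ z : ℂ, 0 < z.im → F (-1 / z) = z ^ 2 * F z) :
    ∫ u in (-1 / 2 : ℝ)..(1 / 2), F (u + √(1 - u ^ 2) * Complex.I) *
      (1 + (-u / √(1 - u ^ 2) : ℝ) * Complex.I) = 0 := by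
  set k : ℝ → ℂ := fun u => F (u + √(1 - u ^ 2) * Complex.I) *
      (1 + (-u / √(1 - u ^ 2) : ℝ) * Complex.I) with hk
  have hodd : ∀ u ∈ Set.uIcc (-1 / 2 : ℝ) (1 / 2), k (-u) = -k u := by
    intro u hu
    rw [Set.uIcc_of_le (by norm_num)] at hu
    have hu' : |u| ≤ 1 / 2 := abs_le.2 ⟨by linarith [hu.1], hu.2⟩
    have hs : 0 < √(1 - u ^ 2) := lt_trans (by norm_num) (half_lt_sqrt hu')
    have hs2 : √(1 - u ^ 2) ^ 2 = 1 - u ^ 2 := Real.sq_sqrt (by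
      have := abs_le.1 hu'; nlinarith)
    set s := √(1 - u ^ 2) with hsdef
    have hs2' : (s : ℂ) ^ 2 = 1 - (u : ℂ) ^ 2 := by exact_mod_cast hs2
    have hs0 : (s : ℂ) ≠ 0 := by exact_mod_cast hs.ne'
    have hz : 0 < ((u : ℂ) + s * Complex.I).im := by simpa using hs
    have hz0 : (u : ℂ) + s * Complex.I ≠ 0 := fun h => by rw [h] at hz; simp at hz
    have h1 : -1 / ((u : ℂ) + s * Complex.I) = ((-u : ℝ) : ℂ) + s * Complex.I := by
      rw [div_eq_iff hz0]
      push_cast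
      linear_combination hs2' - (s : ℂ) ^ 2 * Complex.I_sq
    have h2 := hS _ hz
    rw [h1] at h2
    simp only [hk, neg_sq, ← hsdef]
    rw [h2]
    push_cast
    field_simp
    linear_combination F (u + s * Complex.I) * ((u + s * Complex.I) * Complex.I * hs2' +
      (s + Complex.I * u) * (s : ℂ) ^ 2 * Complex.I_sq) +
      F (u + s * Complex.I) * s * ((u : ℂ) ^ 2 + 1 - (s : ℂ) ^ 2) * Complex.I_sq
  have h1 : ∫ u in (-1 / 2 : ℝ)..(1 / 2), k u = ∫ u in (-1 / 2 : ℝ)..(1 / 2), k (-u) := by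
    rw [intervalIntegral.integral_comp_neg]
    norm_num
  have h2 : ∫ u in (-1 / 2 : ℝ)..(1 / 2), k u = -∫ u in (-1 / 2 : ℝ)..(1 / 2), k u := by
    conv_lhs => rw [h1, intervalIntegral.integral_congr hodd, intervalIntegral.integral_neg]
  exact self_eq_neg.1 h2

/-- Stokes' theorem on the truncated fundamental domain for a function of weight `2`: the vertical
edges cancel by periodicity and the arc does not contribute. -/
theorem stokes_truncFD {F : ℂ → ℂ} (hF : ContDiffOn ℝ 1 F {z : ℂ | 0 < z.im})
    (hT1 : ∀ z : ℂ, 0 < z.im → F (z + 1) = F z)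
    (hS : ∀ z : ℂ, 0 < z.im → F (-1 / z) = z ^ 2 * F z) {T : ℝ} (hT : 1 ≤ T) :
    ∫ u in (-1 / 2 : ℝ)..(1 / 2), ∫ v in √(1 - u ^ 2)..T, dbar F (u + v * Complex.I) =
      Complex.I / 2 * ∫ u in (-1 / 2 : ℝ)..(1 / 2), F (u + T * Complex.I) := by
  have hopen : IsOpen {z : ℂ | 0 < z.im} := isOpen_lt continuous_const Complex.continuous_im
  have hFa : ∀ z : ℂ, 0 < z.im → ContDiffAt ℝ 1 F z := fun z hz =>
    hF.contDiffAt (hopen.mem_nhds hz)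
  let R : Set (ℝ × ℝ) := Set.uIcc (-1 / 2 : ℝ) (1 / 2) ×ˢ Set.uIcc (0 : ℝ) 1
  have hRu : ∀ p ∈ R, |p.1| ≤ 1 / 2 := by
    intro p hp
    have h1 := hp.1
    rw [Set.uIcc_of_le (by norm_num)] at h1
    exact abs_le.2 ⟨by linarith [h1.1], h1.2⟩
  have hRq : ∀ p ∈ R, 0 < 1 - p.1 ^ 2 := by
    intro p hp
    have := abs_le.1 (hRu p hp)
    nlinarith
  have him : ∀ p ∈ R, 0 < (fdParam T p).im := by
    intro p hp
    have h1 := half_lt_sqrt (hRu p hp)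
    have h2 := sqrt_one_sub_sq_le_one p.1
    have h3 := hp.2
    rw [Set.uIcc_of_le zero_le_one] at h3
    have h4 : (fdParam T p).im = √(1 - p.1 ^ 2) + p.2 * (T - √(1 - p.1 ^ 2)) := by
      simp only [fdParam, Complex.add_im, Complex.ofReal_im, Complex.mul_I_im, Complex.ofReal_re,
        zero_add]
    rw [h4]
    have : 0 ≤ p.2 * (T - √(1 - p.1 ^ 2)) := mul_nonneg h3.1 (by linarith)
    linarith
  -- the pull-back of `F dz` is `f dt - g du`
  let f : ℝ × ℝ → ℂ := fun p => F (fdParam T p) * (Complex.I * (T - √(1 - p.1 ^ 2) : ℝ))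
  let g : ℝ × ℝ → ℂ := fun p =>
    -(F (fdParam T p) * (1 + (-p.1 / √(1 - p.1 ^ 2) * (1 - p.2) : ℝ) * Complex.I))
  have hΨ : ∀ p ∈ R, ContDiffAt ℝ 1 (fdParam T) p := by
    intro p hp
    have h1 := contDiffAt_sqrt_one_sub_sq (hRq p hp)
    have h2 : ContDiffAt ℝ 1 (fun p : ℝ × ℝ =>
        √(1 - p.1 ^ 2) + p.2 * (T - √(1 - p.1 ^ 2))) p :=
      h1.add (contDiffAt_snd.mul (contDiffAt_const.sub h1))
    exact (contDiff_ofReal.contDiffAt.comp p contDiffAt_fst).add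
      ((contDiff_ofReal.contDiffAt.comp p h2).mul contDiffAt_const)
  have hfa : ∀ p ∈ R, ContDiffAt ℝ 1 f p := by
    intro p hp
    have h1 := contDiffAt_sqrt_one_sub_sq (hRq p hp)
    exact ((hFa _ (him p hp)).comp p (hΨ p hp)).mul (contDiffAt_const.mul
      (contDiff_ofReal.contDiffAt.comp p (contDiffAt_const.sub h1)))
  have hga : ∀ p ∈ R, ContDiffAt ℝ 1 g p := by
    intro p hp
    have h1 := contDiffAt_sqrt_one_sub_sq (hRq p hp)
    have h0 : √(1 - p.1 ^ 2) ≠ 0 := (lt_trans (by norm_num) (half_lt_sqrt (hRu p hp))).ne'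
    have h2 : ContDiffAt ℝ 1 (fun p : ℝ × ℝ => -p.1 / √(1 - p.1 ^ 2) * (1 - p.2)) p :=
      ((contDiffAt_fst.neg).div h1 h0).mul (contDiffAt_const.sub contDiffAt_snd)
    exact (((hFa _ (him p hp)).comp p (hΨ p hp)).mul (contDiffAt_const.add
      ((contDiff_ofReal.contDiffAt.comp p h2).mul contDiffAt_const))).neg
  have hdiv : ∀ p ∈ R, fderiv ℝ f p (1, 0) + fderiv ℝ g p (0, 1) =
      2 * Complex.I * ((T - √(1 - p.1 ^ 2) : ℝ) * dbar F (fdParam T p)) := by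
    intro p hp
    obtain ⟨u, t⟩ := p
    have hs := hasDerivAt_sqrt_one_sub_sq (hRq _ hp)
    have hFd := ((hFa _ (him _ hp)).differentiableAt one_ne_zero).hasFDerivAt
    simp only at hs
    set s : ℝ := √(1 - u ^ 2) with hsdef
    set c : ℝ := -u / s with hc
    have hsc : HasDerivAt (fun x : ℝ => ((√(1 - x ^ 2) : ℝ) : ℂ)) (c : ℂ) u := hs.ofReal_comp
    have hΨu : HasDerivAt (fun x : ℝ => fdParam T (x, t))
        (1 + (c * (1 - t) : ℝ) * Complex.I) u := by
      have h1 : HasDerivAt (fun x : ℝ => √(1 - x ^ 2) + t * (T - √(1 - x ^ 2)))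
          (c + t * (-c)) u := hs.add ((hs.const_sub T).const_mul t)
      have h2 := ((hasDerivAt_id u).ofReal_comp).add (h1.ofReal_comp.mul_const Complex.I)
      refine (h2.congr_deriv ?_)
      push_cast
      ring
    have hΨt : HasDerivAt (fun x : ℝ => fdParam T (u, x)) (((T - s : ℝ) : ℂ) * Complex.I) t := by
      have h1 : HasDerivAt (fun x : ℝ => s + x * (T - s)) (T - s) t := by
        simpa using ((hasDerivAt_id t).mul_const (T - s)).const_add s
      have h2 := (h1.ofReal_comp.mul_const Complex.I).const_add (u : ℂ)
      exact h2
    have hfu : fderiv ℝ f (u, t) (1, 0) =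
        fderiv ℝ F (fdParam T (u, t)) (1 + (c * (1 - t) : ℝ) * Complex.I) *
          (Complex.I * (T - s : ℝ)) + F (fdParam T (u, t)) * (Complex.I * (-c)) := by
      have h1 : HasDerivAt (fun x : ℝ => f (x, t)) (fderiv ℝ f (u, t) (1, 0)) u := by
        have h3 := ((hfa _ hp).differentiableAt one_ne_zero).hasFDerivAt
        exact h3.comp_hasDerivAt u ((hasDerivAt_id u).prodMk (hasDerivAt_const u t))
      have h2 : HasDerivAt (fun x : ℝ => f (x, t)) _ u :=
        (hFd.comp_hasDerivAt u hΨu).mul ((hs.const_sub T).ofReal_comp.const_mul Complex.I)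
      rw [h1.unique h2]
      push_cast
      rfl
    have hgt : fderiv ℝ g (u, t) (0, 1) =
        -(fderiv ℝ F (fdParam T (u, t)) (((T - s : ℝ) : ℂ) * Complex.I) *
          (1 + (c * (1 - t) : ℝ) * Complex.I) + F (fdParam T (u, t)) * (-c * Complex.I)) := by
      have h1 : HasDerivAt (fun x : ℝ => g (u, x)) (fderiv ℝ g (u, t) (0, 1)) t := by
        have h3 := ((hga _ hp).differentiableAt one_ne_zero).hasFDerivAt
        exact h3.comp_hasDerivAt t ((hasDerivAt_const t u).prodMk (hasDerivAt_id t))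
      have h4 : HasDerivAt (fun x : ℝ => c * (1 - x)) (-c) t := by
        simpa using ((hasDerivAt_id t).const_sub 1).const_mul c
      have h2 : HasDerivAt (fun x : ℝ => g (u, x)) _ t :=
        ((hFd.comp_hasDerivAt t hΨt).mul ((h4.ofReal_comp.mul_const Complex.I).const_add 1)).neg
      rw [h1.unique h2]
      push_cast
      rfl
    have hlin1 : fderiv ℝ F (fdParam T (u, t)) (1 + (c * (1 - t) : ℝ) * Complex.I) =
        fderiv ℝ F (fdParam T (u, t)) 1 +
          (c * (1 - t) : ℝ) * fderiv ℝ F (fdParam T (u, t)) Complex.I := by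
      rw [map_add, ← Complex.real_smul, map_smul, Complex.real_smul]
    have hlin2 : fderiv ℝ F (fdParam T (u, t)) (((T - s : ℝ) : ℂ) * Complex.I) =
        ((T - s : ℝ) : ℂ) * fderiv ℝ F (fdParam T (u, t)) Complex.I := by
      rw [← Complex.real_smul, map_smul, Complex.real_smul]
    rw [hfu, hgt, hlin1, hlin2, dbar]
    push_cast
    linear_combination ((T : ℂ) - s) * fderiv ℝ F (fdParam T (u, t)) Complex.I * (-Complex.I_sq)
  have hint : ContinuousOn (fun p => fderiv ℝ f p (1, 0) + fderiv ℝ g p (0, 1)) R := by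
    intro p hp
    have h1 := ((hfa p hp).fderiv_right (m := 0) (by norm_num)).continuousAt
    have h2 := ((hga p hp).fderiv_right (m := 0) (by norm_num)).continuousAt
    exact ((h1.clm_apply continuousAt_const).add
      (h2.clm_apply continuousAt_const)).continuousWithinAt
  have hRc : IsCompact R := isCompact_uIcc.prod isCompact_uIcc
  have hsub : ∀ p ∈ Set.Ioo (min (-1 / 2 : ℝ) (1 / 2)) (max (-1 / 2) (1 / 2)) ×ˢ
      Set.Ioo (min (0 : ℝ) 1) (max 0 1) \ ∅, p ∈ R := fun p hp =>
    ⟨Set.Ioo_subset_Icc_self hp.1.1, Set.Ioo_subset_Icc_self hp.1.2⟩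
  have key := integral2_divergence_prod_of_hasFDerivAt_off_countable f g (fderiv ℝ f) (fderiv ℝ g)
    (-1 / 2) 0 (1 / 2) 1 ∅ Set.countable_empty
    (fun p hp => (hfa p hp).continuousAt.continuousWithinAt)
    (fun p hp => (hga p hp).continuousAt.continuousWithinAt)
    (fun p hp => ((hfa p (hsub p hp)).differentiableAt one_ne_zero).hasFDerivAt)
    (fun p hp => ((hga p (hsub p hp)).differentiableAt one_ne_zero).hasFDerivAt)
    (hint.integrableOn_compact hRc)
  -- the four edges
  have hedge : ∫ t in (0 : ℝ)..1, f (1 / 2, t) = ∫ t in (0 : ℝ)..1, f (-1 / 2, t) := by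
    refine intervalIntegral.integral_congr fun t ht => ?_
    have hp : ((-1 / 2 : ℝ), t) ∈ R := ⟨Set.left_mem_uIcc, ht⟩
    have h1 := hT1 _ (him _ hp)
    have h2 : fdParam T (-1 / 2, t) + 1 = fdParam T (1 / 2, t) := by
      simp only [fdParam]
      norm_num
      ring
    rw [h2] at h1
    simp only [f, h1]
    norm_num
  have htop : ∫ u in (-1 / 2 : ℝ)..(1 / 2), g (u, 1) =
      -∫ u in (-1 / 2 : ℝ)..(1 / 2), F (u + T * Complex.I) := by
    rw [← intervalIntegral.integral_neg]
    refine intervalIntegral.integral_congr fun u _ => ?_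
    simp [g, fdParam]
  have harc : ∫ u in (-1 / 2 : ℝ)..(1 / 2), g (u, 0) = 0 := by
    rw [← neg_eq_zero, ← intervalIntegral.integral_neg, ← integral_arc_eq_zero hS]
    refine intervalIntegral.integral_congr fun u _ => ?_
    simp [g, fdParam]
  rw [hedge, htop, harc, sub_zero, add_sub_cancel_right] at key
  have hinner : ∀ u ∈ Set.uIcc (-1 / 2 : ℝ) (1 / 2),
      ∫ t in (0 : ℝ)..1, (fderiv ℝ f (u, t) (1, 0) + fderiv ℝ g (u, t) (0, 1)) =
      2 * Complex.I * ∫ v in √(1 - u ^ 2)..T, dbar F (u + v * Complex.I) := by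
    intro u hu
    rw [intervalIntegral.integral_congr fun t ht => hdiv (u, t) ⟨hu, ht⟩]
    dsimp only
    rw [intervalIntegral.integral_const_mul, intervalIntegral.integral_const_mul]
    congr 1
    have h1 := intervalIntegral.smul_integral_comp_mul_add (a := 0) (b := 1)
      (fun v : ℝ => dbar F (u + v * Complex.I)) (T - √(1 - u ^ 2)) (√(1 - u ^ 2))
    rw [mul_zero, zero_add, mul_one, sub_add_cancel, Complex.real_smul] at h1
    rw [← h1]
    congr 1
    refine intervalIntegral.integral_congr fun t _ => ?_
    simp only [fdParam]
    congr 3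
    push_cast
    ring
  rw [intervalIntegral.integral_congr hinner, intervalIntegral.integral_const_mul] at key
  linear_combination (-Complex.I / 2) * key + (∫ u in (-1 / 2 : ℝ)..(1 / 2),
    ∫ v in √(1 - u ^ 2)..T, dbar F (u + v * Complex.I)) * Complex.I_sq

end Stokes

/-! ### Fourier expansions of harmonic Maass forms -/

section IncGamma

lemma integrableOn_incGamma (s : ℝ) {x : ℝ} (hx : 0 < x) :
    IntegrableOn (fun t : ℝ => Real.exp (-t) * t ^ (s - 1)) (Set.Ioi x) := by
  refine integrable_of_isBigO_exp_neg (b := 1 / 2) (by norm_num) ?_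
    (Real.Gamma_integrand_isLittleO _).isBigO
  refine ContinuousOn.mul (by fun_prop) fun t ht => ?_
  exact (Real.continuousAt_rpow_const _ _ (Or.inl (hx.trans_le ht).ne')).continuousWithinAt

lemma incGamma_eq_sub (s : ℝ) {x y : ℝ} (hx : 0 < x) (hy : 0 < y) :
    incGamma s y = incGamma s x - ∫ t in x..y, Real.exp (-t) * t ^ (s - 1) := by
  rw [← intervalIntegral.integral_Ioi_sub_Ioi' (integrableOn_incGamma s hx)
    (integrableOn_incGamma s hy), incGamma, incGamma, sub_sub_cancel]

lemma hasDerivAt_incGamma (s : ℝ) {x : ℝ} (hx : 0 < x) :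
    HasDerivAt (incGamma s) (-(Real.exp (-x) * x ^ (s - 1))) x := by
  have hc : ContinuousOn (fun t : ℝ => Real.exp (-t) * t ^ (s - 1)) (Set.Ioi 0) := by
    refine ContinuousOn.mul (by fun_prop) fun t ht => ?_
    exact (Real.continuousAt_rpow_const _ _ (Or.inl (ne_of_gt ht))).continuousWithinAt
  have h1 := intervalIntegral.integral_hasDerivAt_right (a := x) (b := x)
    (f := fun t : ℝ => Real.exp (-t) * t ^ (s - 1)) (by simp)
    (hc.stronglyMeasurableAtFilter isOpen_Ioi x hx) (hc.continuousAt (Ioi_mem_nhds hx))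
  refine (h1.const_sub (incGamma s x)).congr_of_eventuallyEq ?_
  filter_upwards [Ioi_mem_nhds hx] with y hy
  exact incGamma_eq_sub s hx hy

lemma incGamma_nonneg (s : ℝ) {x : ℝ} (hx : 0 < x) : 0 ≤ incGamma s x :=
  setIntegral_nonneg measurableSet_Ioi fun _ ht =>
    mul_nonneg (Real.exp_pos _).le (Real.rpow_nonneg (hx.trans ht).le _)

lemma incGamma_antitoneOn (s : ℝ) : AntitoneOn (incGamma s) (Set.Ioi 0) := by
  intro x hx y hy hxy
  rw [incGamma_eq_sub s hx hy]
  have : 0 ≤ ∫ t in x..y, Real.exp (-t) * t ^ (s - 1) :=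
    intervalIntegral.integral_nonneg hxy fun _ ht =>
      mul_nonneg (Real.exp_pos _).le (Real.rpow_nonneg (hx.out.trans_le ht.1).le _)
  linarith

lemma tendsto_incGamma (s : ℝ) : Tendsto (incGamma s) atTop (𝓝 0) := by
  have h1 := (intervalIntegral_tendsto_integral_Ioi 1 (integrableOn_incGamma s zero_lt_one)
    tendsto_id).const_sub (incGamma s 1)
  change Tendsto _ atTop (𝓝 (incGamma s 1 - incGamma s 1)) at h1
  rw [sub_self] at h1
  refine h1.congr' ?_
  filter_upwards [eventually_gt_atTop 0] with y hy
  exact (incGamma_eq_sub s zero_lt_one hy).symm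

/-- The `v`-dependence of the non-holomorphic Fourier coefficient with exponent `ν` in weight
`κ / 2`, relative to `q ^ ν`. It is zero for `ν > 0`, as no such exponents occur. -/
def nonholFactor (κ : ℤ) (ν v : ℝ) : ℝ :=
  if ν < 0 then incGamma (1 - (κ : ℝ) / 2) (4 * Real.pi * |ν| * v)
  else if ν = 0 then v ^ (1 - (κ : ℝ) / 2) else 0

lemma nonholFactor_nonneg (κ : ℤ) (ν : ℝ) {v : ℝ} (hv : 0 < v) : 0 ≤ nonholFactor κ ν v := by
  unfold nonholFactor
  split_ifs with h1 h2
  · exact incGamma_nonneg _ (by have := abs_pos.2 h1.ne; positivity)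
  · positivity
  · exact le_rfl

lemma nonholFactor_le (κ : ℤ) {ν : ℝ} (h : ν ≠ 0 ∨ 2 < κ) {v v' : ℝ} (hv : 0 < v) (hvv : v ≤ v') :
    nonholFactor κ ν v' ≤ nonholFactor κ ν v := by
  unfold nonholFactor
  split_ifs with h1 h2
  · have := abs_pos.2 h1.ne
    have hv' := hv.trans_le hvv
    exact incGamma_antitoneOn _ (Set.mem_Ioi.2 (by positivity)) (Set.mem_Ioi.2 (by positivity))
      (by gcongr)
  · have h3 : (2 : ℝ) < κ := by exact_mod_cast h.resolve_left (not_not.2 h2)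
    exact Real.rpow_le_rpow_of_nonpos hv hvv (by linarith)
  · exact le_rfl

lemma tendsto_nonholFactor (κ : ℤ) {ν : ℝ} (h : ν ≠ 0 ∨ 2 < κ) :
    Tendsto (nonholFactor κ ν) atTop (𝓝 0) := by
  unfold nonholFactor
  split_ifs with h1 h2
  · have := abs_pos.2 h1.ne
    exact (tendsto_incGamma _).comp (tendsto_id.const_mul_atTop (by positivity))
  · have h3 : (2 : ℝ) < κ := by exact_mod_cast h.resolve_left (not_not.2 h2)
    have := tendsto_rpow_neg_atTop (y := (κ : ℝ) / 2 - 1) (by linarith)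
    simpa using this
  · exact tendsto_const_nhds

/-- The factors `nonholFactor` solve the inhomogeneous equation satisfied by the Fourier
coefficients of a preimage under `ξ`. -/
lemma exists_hasDerivAt_nonholFactor {κ : ℤ} (hκ : κ ≠ 2) {ν : ℝ} (hν : ν ≤ 0) :
    ∃ c : ℝ, c ≠ 0 ∧ ∀ v : ℝ, 0 < v → HasDerivAt (nonholFactor κ ν)
      (c * (v ^ (-((κ : ℝ) / 2)) * Real.exp (4 * Real.pi * ν * v))) v := by
  have hκ' : (κ : ℝ) ≠ 2 := by exact_mod_cast hκ
  rcases hν.lt_or_eq with h | h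
  · have h0 := abs_pos.2 h.ne
    have hA : 0 < 4 * Real.pi * |ν| := by positivity
    refine ⟨-(4 * Real.pi * |ν|) ^ (1 - (κ : ℝ) / 2), neg_ne_zero.2 (by positivity), fun v hv => ?_⟩
    have h1 := (hasDerivAt_incGamma (1 - (κ : ℝ) / 2) (mul_pos hA hv)).comp v
      ((hasDerivAt_id v).const_mul (4 * Real.pi * |ν|))
    have h2 : nonholFactor κ ν =
        incGamma (1 - (κ : ℝ) / 2) ∘ fun v => 4 * Real.pi * |ν| * id v := by
      funext v
      simp [nonholFactor, h]
    rw [h2]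
    refine h1.congr_deriv ?_
    rw [Real.mul_rpow hA.le hv.le, show 1 - (κ : ℝ) / 2 - 1 = -((κ : ℝ) / 2) by ring,
      show 1 - (κ : ℝ) / 2 = -((κ : ℝ) / 2) + 1 by ring, Real.rpow_add_one hA.ne',
      show -(4 * Real.pi * |ν| * v) = 4 * Real.pi * ν * v by rw [abs_of_neg h]; ring]
    ring
  · refine ⟨1 - (κ : ℝ) / 2, fun h3 => hκ' (by linarith), fun v hv => ?_⟩
    have h2 : nonholFactor κ ν = fun v => v ^ (1 - (κ : ℝ) / 2) := by
      funext v
      simp [nonholFactor, h]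
    rw [h2]
    refine (Real.hasDerivAt_rpow_const (Or.inl hv.ne')).congr_deriv ?_
    rw [h, show 1 - (κ : ℝ) / 2 - 1 = -((κ : ℝ) / 2) by ring]
    simp

end IncGamma

section FourierCoefficients

/-- The Fourier coefficient with exponent `ν` of `F` at height `v`, including the exponential
factor. -/
def fourierInt (F : ℂ → ℂ) (ν v : ℝ) : ℂ :=
  ∫ u in (0 : ℝ)..1, F (u + v * Complex.I) * e (-(ν * u))

lemma hasDerivAt_e_neg (ν u : ℝ) :
    HasDerivAt (fun u : ℝ => e (-(ν * u))) (-(2 * Real.pi * Complex.I * ν) * e (-(ν * u))) u := by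
  have h1 : HasDerivAt (fun u : ℝ => 2 * Real.pi * Complex.I * (-((ν : ℂ) * u)))
      (2 * Real.pi * Complex.I * (-((ν : ℂ) * 1))) u :=
    (((hasDerivAt_id u).ofReal_comp.const_mul (ν : ℂ)).neg).const_mul _
  refine h1.cexp.congr_deriv ?_
  rw [e]
  ring

/-- Integration by parts for quasi-periodic functions. -/
lemma integral_deriv_mul_e {φ φ' : ℝ → ℂ} (h : ∀ u, HasDerivAt φ (φ' u) u) (hφ' : Continuous φ')
    {ν : ℝ} (hper : φ 1 = e ν * φ 0) :
    ∫ u in (0 : ℝ)..1, φ' u * e (-(ν * u)) =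
      2 * Real.pi * Complex.I * ν * ∫ u in (0 : ℝ)..1, φ u * e (-(ν * u)) := by
  have he : Continuous fun u : ℝ => e (-(ν * u)) := continuous_e.comp (by fun_prop)
  have hφ : Continuous φ := continuous_iff_continuousAt.2 fun u => (h u).continuousAt
  have h1 := intervalIntegral.integral_eq_sub_of_hasDerivAt (a := 0) (b := 1)
    (fun u _ => (h u).mul (hasDerivAt_e_neg ν u))
    (((hφ'.mul he).add (hφ.mul (continuous_const.mul he))).intervalIntegrable _ _)
  have hc1 : Continuous fun u : ℝ => φ' u * e (-(ν * u)) := hφ'.mul he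
  have hc2 : Continuous fun u : ℝ => φ u * (-(2 * Real.pi * Complex.I * ν) * e (-(ν * u))) :=
    hφ.mul (continuous_const.mul he)
  rw [intervalIntegral.integral_add (hc1.intervalIntegrable _ _)
    (hc2.intervalIntegrable _ _)] at h1
  have h2 : ∫ u in (0 : ℝ)..1, φ u * (-(2 * Real.pi * Complex.I * ν) * e (-(ν * u))) =
      -(2 * Real.pi * Complex.I * ν) * ∫ u in (0 : ℝ)..1, φ u * e (-(ν * u)) := by
    rw [← intervalIntegral.integral_const_mul]
    exact intervalIntegral.integral_congr fun u _ => by ring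
  have h3 : φ 1 * e (-((ν : ℂ) * ((1 : ℝ) : ℂ))) - φ 0 * e (-((ν : ℂ) * ((0 : ℝ) : ℂ))) = 0 := by
    rw [hper]
    have h4 := e_neg_mul_e ν
    have h5 : e 0 = 1 := by simp [e]
    simp only [Complex.ofReal_one, Complex.ofReal_zero, mul_one, mul_zero, neg_zero, h5]
    linear_combination φ 0 * h4
  simp only [Pi.mul_apply] at h1
  rw [h2, h3] at h1
  linear_combination h1

variable {F : ℂ → ℂ}

lemma isOpen_im_pos : IsOpen {z : ℂ | 0 < z.im} :=
  isOpen_lt continuous_const Complex.continuous_im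

lemma hasDerivAt_horizontal (hF : ContDiffOn ℝ 1 F {z : ℂ | 0 < z.im}) {v : ℝ} (hv : 0 < v)
    (u : ℝ) : HasDerivAt (fun u : ℝ => F (u + v * Complex.I))
      (fderiv ℝ F (u + v * Complex.I) 1) u := by
  have hz : 0 < ((u : ℂ) + v * Complex.I).im := by simpa using hv
  have h1 := ((hF.contDiffAt (isOpen_im_pos.mem_nhds hz)).differentiableAt one_ne_zero).hasFDerivAt
  exact h1.comp_hasDerivAt u ((hasDerivAt_id u).ofReal_comp.add_const _)

lemma hasDerivAt_vertical (hF : ContDiffOn ℝ 1 F {z : ℂ | 0 < z.im}) {v : ℝ} (hv : 0 < v)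
    (u : ℝ) : HasDerivAt (fun v : ℝ => F (u + v * Complex.I))
      (fderiv ℝ F (u + v * Complex.I) Complex.I) v := by
  have hz : 0 < ((u : ℂ) + v * Complex.I).im := by simpa using hv
  have h1 := ((hF.contDiffAt (isOpen_im_pos.mem_nhds hz)).differentiableAt one_ne_zero).hasFDerivAt
  have h2 : HasDerivAt (fun v : ℝ => (u : ℂ) + v * Complex.I) (1 * Complex.I) v :=
    ((hasDerivAt_id v).ofReal_comp.mul_const _).const_add _
  rw [one_mul] at h2
  exact h1.comp_hasDerivAt v h2

lemma continuousOn_fderiv_apply (hF : ContDiffOn ℝ 1 F {z : ℂ | 0 < z.im}) (c : ℂ) :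
    ContinuousOn (fun z => fderiv ℝ F z c) {z : ℂ | 0 < z.im} :=
  (hF.continuousOn_fderiv_of_isOpen isOpen_im_pos le_rfl).clm_apply continuousOn_const

lemma continuous_horizontal (hF : ContinuousOn F {z : ℂ | 0 < z.im}) {v : ℝ} (hv : 0 < v) :
    Continuous fun u : ℝ => F (u + v * Complex.I) :=
  hF.comp_continuous (by fun_prop) fun u => by simpa using hv

lemma continuousOn_dbar (hF : ContDiffOn ℝ 1 F {z : ℂ | 0 < z.im}) :
    ContinuousOn (dbar F) {z : ℂ | 0 < z.im} :=
  ((continuousOn_fderiv_apply hF 1).add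
    (continuousOn_const.mul (continuousOn_fderiv_apply hF Complex.I))).div_const 2

/-- The vertical derivative of a Fourier coefficient. -/
lemma hasDerivAt_fourierInt (hF : ContDiffOn ℝ 1 F {z : ℂ | 0 < z.im}) {ν : ℝ}
    (hper : ∀ z : ℂ, 0 < z.im → F (z + 1) = e ν * F z) {v : ℝ} (hv : 0 < v) :
    HasDerivAt (fourierInt F ν)
      (-(2 * Real.pi * ν) * fourierInt F ν v - 2 * Complex.I * fourierInt (dbar F) ν v) v := by
  have he : Continuous fun u : ℝ => e (-(ν * u)) := continuous_e.comp (by fun_prop)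
  have hcI := continuousOn_fderiv_apply hF Complex.I
  have hc1 := continuousOn_fderiv_apply hF 1
  -- a bound for the vertical derivative near height `v`
  obtain ⟨B, hB⟩ := ((isCompact_uIcc (a := (0 : ℝ)) (b := 1)).prod
    (isCompact_Icc (a := v / 2) (b := 2 * v))).exists_bound_of_continuousOn
    (f := fun p : ℝ × ℝ => fderiv ℝ F (p.1 + p.2 * Complex.I) Complex.I * e (-(ν * p.1))) (by
      refine ContinuousOn.mul (hcI.comp (by fun_prop) fun p hp => ?_)
        (continuous_e.comp (by fun_prop)).continuousOn
      have : 0 < p.2 := lt_of_lt_of_le (by linarith) hp.2.1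
      simpa using this)
  have h1 := intervalIntegral.hasDerivAt_integral_of_dominated_loc_of_deriv_le
    (μ := volume) (a := 0) (b := 1) (x₀ := v) (s := Set.Icc (v / 2) (2 * v)) (bound := fun _ => B)
    (F := fun v u => F ((u : ℝ) + (v : ℝ) * Complex.I) * e (-(ν * u)))
    (F' := fun v u => fderiv ℝ F ((u : ℝ) + (v : ℝ) * Complex.I) Complex.I * e (-(ν * u)))
    (Icc_mem_nhds (by linarith) (by linarith))
    (by
      filter_upwards [Ioi_mem_nhds hv] with x hx
      exact ((continuous_horizontal hF.continuousOn hx).mul he).aestronglyMeasurable)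
    (((continuous_horizontal hF.continuousOn hv).mul he).intervalIntegrable _ _)
    ((continuous_horizontal hcI hv).mul he).aestronglyMeasurable
    (ae_of_all _ fun u hu x hx => hB (u, x) ⟨Set.uIoc_subset_uIcc hu, hx⟩)
    (by simp)
    (ae_of_all _ fun u _ x hx => (hasDerivAt_vertical hF (lt_of_lt_of_le (by linarith) hx.1)
      u).mul_const _)
  refine h1.2.congr_deriv ?_
  have h2 := integral_deriv_mul_e (hasDerivAt_horizontal hF hv) (continuous_horizontal hc1 hv)
    (ν := ν) (by
      have := hper (v * Complex.I) (by simpa using hv)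
      simpa [add_comm] using this)
  have h3 : 2 * Complex.I * fourierInt (dbar F) ν v =
      Complex.I * (∫ u in (0 : ℝ)..1, fderiv ℝ F (u + v * Complex.I) 1 * e (-(ν * u))) -
        ∫ u in (0 : ℝ)..1, fderiv ℝ F (u + v * Complex.I) Complex.I * e (-(ν * u)) := by
    have hd1 : Continuous fun u : ℝ =>
        Complex.I * (fderiv ℝ F (u + v * Complex.I) 1 * e (-(ν * u))) :=
      continuous_const.mul ((continuous_horizontal hc1 hv).mul he)
    have hd2 : Continuous fun u : ℝ => fderiv ℝ F (u + v * Complex.I) Complex.I * e (-(ν * u)) :=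
      (continuous_horizontal hcI hv).mul he
    rw [fourierInt, ← intervalIntegral.integral_const_mul, ← intervalIntegral.integral_const_mul,
      ← intervalIntegral.integral_sub (hd1.intervalIntegrable _ _) (hd2.intervalIntegrable _ _)]
    refine intervalIntegral.integral_congr fun u _ => ?_
    simp only [dbar]
    linear_combination fderiv ℝ F (u + v * Complex.I) Complex.I * e (-(ν * u)) * Complex.I_sq
  rw [h3, h2]
  simp only [fourierInt]
  linear_combination (2 * Real.pi * ν * ∫ u in (0 : ℝ)..1, F (u + v * Complex.I) * e (-(ν * u))) *
    Complex.I_sq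

lemma norm_fourierInt_le {ν v B : ℝ} (hB : ∀ u : ℝ, ‖F (u + v * Complex.I)‖ ≤ B) :
    ‖fourierInt F ν v‖ ≤ B := by
  have h1 := intervalIntegral.norm_integral_le_of_norm_le_const (a := 0) (b := 1) (C := B)
    (f := fun u : ℝ => F (u + v * Complex.I) * e (-(ν * u))) fun u _ => by
      rw [norm_mul, show (-((ν : ℂ) * u)) = ((-(ν * u) : ℝ) : ℂ) by push_cast; ring, norm_e_real,
        mul_one]
      exact hB u
  simpa [fourierInt] using h1

lemma eq_of_hasDerivAt_zero {φ : ℝ → ℂ} (h : ∀ v, 0 < v → HasDerivAt φ 0 v) {v : ℝ} (hv : 0 < v) :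
    φ v = φ 1 :=
  isOpen_Ioi.is_const_of_deriv_eq_zero isPreconnected_Ioi
    (fun x hx => (h x hx).differentiableAt.differentiableWithinAt) (fun x hx => (h x hx).deriv)
    (Set.mem_Ioi.2 hv) (Set.mem_Ioi.2 one_pos)

/-- A quasi-periodic function of class `C²` is the sum of its Fourier series, and the series
converges absolutely. -/
lemma hasSum_fourierInt (hF : ContDiffOn ℝ 2 F {z : ℂ | 0 < z.im}) {x : ℝ}
    (hper : ∀ z : ℂ, 0 < z.im → F (z + 1) = e x * F z) {v : ℝ} (hv : 0 < v) (u : ℝ) :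
    HasSum (fun m : ℤ => fourierInt F (x + m) v * e ((x + m) * u)) (F (u + v * Complex.I)) := by
  have hF1 : ContDiffOn ℝ 1 F {z : ℂ | 0 < z.im} := hF.of_le (by norm_num)
  set φ : ℝ → ℂ := fun u => F (u + v * Complex.I) with hφ
  have hφc : Continuous φ := continuous_horizontal hF1.continuousOn hv
  have hφp : ∀ u, φ (u + 1) = e x * φ u := fun u => by
    have := hper (u + v * Complex.I) (by simpa using hv)
    simp only [hφ]
    rw [← this]
    push_cast
    ring_nf
  have hexm : ∀ m : ℤ, e ((x + m : ℝ) : ℂ) = e x := fun m => by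
    push_cast
    exact e_add_int _ _
  -- the periodic function `u ↦ F(u + iv) e(-xu)`
  set ψ : ℝ → ℂ := fun u => φ u * e (-(x * u)) with hψ
  have hψp : Function.Periodic ψ 1 := fun u => by
    simp only [hψ, hφp]
    rw [show (-((x : ℂ) * ((u + 1 : ℝ) : ℂ))) = -(x * u) + -x by push_cast; ring, e_add]
    linear_combination φ u * e (-(x * u)) * e_neg_mul_e x
  have hψc : Continuous ψ := hφc.mul (continuous_e.comp (by fun_prop))
  let Ψ : C(AddCircle (1 : ℝ), ℂ) :=
    ⟨hψp.lift, continuous_coinduced_dom.mpr hψc⟩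
  have hcoeff : ∀ m : ℤ, fourierCoeff Ψ m = fourierInt F (x + m) v := fun m => by
    rw [fourierCoeff_eq_intervalIntegral _ _ 0, fourierInt]
    simp only [div_one, one_smul, zero_add]
    refine intervalIntegral.integral_congr fun u _ => ?_
    have h1 : Ψ (u : AddCircle (1 : ℝ)) = ψ u := hψp.lift_coe u
    simp only [h1, fourier_coe_apply, smul_eq_mul, hψ, hφ]
    rw [show Complex.exp (2 * Real.pi * Complex.I * ((-m : ℤ) : ℂ) * u / ((1 : ℝ) : ℂ)) =
      e (-(m * u)) by rw [e]; congr 1; push_cast; ring,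
      show (-(((x + m : ℝ) : ℂ) * u)) = -(x * u) + -(m * u) by push_cast; ring, e_add]
    ring
  -- two integrations by parts
  have hdec : ∀ m : ℤ, (2 * Real.pi * Complex.I * ((x + m : ℝ) : ℂ)) ^ 2 * fourierInt F (x + m) v =
      ∫ u in (0 : ℝ)..1, fderiv ℝ (fun z => fderiv ℝ F z 1) (u + v * Complex.I) 1 *
        e (-((x + m : ℝ) * u)) := by
    intro m
    have hF2 : ContDiffOn ℝ 1 (fun z => fderiv ℝ F z 1) {z : ℂ | 0 < z.im} :=
      (hF.fderiv_of_isOpen isOpen_im_pos (by norm_num)).clm_apply contDiffOn_const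
    have hd := hasDerivAt_horizontal hF1 hv
    have hperd : fderiv ℝ F ((1 : ℝ) + v * Complex.I) 1 =
        e ((x + m : ℝ) : ℂ) * fderiv ℝ F ((0 : ℝ) + v * Complex.I) 1 := by
      rw [hexm]
      have h1 : HasDerivAt (fun u : ℝ => φ (u + 1)) (fderiv ℝ F ((1 : ℝ) + v * Complex.I) 1) 0 := by
        have := hd (0 + 1)
        rw [zero_add] at this
        have h2 := HasDerivAt.comp_add_const (x := 0) (a := 1) (f := φ) (by simpa using this)
        exact h2
      have h2 : HasDerivAt (fun u : ℝ => φ (u + 1))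
          (e x * fderiv ℝ F ((0 : ℝ) + v * Complex.I) 1) 0 := by
        simp only [hφp]
        exact (hd 0).const_mul _
      exact h1.unique h2
    rw [integral_deriv_mul_e (hasDerivAt_horizontal hF2 hv)
      (continuous_horizontal (continuousOn_fderiv_apply hF2 1) hv) hperd,
      integral_deriv_mul_e hd (continuous_horizontal (continuousOn_fderiv_apply hF1 1) hv)
        (by rw [hexm]; simpa [hφ] using hφp 0), fourierInt]
    ring
  have hsum : Summable (fourierCoeff Ψ) := by
    obtain ⟨B, hB⟩ := (isCompact_uIcc (a := (0 : ℝ)) (b := 1)).exists_bound_of_continuousOn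
      (f := fun u : ℝ => fderiv ℝ (fun z => fderiv ℝ F z 1) (u + v * Complex.I) 1) (by
        have hF2 : ContDiffOn ℝ 1 (fun z => fderiv ℝ F z 1) {z : ℂ | 0 < z.im} :=
          (hF.fderiv_of_isOpen isOpen_im_pos (by norm_num)).clm_apply contDiffOn_const
        exact (continuous_horizontal (continuousOn_fderiv_apply hF2 1) hv).continuousOn)
    have hB' : ∀ m : ℤ, (2 * Real.pi) ^ 2 * |(m : ℝ) + x| ^ 2 * ‖fourierInt F (x + m) v‖ ≤ B := by
      intro m
      have h1 := intervalIntegral.norm_integral_le_of_norm_le_const (a := 0) (b := 1) (C := B)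
        (f := fun u : ℝ => fderiv ℝ (fun z => fderiv ℝ F z 1) (u + v * Complex.I) 1 *
          e (-((x + m : ℝ) * u))) fun u hu => by
          rw [norm_mul, show (-(((x + m : ℝ) : ℂ) * u)) = ((-((x + m) * u) : ℝ) : ℂ) by
            push_cast; ring, norm_e_real, mul_one]
          exact hB u (Set.uIoc_subset_uIcc hu)
      rw [← hdec, norm_mul, norm_pow, norm_mul, norm_mul, norm_mul, Complex.norm_I, mul_one,
        Complex.norm_real, Complex.norm_real, Complex.norm_ofNat, Real.norm_eq_abs,
        Real.norm_eq_abs, abs_of_pos Real.pi_pos, mul_pow, add_comm x] at h1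
      rw [add_comm x]
      simpa using h1
    refine Summable.of_norm_bounded_eventually
      (((Real.summable_one_div_int_add_rpow x 2).2 (by norm_num)).mul_left
        (B / (2 * Real.pi) ^ 2)) ?_
    have hfin : {m : ℤ | (m : ℝ) + x = 0}.Finite := by
      refine Set.Subsingleton.finite fun m hm m' hm' => ?_
      have : (m : ℝ) = m' := by
        have h1 : (m : ℝ) + x = 0 := hm
        have h2 : (m' : ℝ) + x = 0 := hm'
        linarith
      exact_mod_cast this
    filter_upwards [hfin.compl_mem_cofinite] with m hm
    have h0 : 0 < |(m : ℝ) + x| := abs_pos.2 hm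
    rw [hcoeff, Real.rpow_two, div_mul_div_comm, mul_one, le_div_iff₀ (by positivity)]
    calc _ = (2 * Real.pi) ^ 2 * |(m : ℝ) + x| ^ 2 * ‖fourierInt F (x + m) v‖ := by ring
      _ ≤ B := hB' m
  have key := (has_pointwise_sum_fourier_series_of_summable hsum (u : AddCircle (1 : ℝ))).mul_right
    (e (x * u))
  have h1 : Ψ (u : AddCircle (1 : ℝ)) = ψ u := hψp.lift_coe u
  rw [h1] at key
  have h2 : ψ u * e (x * u) = F (u + v * Complex.I) := by
    simp only [hψ, hφ]
    linear_combination F (u + v * Complex.I) * e_neg_mul_e (x * u)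
  rw [h2] at key
  refine key.congr_fun fun m => ?_
  simp only [smul_eq_mul, hcoeff, fourier_coe_apply]
  rw [show Complex.exp (2 * Real.pi * Complex.I * (m : ℂ) * u / ((1 : ℝ) : ℂ)) =
      e (m * u) by rw [e]; congr 1; push_cast; ring, mul_assoc, ← e_add]
  ring_nf

end FourierCoefficients

section Coefficients

variable {F G : ℂ → ℂ}

lemma contDiffOn_of_differentiableOn (hG : DifferentiableOn ℂ G {z : ℂ | 0 < z.im})
    (n : WithTop ℕ∞) :
    ContDiffOn ℝ n G {z : ℂ | 0 < z.im} :=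
  (hG.contDiffOn isOpen_im_pos).restrict_scalars ℝ

lemma dbar_eq_zero (hG : DifferentiableOn ℂ G {z : ℂ | 0 < z.im}) {z : ℂ} (hz : 0 < z.im) :
    dbar G z = 0 := by
  have h1 := hG.differentiableAt (isOpen_im_pos.mem_nhds hz)
  rw [dbar, h1.fderiv_restrictScalars ℝ]
  simp only [ContinuousLinearMap.coe_restrictScalars']
  have h2 : fderiv ℂ G z Complex.I = Complex.I * fderiv ℂ G z 1 := by
    rw [← smul_eq_mul, ← map_smul, smul_eq_mul, mul_one]
  rw [h2]
  linear_combination (fderiv ℂ G z 1 / 2) * Complex.I_sq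

/-- The Fourier coefficients of a holomorphic function are constant multiples of exponentials. -/
lemma exists_fourierInt_eq (hG : DifferentiableOn ℂ G {z : ℂ | 0 < z.im}) {ν : ℝ}
    (hper : ∀ z : ℂ, 0 < z.im → G (z + 1) = e ν * G z) :
    ∃ D : ℂ, ∀ v, 0 < v → fourierInt G ν v = D * Real.exp (-(2 * Real.pi * ν * v)) := by
  set φ : ℝ → ℂ := fun v => fourierInt G ν v * (Real.exp (2 * Real.pi * ν * v) : ℝ) with hφ
  have hd : ∀ v, 0 < v → HasDerivAt φ 0 v := by
    intro v hv
    have h1 := hasDerivAt_fourierInt (contDiffOn_of_differentiableOn hG 1) hper hv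
    have h0 : fourierInt (dbar G) ν v = 0 := by
      rw [fourierInt]
      refine (intervalIntegral.integral_congr (g := fun _ => 0) fun u _ => ?_).trans (by simp)
      simp only
      rw [dbar_eq_zero hG (by simpa using hv), zero_mul]
    rw [h0, mul_zero, sub_zero] at h1
    have h2 : HasDerivAt (fun v : ℝ => Real.exp (2 * Real.pi * ν * v))
        (Real.exp (2 * Real.pi * ν * v) * (2 * Real.pi * ν * 1)) v :=
      ((hasDerivAt_id v).const_mul _).exp
    refine (h1.mul h2.ofReal_comp).congr_deriv ?_
    push_cast
    ring
  refine ⟨φ 1, fun v hv => ?_⟩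
  rw [← eq_of_hasDerivAt_zero hd hv]
  simp only [hφ]
  rw [mul_assoc, ← Complex.ofReal_mul, ← Real.exp_add, add_neg_cancel, Real.exp_zero,
    Complex.ofReal_one, mul_one]

lemma fourierInt_dbar {κ : ℤ} (hFG : ∀ z : ℂ, 0 < z.im →
      dbar F z = Complex.I / 2 * (z.im ^ (-((κ : ℝ) / 2)) : ℝ) * conj (G z)) (ν : ℝ) {v : ℝ}
    (hv : 0 < v) : fourierInt (dbar F) ν v = Complex.I / 2 *
      (v ^ (-((κ : ℝ) / 2)) : ℝ) * conj (fourierInt G (-ν) v) := by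
  rw [fourierInt, fourierInt, ← intervalIntegral.intervalIntegral_conj,
    ← intervalIntegral.integral_const_mul]
  refine intervalIntegral.integral_congr fun u _ => ?_
  rw [hFG _ (by simpa using hv), map_mul, conj_e]
  simp
  ring

/-- The shape of the Fourier coefficients of a preimage `F` under `ξ` of a bounded holomorphic
function. -/
theorem exists_fourierInt_eq_add {κ : ℤ} (hκ : κ ≠ 2) {x : ℝ}
    (hF : ContDiffOn ℝ 1 F {z : ℂ | 0 < z.im})
    (hFper : ∀ z : ℂ, 0 < z.im → F (z + 1) = e x * F z)
    (hG : DifferentiableOn ℂ G {z : ℂ | 0 < z.im})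
    (hGper : ∀ z : ℂ, 0 < z.im → G (z + 1) = e (-x) * G z)
    (hFG : ∀ z : ℂ, 0 < z.im →
      dbar F z = Complex.I / 2 * (z.im ^ (-((κ : ℝ) / 2)) : ℝ) * conj (G z))
    (hGb : ∃ B A : ℝ, ∀ z : ℂ, 0 < z.im → A ≤ z.im → ‖G z‖ ≤ B)
    (hFb : ∃ B C A : ℝ, ∀ z : ℂ, 0 < z.im → A ≤ z.im → ‖F z‖ ≤ B * Real.exp (C * z.im)) :
    ∃ a a' : ℤ → ℂ, (∃ n₀ : ℝ, ∀ m : ℤ, x + m < n₀ → a m = 0) ∧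
      (∀ m : ℤ, 0 < x + m → a' m = 0) ∧
      ∀ (m : ℤ) (v : ℝ), 0 < v → fourierInt F (x + m) v =
        (a m + a' m * nonholFactor κ (x + m) v) * Real.exp (-(2 * Real.pi * (x + m) * v)) := by
  obtain ⟨BG, AG, hGb⟩ := hGb
  obtain ⟨BF, C, AF, hFb⟩ := hFb
  have hGb' : ∀ (ν v : ℝ), 0 < v → AG ≤ v → ‖fourierInt G ν v‖ ≤ BG := fun ν v hv hA =>
    norm_fourierInt_le fun u => hGb _ (by simpa using hv) (by simpa using hA)
  have hFb' : ∀ (ν v : ℝ), 0 < v → AF ≤ v → ‖fourierInt F ν v‖ ≤ BF * Real.exp (C * v) :=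
    fun ν v hv hA => norm_fourierInt_le fun u => by
      simpa using hFb (u + v * Complex.I) (by simpa using hv) (by simpa using hA)
  have key : ∀ m : ℤ, ∃ a a' : ℂ, (0 < x + m → a' = 0) ∧ ∀ v : ℝ, 0 < v → fourierInt F (x + m) v =
      (a + a' * nonholFactor κ (x + m) v) * Real.exp (-(2 * Real.pi * (x + m) * v)) := by
    intro m
    set ν : ℝ := x + m with hν
    have hFper' : ∀ z : ℂ, 0 < z.im → F (z + 1) = e ν * F z := fun z hz => by
      rw [hFper z hz, hν, Complex.ofReal_add, Complex.ofReal_intCast, e_add_int]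
    have hGper' : ∀ z : ℂ, 0 < z.im → G (z + 1) = e ((-ν : ℝ) : ℂ) * G z := fun z hz => by
      rw [hGper z hz, hν, show (((-(x + m) : ℝ)) : ℂ) = -x + ((-m : ℤ) : ℂ) by push_cast; ring,
        e_add_int]
    obtain ⟨D, hD⟩ := exists_fourierInt_eq hG hGper'
    set φ : ℝ → ℂ := fun v => fourierInt F ν v * (Real.exp (2 * Real.pi * ν * v) : ℝ) with hφ
    have hφd : ∀ v, 0 < v → HasDerivAt φ
        (conj D * ((v ^ (-((κ : ℝ) / 2)) * Real.exp (4 * Real.pi * ν * v) : ℝ) : ℂ)) v := by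
      intro v hv
      have h1 := hasDerivAt_fourierInt hF hFper' hv
      have h2 : HasDerivAt (fun v : ℝ => Real.exp (2 * Real.pi * ν * v))
          (Real.exp (2 * Real.pi * ν * v) * (2 * Real.pi * ν * 1)) v :=
        ((hasDerivAt_id v).const_mul _).exp
      refine (h1.mul h2.ofReal_comp).congr_deriv ?_
      rw [fourierInt_dbar hFG ν hv, hD v hv,
        show 4 * Real.pi * ν * v = 2 * Real.pi * ν * v + 2 * Real.pi * ν * v by ring,
        Real.exp_add, show -(2 * Real.pi * -ν * v) = 2 * Real.pi * ν * v by ring, map_mul,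
        Complex.conj_ofReal]
      push_cast
      linear_combination (-(v ^ (-((κ : ℝ) / 2)) : ℝ) * conj D * Complex.exp (2 * Real.pi * ν * v) *
        Complex.exp (2 * Real.pi * ν * v)) * Complex.I_sq
    have hback : ∀ (c : ℂ) (v : ℝ), φ v = c →
        fourierInt F ν v = c * Real.exp (-(2 * Real.pi * (x + m) * v)) := by
      rintro c v rfl
      simp only [hφ]
      rw [mul_assoc, ← Complex.ofReal_mul, ← Real.exp_add, ← hν, add_neg_cancel, Real.exp_zero,
        Complex.ofReal_one, mul_one]
    rcases lt_or_ge 0 ν with hpos | hneg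
    · -- `G` is bounded, hence has no coefficient with negative exponent `-ν`
      have hD0 : D = 0 := by
        have h1 : Tendsto (fun v : ℝ => BG * Real.exp (-(2 * Real.pi * ν * v))) atTop (𝓝 0) := by
          have h2 : Tendsto (fun v : ℝ => Real.exp (-(2 * Real.pi * ν * v))) atTop (𝓝 0) :=
            Real.tendsto_exp_neg_atTop_nhds_zero.comp (tendsto_id.const_mul_atTop (by positivity))
          simpa using h2.const_mul BG
        refine norm_le_zero_iff.1 (ge_of_tendsto h1 ?_)
        filter_upwards [eventually_gt_atTop 0, eventually_ge_atTop AG] with v hv hA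
        have h3 := hGb' (-ν) v hv hA
        rw [hD v hv, norm_mul, Complex.norm_real, Real.norm_eq_abs, abs_of_pos (Real.exp_pos _),
          show -(2 * Real.pi * -ν * v) = 2 * Real.pi * ν * v by ring] at h3
        rw [Real.exp_neg, ← div_eq_mul_inv, le_div_iff₀ (Real.exp_pos _)]
        exact h3
      refine ⟨φ 1, 0, fun _ => rfl, fun v hv => hback _ _ ?_⟩
      rw [zero_mul, add_zero]
      exact eq_of_hasDerivAt_zero (fun v hv => by simpa [hD0] using hφd v hv) hv
    · obtain ⟨c, hc0, hc⟩ := exists_hasDerivAt_nonholFactor hκ hneg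
      have hc0' : (c : ℂ) ≠ 0 := by exact_mod_cast hc0
      have h1 : ∀ v, 0 < v → HasDerivAt (fun v => φ v - conj D / c * nonholFactor κ ν v) 0 v := by
        intro v hv
        refine ((hφd v hv).sub ((hc v hv).ofReal_comp.const_mul (conj D / c))).congr_deriv ?_
        push_cast
        field_simp
        ring
      refine ⟨φ 1 - conj D / c * nonholFactor κ ν 1, conj D / c, fun h => absurd h hneg.not_gt,
        fun v hv => hback _ _ ?_⟩
      have := eq_of_hasDerivAt_zero h1 hv
      rw [← this, sub_add_cancel]
  choose a a' ha' hexp using key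
  refine ⟨a, a', ⟨min 0 (-(C / (2 * Real.pi))), fun m hm => ?_⟩, ha', hexp⟩
  -- the growth condition bounds the principal part
  have hν0 : x + m < 0 := hm.trans_le (min_le_left _ _)
  have hν1 : C + 2 * Real.pi * (x + m) < 0 := by
    have h1 := hm.trans_le (min_le_right _ _)
    have h2 : 2 * Real.pi * (x + m) < 2 * Real.pi * -(C / (2 * Real.pi)) :=
      mul_lt_mul_of_pos_left h1 (by positivity)
    have h3 : 2 * Real.pi * -(C / (2 * Real.pi)) = -C := by field_simp
    linarith
  have h1 : Tendsto (fun v : ℝ => BF * Real.exp (-(-(C + 2 * Real.pi * (x + m)) * v)) +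
      ‖a' m‖ * nonholFactor κ (x + m) v) atTop (𝓝 0) := by
    have h2 : Tendsto (fun v : ℝ => Real.exp (-(-(C + 2 * Real.pi * (x + m)) * v))) atTop (𝓝 0) :=
      Real.tendsto_exp_neg_atTop_nhds_zero.comp (tendsto_id.const_mul_atTop (by linarith))
    simpa using (h2.const_mul BF).add
      ((tendsto_nonholFactor κ (Or.inl hν0.ne)).const_mul ‖a' m‖)
  refine norm_le_zero_iff.1 (ge_of_tendsto h1 ?_)
  filter_upwards [eventually_gt_atTop 0, eventually_ge_atTop AF] with v hv hA
  have h3 : a m = fourierInt F (x + m) v * (Real.exp (2 * Real.pi * (x + m) * v) : ℝ) -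
      a' m * nonholFactor κ (x + m) v := by
    rw [hexp m v hv, mul_assoc, ← Complex.ofReal_mul, ← Real.exp_add, neg_add_cancel, Real.exp_zero,
      Complex.ofReal_one, mul_one, add_sub_cancel_right]
  rw [h3]
  refine (norm_sub_le _ _).trans (add_le_add ?_ ?_)
  · rw [norm_mul, Complex.norm_real, Real.norm_eq_abs, abs_of_pos (Real.exp_pos _),
      show -(-(C + 2 * Real.pi * (x + m)) * v) = C * v + 2 * Real.pi * (x + m) * v by ring,
      Real.exp_add, ← mul_assoc]
    exact mul_le_mul_of_nonneg_right (hFb' _ v hv hA) (Real.exp_pos _).le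
  · rw [norm_mul, Complex.norm_real, Real.norm_eq_abs, abs_of_nonneg (nonholFactor_nonneg _ _ hv)]

end Coefficients

section Expansion

variable {V : Type*} [AddCommGroup V] [Module ℝ V] {Q : QuadraticForm ℝ V} {M : AddSubgroup V}

section

variable {ι : Type*} {κ : ℤ} {a : ι → ℝ → ℂ} {τ : ℍ} {γ : ι}

variable (κ a) in
/-- The coefficient of `q ^ n` in the component `γ` at height `v` of a Fourier expansion with
coefficients `a` and `a'`. -/
def coeffAt (a' : ι → ℝ → ℂ) (v : ℝ) (γ : ι) (n : ℝ) : ℂ := a γ n + a' γ n * nonholFactor κ n v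

lemma minusTerm_eq (n : Set.Iio (0 : ℝ)) :
    minusTerm κ a τ γ n = a γ n * nonholFactor κ n τ.im * e (n * τ) := by
  rw [minusTerm, nonholFactor, if_pos (Set.mem_Iio.1 n.2)]

lemma hasSum_nonholPart (h : Summable fun n : Set.Iio (0 : ℝ) => minusTerm κ a τ γ n) :
    HasSum (fun n : ℝ => a γ n * nonholFactor κ n τ.im * e (n * τ)) (nonholPart κ a τ γ) := by
  set q : ℝ → ℂ := fun n => a γ n * nonholFactor κ n τ.im * e (n * τ) with hq
  have h1 : HasSum (Set.indicator (Set.Iio (0 : ℝ)) q)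
      (∑' n : Set.Iio (0 : ℝ), minusTerm κ a τ γ n) := by
    rw [← hasSum_subtype_iff_indicator]
    exact h.hasSum.congr_fun fun n => (minusTerm_eq n).symm
  have h2 : HasSum (Pi.single (0 : ℝ) (q 0)) (q 0) := hasSum_pi_single 0 (q 0)
  have h3 : q 0 = a γ 0 * ((τ.im ^ (1 - (κ : ℝ) / 2) : ℝ) : ℂ) := by
    simp [hq, nonholFactor, e]
  rw [nonholPart, ← h3]
  refine (h2.add h1).congr_fun fun n => ?_
  rcases lt_trichotomy n 0 with h | h | h
  · simp [h, h.ne]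
  · subst h
    simp
  · simp [h.not_gt, h.ne', hq, nonholFactor]

end

variable {ε : ℤˣ} {κ : ℤ} {f : ℍ → Disc Q M → ℂ}

/-- Summation over real exponents reduces to summation over a coset of `ℤ`. -/
lemma hasSum_coset_iff {g : ℝ → ℂ} {s : ℂ} {x y : ℝ} (hx : ∃ m : ℤ, x = y + m)
    (hg : ∀ n, g n ≠ 0 → ∃ m : ℤ, n = y + m) :
    HasSum (fun m : ℤ => g (x + m)) s ↔ HasSum g s := by
  have hi : Function.Injective fun m : ℤ => x + m := fun m m' h => by simpa using h
  refine hi.hasSum_iff (f := g) fun n hn => ?_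
  by_contra h0
  obtain ⟨m, hm⟩ := hg n h0
  obtain ⟨k, hk⟩ := hx
  exact hn ⟨m - k, by simp only; push_cast; linarith⟩

namespace HasFourierExpansion

variable {a a' : Disc Q M → ℝ → ℂ} (hf : HasFourierExpansion Q ε M κ f a a')

include hf

lemma hasSum_coeffAt (τ : ℍ) (γ : Disc Q M) :
    HasSum (fun n : ℝ => coeffAt κ a a' τ.im γ n * e (n * τ)) (f τ γ) := by
  rw [hf.eq_add]
  refine ((hf.summable_plus τ γ).hasSum.add (hasSum_nonholPart (hf.summable_minus τ γ))).congr_fun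
    fun n => ?_
  rw [coeffAt, plusTerm]
  ring

lemma exponent_coeffAt {v : ℝ} {γ : Disc Q M} {n : ℝ} (h : coeffAt κ a a' v γ n ≠ 0) :
    ∃ m : ℤ, n = (ε : ℤ) * Q (rep γ) + m := by
  by_cases h0 : a γ n = 0
  · by_cases h1 : a' γ n = 0
    · simp [coeffAt, h0, h1] at h
    · exact hf.exponent_minus γ n h1
  · exact hf.exponent_plus γ n h0

end HasFourierExpansion

lemma ofComplex_add_one {z : ℂ} (hz : 0 < z.im) :
    ofComplex (z + 1) = ModularGroup.T • ofComplex z := by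
  have hz1 : 0 < (z + 1).im := by simpa using hz
  apply UpperHalfPlane.ext
  rw [modular_T_smul, coe_vadd, ofComplex_apply_of_im_pos hz, ofComplex_apply_of_im_pos hz1]
  simp [add_comm]

/-- The definition of `ξ`, solved for `∂/∂τ̄`. -/
lemma dbar_comp_ofComplex {ι : Type*} (f : ℍ → ι → ℂ) (κ : ℤ) (γ : ι) (z : ℂ) (hz : 0 < z.im) :
    dbar ((fun τ => f τ γ) ∘ ofComplex) z = Complex.I / 2 * (z.im ^ (-((κ : ℝ) / 2)) : ℝ) *
      conj (((fun τ => xi κ f τ γ) ∘ ofComplex) z) := by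
  set F : ℂ → ℂ := (fun τ => f τ γ) ∘ ofComplex
  have h1 : ((fun τ => xi κ f τ γ) ∘ ofComplex) z =
      2 * Complex.I * ((z.im ^ ((κ : ℝ) / 2) : ℝ) : ℂ) * conj (dbar F z) := by
    simp only [Function.comp_apply, ofComplex_apply_of_im_pos hz]
    rfl
  have h2 : ((z.im ^ (-((κ : ℝ) / 2)) : ℝ) : ℂ) * ((z.im ^ ((κ : ℝ) / 2) : ℝ) : ℂ) = 1 := by
    rw [← Complex.ofReal_mul, ← Real.rpow_add hz, neg_add_cancel, Real.rpow_zero,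
      Complex.ofReal_one]
  rw [h1]
  simp only [map_mul, Complex.conj_ofReal, Complex.conj_conj, Complex.conj_I, Complex.conj_ofNat]
  linear_combination (-dbar F z) * h2 + dbar F z * ((z.im ^ (-((κ : ℝ) / 2)) : ℝ) : ℂ) *
    ((z.im ^ ((κ : ℝ) / 2) : ℝ) : ℂ) * Complex.I_sq

/-- Harmonic Maass forms whose image under `ξ` is holomorphic have Fourier expansions. -/
theorem IsHarmonicMaass.exists_hasFourierExpansion [Finite (Disc Q M)] (hκ : κ ≠ 2)
    (hf : IsHarmonicMaass Q ε M κ f) (hξ : IsModularForm Q (-ε) M (4 - κ) (xi κ f)) :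
    ∃ a a', HasFourierExpansion Q ε M κ f a a' := by
  have key : ∀ γ : Disc Q M, ∃ a a' : ℤ → ℂ,
      (∃ n₀ : ℝ, ∀ m : ℤ, (ε : ℤ) * Q (rep γ) + m < n₀ → a m = 0) ∧
      (∀ m : ℤ, 0 < (ε : ℤ) * Q (rep γ) + m → a' m = 0) ∧
      ∀ τ : ℍ, HasSum (fun m : ℤ => (a m + a' m * nonholFactor κ ((ε : ℤ) * Q (rep γ) + m) τ.im) *
        e (((ε : ℤ) * Q (rep γ) + m : ℝ) * τ)) (f τ γ) := by
    intro γ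
    set x : ℝ := (ε : ℤ) * Q (rep γ) with hx
    set F : ℂ → ℂ := (fun τ => f τ γ) ∘ ofComplex with hFdef
    set G : ℂ → ℂ := (fun τ => xi κ f τ γ) ∘ ofComplex with hGdef
    have hF : ContDiffOn ℝ 2 F {z : ℂ | 0 < z.im} :=
      by exact_mod_cast contDiffOn_infty.1 (hf.smooth γ) 2
    have hFper : ∀ z : ℂ, 0 < z.im → F (z + 1) = e x * F z := fun z hz => by
      simp only [hFdef, Function.comp_apply, ofComplex_add_one hz]
      rw [hf.transforms.apply_T, hx]
      push_cast
      rfl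
    have hGper : ∀ z : ℂ, 0 < z.im → G (z + 1) = e (-x) * G z := fun z hz => by
      simp only [hGdef, Function.comp_apply, ofComplex_add_one hz]
      rw [hξ.transforms.apply_T, hx]
      push_cast
      ring_nf
    have hFG := dbar_comp_ofComplex f κ γ
    have hGb : ∃ B A : ℝ, ∀ z : ℂ, 0 < z.im → A ≤ z.im → ‖G z‖ ≤ B := by
      obtain ⟨B, A, h⟩ := isBoundedAtImInfty_iff.1 (hξ.bdd γ)
      refine ⟨B, A, fun z hz hA => ?_⟩
      simp only [hGdef, Function.comp_apply, ofComplex_apply_of_im_pos hz]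
      exact h ⟨z, hz⟩ hA
    have hFb : ∃ B C A : ℝ, ∀ z : ℂ, 0 < z.im → A ≤ z.im → ‖F z‖ ≤ B * Real.exp (C * z.im) := by
      obtain ⟨C, hC⟩ := hf.growth
      obtain ⟨B, hB⟩ := (hC γ).bound
      obtain ⟨A, hA⟩ := (atImInfty_mem _).1 hB
      refine ⟨B, C, A, fun z hz hAz => ?_⟩
      have := hA ⟨z, hz⟩ hAz
      simp only [hFdef, Function.comp_apply, ofComplex_apply_of_im_pos hz]
      rw [Set.mem_ofPred_eq, Real.norm_eq_abs, abs_of_pos (Real.exp_pos _)] at this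
      exact this
    obtain ⟨a, a', h1, h2, h3⟩ := exists_fourierInt_eq_add hκ (hF.of_le (by norm_num)) hFper
      (mdifferentiable_iff.1 (hξ.holo γ)) hGper hFG hGb hFb
    refine ⟨a, a', h1, h2, fun τ => ?_⟩
    have h4 := hasSum_fourierInt hF hFper τ.im_pos τ.re
    have h5 : F (τ.re + τ.im * Complex.I) = f τ γ := by
      have : ((τ.re : ℂ) + τ.im * Complex.I) = τ := Complex.re_add_im (τ : ℂ)
      rw [this]
      simp [hFdef]
    rw [h5] at h4
    refine h4.congr_fun fun m => ?_
    rw [h3 m _ τ.im_pos, mul_assoc, mul_assoc]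
    congr 2
    rw [e, e, Complex.ofReal_exp, ← Complex.exp_add]
    congr 1
    rw [← Complex.re_add_im (τ : ℂ)]
    push_cast
    simp only [coe_re, coe_im]
    linear_combination 2 * Real.pi * (x + m) * τ.im * Complex.I_sq
  choose a a' ha ha' hsum using key
  choose n₀ hn₀ using ha
  set ι : Disc Q M → ℤ → ℝ := fun γ m => (ε : ℤ) * Q (rep γ) + m with hι
  have hinj : ∀ γ, Function.Injective (ι γ) := fun γ m m' h => by simpa [hι] using h
  set b : Disc Q M → ℝ → ℂ := fun γ => Function.extend (ι γ) (a γ) 0 with hb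
  set b' : Disc Q M → ℝ → ℂ := fun γ => Function.extend (ι γ) (a' γ) 0 with hb'
  have hbe : ∀ γ m, b γ (ι γ m) = a γ m := fun γ m => (hinj γ).extend_apply _ _ _
  have hbe' : ∀ γ m, b' γ (ι γ m) = a' γ m := fun γ m => (hinj γ).extend_apply _ _ _
  have hexp : ∀ (c : ℤ → ℂ) γ n, Function.extend (ι γ) c 0 n ≠ 0 →
      ∃ m : ℤ, n = (ε : ℤ) * Q (rep γ) + m := by
    intro c γ n h
    by_contra h0
    exact h (Function.extend_apply' _ _ _ fun ⟨m, hm⟩ => h0 ⟨m, hm.symm⟩)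
  -- the holomorphic part converges: only finitely many of its exponents are not positive
  have hsp : ∀ (τ : ℍ) γ, Summable fun m : ℤ => a γ m * e ((ι γ m : ℝ) * τ) := by
    intro τ γ
    have h1 : Summable ({m : ℤ | 0 < ι γ m}.indicator fun m =>
        (a γ m + a' γ m * nonholFactor κ (ι γ m) τ.im) * e ((ι γ m : ℝ) * τ)) :=
      (hsum γ τ).summable.indicator _
    have h2 : Summable ({m : ℤ | 0 < ι γ m}ᶜ.indicator fun m => a γ m * e ((ι γ m : ℝ) * τ)) := by
      refine summable_of_hasFiniteSupport ((Set.finite_Icc ⌊n₀ γ - (ε : ℤ) * Q (rep γ)⌋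
        ⌈-((ε : ℤ) * Q (rep γ))⌉).subset fun m hm => ?_)
      obtain ⟨hm1, hm2⟩ := Set.indicator_apply_ne_zero.1 (Function.mem_support.1 hm)
      have h3 : n₀ γ ≤ ι γ m := not_lt.1 fun h => hm2 (by simp [hn₀ γ m h])
      have h4 : ι γ m ≤ 0 := not_lt.1 hm1
      simp only [hι] at h3 h4
      constructor
      · exact Int.cast_le.1 ((Int.floor_le _).trans (by linarith : _ ≤ (m : ℝ)))
      · exact Int.cast_le.1 ((by linarith : (m : ℝ) ≤ -((ε : ℤ) * Q (rep γ))).trans (Int.le_ceil _))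
    refine (h1.add h2).congr fun m => ?_
    by_cases hm : 0 < ι γ m
    · have : a' γ m = 0 := ha' γ m hm
      simp [hm, this]
    · simp [hm]
  have hsm : ∀ (τ : ℍ) γ, HasSum (fun m : ℤ => a' γ m * nonholFactor κ (ι γ m) τ.im *
      e ((ι γ m : ℝ) * τ)) (f τ γ - ∑' m : ℤ, a γ m * e ((ι γ m : ℝ) * τ)) := by
    intro τ γ
    refine ((hsum γ τ).sub (hsp τ γ).hasSum).congr_fun fun m => ?_
    simp only [hι]
    ring
  have hp : ∀ τ γ, HasSum (plusTerm b τ γ) (∑' m : ℤ, a γ m * e ((ι γ m : ℝ) * τ)) := by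
    intro τ γ
    refine (hasSum_coset_iff (x := (ε : ℤ) * Q (rep γ)) (g := plusTerm b τ γ) ⟨0, by simp⟩
      fun n hn => hexp _ γ n (left_ne_zero_of_mul hn)).1 ?_
    exact (hsp τ γ).hasSum.congr_fun fun m => by
      rw [plusTerm, ← hbe]
  have hm : ∀ (τ : ℍ) γ, HasSum (fun n : ℝ => b' γ n * nonholFactor κ n τ.im * e (n * τ))
      (f τ γ - ∑' m : ℤ, a γ m * e ((ι γ m : ℝ) * τ)) := by
    intro τ γ
    refine (hasSum_coset_iff (x := (ε : ℤ) * Q (rep γ))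
      (g := fun n : ℝ => b' γ n * nonholFactor κ n τ.im * e (n * τ)) ⟨0, by simp⟩
      fun n hn => hexp _ γ n (left_ne_zero_of_mul (left_ne_zero_of_mul hn))).1 ?_
    exact (hsm τ γ).congr_fun fun m => by rw [← hbe']
  have hsm' : ∀ τ γ, Summable fun n : Set.Iio (0 : ℝ) => minusTerm κ b' τ γ n := fun τ γ =>
    ((hm τ γ).summable.subtype (Set.Iio 0)).congr fun n => (minusTerm_eq n).symm
  refine ⟨b, b', fun γ => hexp _ γ, fun γ => hexp _ γ, ?_, fun τ γ => (hp τ γ).summable, hsm',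
    fun τ γ => ?_⟩
  · obtain ⟨N, hN⟩ := (Set.finite_range n₀).bddBelow
    refine ⟨N, fun γ n hn => ?_⟩
    by_contra h0
    obtain ⟨m, rfl⟩ := hexp _ γ n h0
    exact h0 ((hbe γ m).trans (hn₀ γ m (hn.trans_le (hN ⟨γ, rfl⟩))))
  · rw [holPart, (hp τ γ).tsum_eq, (hasSum_nonholPart (hsm' τ γ)).unique (hm τ γ)]
    ring

end Expansion

section TermwiseIntegration

lemma integral_e_int (j : ℤ) (x : ℝ) :
    ∫ u in x..(x + 1), e (j * u) = if j = 0 then 1 else 0 := by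
  split_ifs with h
  · subst h
    have : ∀ u : ℝ, e (((0 : ℤ) : ℂ) * u) = 1 := fun u => by simp [e]
    simp only [this]
    simp
  · have h0 : 2 * Real.pi * Complex.I * (j : ℂ) ≠ 0 := by
      have : (j : ℂ) ≠ 0 := by exact_mod_cast h
      simp [Real.pi_ne_zero, this]
    have h1 := integral_exp_mul_complex (a := x) (b := x + 1) h0
    have h2 : ∀ u : ℝ, e (j * u) = Complex.exp (2 * Real.pi * Complex.I * j * u) := fun u => by
      rw [e]
      congr 1
      ring
    simp only [h2]
    rw [h1, ← h2, ← h2, Complex.ofReal_add, Complex.ofReal_one, mul_add, mul_one, e_add_int,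
      sub_self, zero_div]

/-- Termwise integration over a period picks the constant term. -/
lemma hasSum_integral_period {ι : Type*} [Countable ι] {c : ι → ℂ} {j : ι → ℤ} {φ : ℝ → ℂ}
    (h : ∀ u : ℝ, HasSum (fun s => c s * e (j s * u)) (φ u)) (x : ℝ) :
    HasSum (fun s => if j s = 0 then c s else 0) (∫ u in x..(x + 1), φ u) := by
  have hn : ∀ (s : ι) (u : ℝ), ‖c s * e (j s * u)‖ = ‖c s‖ := fun s u => by
    rw [norm_mul, show ((j s : ℂ) * u) = ((j s * u : ℝ) : ℂ) by push_cast; rfl, norm_e_real,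
      mul_one]
  have hs : Summable fun s => ‖c s‖ := by simpa only [hn] using (h 0).summable.norm
  have h1 := intervalIntegral.hasSum_integral_of_dominated_convergence (μ := volume) (a := x)
    (b := x + 1) (F := fun s u => c s * e (j s * u)) (f := φ) (fun s _ => ‖c s‖)
    (fun s => (continuous_const.mul (continuous_e.comp (by fun_prop))).aestronglyMeasurable)
    (fun s => ae_of_all _ fun u _ => (hn s u).le) (ae_of_all _ fun _ _ => hs) (by simp)
    (ae_of_all _ fun u _ => h u)
  refine h1.congr_fun fun s => ?_
  rw [intervalIntegral.integral_const_mul, integral_e_int]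
  split_ifs <;> simp

end TermwiseIntegration

section CuspCoefficient

variable {V : Type*} [AddCommGroup V] [Module ℝ V] {Q : QuadraticForm ℝ V} {M : AddSubgroup V}
  {ε : ℤˣ} {κ : ℤ} {f : ℍ → Disc Q M → ℂ} {a a' : Disc Q M → ℝ → ℂ}

/-- If `ξ f` is a cusp form, then the constant terms of `f` carry no power of `v`: otherwise `ξ f`
would have a nonzero constant term. -/
theorem HasFourierExpansion.coeff_zero_eq_zero (hE : HasFourierExpansion Q ε M κ f a a')
    (hκ : κ ≠ 2) (hf : IsHarmonicMaass Q ε M κ f) (hξ : IsCuspForm Q (-ε) M (4 - κ) (xi κ f))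
    (γ : Disc Q M) : a' γ 0 = 0 := by
  by_contra hne
  obtain ⟨k, hk⟩ := hE.exponent_minus γ 0 hne
  have hκ' : (1 : ℝ) - κ / 2 ≠ 0 := fun h => hκ (by
    have : (κ : ℝ) = 2 := by linarith
    exact_mod_cast this)
  set F : ℂ → ℂ := (fun τ => f τ γ) ∘ ofComplex with hFdef
  set G : ℂ → ℂ := (fun τ => xi κ f τ γ) ∘ ofComplex with hGdef
  have hF : ContDiffOn ℝ 1 F {z : ℂ | 0 < z.im} := by
    exact_mod_cast contDiffOn_infty.1 (hf.smooth γ) 1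
  have hFper : ∀ z : ℂ, 0 < z.im → F (z + 1) = e ((0 : ℝ) : ℂ) * F z := fun z hz => by
    simp only [hFdef, Function.comp_apply, ofComplex_add_one hz]
    rw [hf.transforms.apply_T, hk]
    push_cast
    rw [e_add_int]
  -- the constant coefficient and its derivative
  have hc : ∀ v : ℝ, 0 < v → fourierInt F 0 v = a γ 0 + a' γ 0 * nonholFactor κ 0 v := by
    intro v hv
    set τ₀ : ℝ → ℍ := fun u => ⟨u + v * Complex.I, by simpa using hv⟩ with hτ₀
    have h1 : ∀ u : ℝ, HasSum (fun m : ℤ => coeffAt κ a a' v γ m * e (m * (v * Complex.I)) *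
        e (m * u)) (F (u + v * Complex.I) * e (-((0 : ℝ) * u))) := by
      intro u
      have h2 := hE.hasSum_coeffAt (τ₀ u) γ
      have h3 := (hasSum_coset_iff (x := 0) ⟨k, hk⟩ fun n hn =>
        hE.exponent_coeffAt (left_ne_zero_of_mul hn)).2 h2
      have h4 : F (u + v * Complex.I) * e (-((0 : ℝ) * u)) = f (τ₀ u) γ := by
        simp only [hFdef, Function.comp_apply]
        rw [ofComplex_apply_of_im_pos (by simpa using hv)]
        simp [e, hτ₀]
      rw [h4]
      refine h3.congr_fun fun m => ?_
      have h5 : (τ₀ u).im = v := by simp [hτ₀, UpperHalfPlane.im]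
      have h6 : (τ₀ u : ℂ) = v * Complex.I + u := by simp [hτ₀, add_comm]
      rw [h5, h6, zero_add, mul_assoc, ← e_add]
      push_cast
      rw [mul_add]
    have h2 := hasSum_integral_period h1 0
    rw [zero_add] at h2
    have h3 := h2.unique (hasSum_single 0 fun m hm => if_neg hm)
    rw [fourierInt]
    exact_mod_cast h3.trans (by simp [coeffAt, e])
  have hd : ∀ v : ℝ, 0 < v → a' γ 0 * (1 - κ / 2) = conj (fourierInt G 0 v) := by
    intro v hv
    have h1 := hasDerivAt_fourierInt hF hFper hv
    rw [fourierInt_dbar (dbar_comp_ofComplex f κ γ) 0 hv] at h1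
    have h2 : HasDerivAt (fun v : ℝ => v ^ (1 - (κ : ℝ) / 2)) _ v :=
      Real.hasDerivAt_rpow_const (Or.inl hv.ne')
    have h3 : HasDerivAt (fourierInt F 0) _ v :=
      ((h2.ofReal_comp.const_mul (a' γ 0)).const_add (a γ 0)).congr_of_eventuallyEq (by
        filter_upwards [Ioi_mem_nhds hv] with x hx
        rw [hc x hx]
        simp [nonholFactor])
    have h4 := h1.unique h3
    rw [show 1 - (κ : ℝ) / 2 - 1 = -((κ : ℝ) / 2) by ring] at h4
    have h5 : ((v ^ (-((κ : ℝ) / 2)) : ℝ) : ℂ) ≠ 0 := by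
      exact_mod_cast (Real.rpow_pos_of_pos hv _).ne'
    refine mul_right_cancel₀ h5 ?_
    simp only [neg_zero] at h4
    push_cast at h4
    linear_combination -h4 -
      ((v ^ (-((κ : ℝ) / 2)) : ℝ) : ℂ) * conj (fourierInt G 0 v) * Complex.I_sq
  -- `ξ f` vanishes at infinity
  have h0 : a' γ 0 * (1 - κ / 2) = 0 := by
    refine norm_le_zero_iff.1 (le_of_forall_pos_le_add fun δ hδ => ?_)
    obtain ⟨A, hA⟩ := isZeroAtImInfty_iff.1 (hξ.zero γ) δ hδ
    have hv : 0 < max A 1 := lt_max_of_lt_right one_pos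
    rw [hd _ hv, RCLike.norm_conj, zero_add]
    refine norm_fourierInt_le fun u => ?_
    simp only [hGdef, Function.comp_apply]
    rw [ofComplex_apply_of_im_pos (by simp)]
    exact hA _ (by simp [UpperHalfPlane.im])
  refine (mul_ne_zero hne ?_) h0
  exact_mod_cast hκ'

end CuspCoefficient

/-! ### The constant term -/

section Terms

variable {V : Type*} [AddCommGroup V] [Module ℝ V] {Q : QuadraticForm ℝ V} (L : AddSubgroup V)
  (w : Grassmannian Q)

/-- Triples `(p, m, x)` indexing the products of coefficients in the constant term. -/
abbrev TermIndex : Type _ :=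
  Σ p : Disc Q (posPart L w) × Disc Q (negPart L w), ℤ × Coset p.2

variable {L w}

/-- The number `m - Q(α + β)`, the negative of the exponent at which the first factor is taken. -/
def TermIndex.expo (t : TermIndex L w) : ℝ := t.2.1 - Q (rep t.1.1 + rep t.1.2)

/-- The contribution to the coefficient of `q ^ j` in the product of three expansions with
coefficients `A`, `B` and those of the theta function of `N⁻`, from the exponents
`-(m - Q(α + β))`, `m - Q(α + β) + Q(x) + j` and `-Q(x)`. -/
def liftTerm (A : Disc Q L → ℝ → ℂ) (B : Disc Q (posPart L w) → ℝ → ℂ) (t : TermIndex L w)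
    (j : ℤ) : ℂ :=
  res L (sumPart L w) (fun γ => A γ (-t.expo)) (glue L w t.1) *
    B t.1.1 (t.expo + Q (t.2.2.1 : V) + j)

/-- Each coordinate of `x_K` is a fixed coordinate of `x` or zero. -/
lemma res_cases (L K : AddSubgroup V) (δ : Disc Q K) :
    (∃ γ : Disc Q L, ∀ x, res L K x δ = x γ) ∨ ∀ x : Disc Q L → ℂ, res L K x δ = 0 := by
  by_cases h : rep δ ∈ dualLattice Q L
  · exact Or.inl ⟨_, fun x => dif_pos h⟩
  · exact Or.inr fun x => dif_neg h

lemma norm_liftTerm_le {A A' : Disc Q L → ℝ → ℂ} {B B' : Disc Q (posPart L w) → ℝ → ℂ}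
    (hA : ∀ γ n, ‖A γ n‖ ≤ ‖A' γ n‖) (hB : ∀ α n, ‖B α n‖ ≤ ‖B' α n‖) (t : TermIndex L w) (j : ℤ) :
    ‖liftTerm A B t j‖ ≤ ‖liftTerm A' B' t j‖ := by
  rw [liftTerm, liftTerm, norm_mul, norm_mul]
  refine mul_le_mul ?_ (hB _ _) (norm_nonneg _) (norm_nonneg _)
  rcases res_cases L (sumPart L w) (glue L w t.1) with ⟨γ, h⟩ | h
  · rw [h, h]
    exact hA _ _
  · rw [h, h]

lemma tendsto_liftTerm {A : ℝ → Disc Q L → ℝ → ℂ} {A' : Disc Q L → ℝ → ℂ}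
    {B : ℝ → Disc Q (posPart L w) → ℝ → ℂ} {B' : Disc Q (posPart L w) → ℝ → ℂ} {l : Filter ℝ}
    (hA : ∀ γ n, Tendsto (fun T => A T γ n) l (𝓝 (A' γ n)))
    (hB : ∀ α n, Tendsto (fun T => B T α n) l (𝓝 (B' α n))) (t : TermIndex L w) (j : ℤ) :
    Tendsto (fun T => liftTerm (A T) (B T) t j) l (𝓝 (liftTerm A' B' t j)) := by
  refine Tendsto.mul ?_ (hB _ _)
  rcases res_cases L (sumPart L w) (glue L w t.1) with ⟨γ, h⟩ | h
  · simp only [h]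
    exact hA _ _
  · simp only [h]
    exact tendsto_const_nhds

end Terms

lemma hasSum_sigma_fintype {ι : Type*} [Fintype ι] {β : ι → Type*} {f : (Σ i, β i) → ℂ}
    {g : ι → ℂ} (h : ∀ i, HasSum (fun b => f ⟨i, b⟩) (g i)) : HasSum f (∑ i, g i) := by
  have hs : Summable f := by
    rw [← summable_norm_iff, summable_sigma_of_nonneg fun _ => norm_nonneg _]
    exact ⟨fun i => (h i).summable.norm, (hasSum_fintype _).summable⟩
  exact (hasSum_fintype g).sigma_of_hasSum h hs

lemma hasSum_mul_of_hasSum {ι₁ ι₂ : Type*} {f : ι₁ → ℂ} {g : ι₂ → ℂ} {a b : ℂ}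
    (hf : HasSum f a) (hg : HasSum g b) :
    HasSum (fun s : ι₁ × ι₂ => f s.1 * g s.2) (a * b) := by
  have hs : Summable fun s : ι₁ × ι₂ => f s.1 * g s.2 :=
    (hf.summable.norm.mul_norm hg.summable.norm).of_norm
  exact hf.mul hg hs

namespace IsSpecialSetting

variable {V : Type*} [AddCommGroup V] [Module ℝ V] [FiniteDimensional ℝ V]
  {Q : QuadraticForm ℝ V} {L : AddSubgroup V} {n : ℕ} {w : Grassmannian Q}
  (H : IsSpecialSetting Q L n w)
include H

lemma countable_coset (β : Disc Q (negPart L w)) : Countable (Coset β) := by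
  have h1 := (H.summable_negPart one_pos).countable_support
  have h2 : Function.support (fun x : dualLattice Q (negPart L w) => Real.exp (1 * Q (x : V))) =
      Set.univ := Set.eq_univ_of_forall fun x => (Real.exp_pos _).ne'
  rw [h2, Set.countable_univ_iff] at h1
  infer_instance

lemma hasSum_thetaN (τ : ℍ) (β : Disc Q (negPart L w)) :
    HasSum (fun x : Coset β => e (-(Q (x.1 : V) : ℂ) * τ))
      (thetaSeries Q (-1) (negPart L w) τ β) := by
  rw [thetaSeries_neg]
  exact ((H.summable_thetaN τ.im_pos).subtype {x | (x : Disc Q (negPart L w)) = β}).hasSum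

/-- The product of three Fourier expansions, ordered by the exponents of the product, for a fixed
pair of classes. -/
lemma hasSum_liftTerm_aux {A : Disc Q L → ℝ → ℂ} {B : Disc Q (posPart L w) → ℝ → ℂ}
    {FA : Disc Q L → ℂ} {FB : Disc Q (posPart L w) → ℂ} {τ : ℍ}
    (hA0 : ∀ γ n, A γ n ≠ 0 → ∃ m : ℤ, n = Q (rep γ) + m)
    (hB0 : ∀ α n, B α n ≠ 0 → ∃ m : ℤ, n = -Q (rep α) + m)
    (hA : ∀ γ, HasSum (fun n : ℝ => A γ n * e (n * τ)) (FA γ))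
    (hB : ∀ α, HasSum (fun n : ℝ => B α n * e (n * τ)) (FB α))
    (p : Disc Q (posPart L w) × Disc Q (negPart L w)) :
    HasSum (fun s : (ℤ × Coset p.2) × ℤ => liftTerm A B ⟨p, s.1⟩ s.2 * e (s.2 * τ))
      (res L (sumPart L w) FA (glue L w p) *
        (FB p.1 * thetaSeries Q (-1) (negPart L w) τ p.2)) := by
  by_cases hp : rep p.1 + rep p.2 ∈ dualLattice Q L
  swap
  · have h0 : ∀ x : Disc Q L → ℂ, res L (sumPart L w) x (glue L w p) = 0 := fun x => by
      rw [H.res_glue_rep, dif_neg hp]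
    simp only [liftTerm, h0, zero_mul]
    exact hasSum_zero
  set γ : Disc Q L := ((⟨rep p.1 + rep p.2, hp⟩ : dualLattice Q L) : Disc Q L) with hγ
  have h0 : ∀ x : Disc Q L → ℂ, res L (sumPart L w) x (glue L w p) = x γ := fun x => by
    rw [H.res_glue_rep, dif_pos hp]
  have hQp : Q (rep p.1 + rep p.2) = Q (rep p.1) + Q (rep p.2) :=
    map_add_of_mem w (mem_space_of_dual (rep_mem _)) (mem_perp_of_dual (rep_mem _))
  have hq : ∀ x : Coset p.2, ∃ m : ℤ, Q (x.1 : V) = Q (rep p.2) + m := fun x =>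
    map_sub_map_int H.even_negPart (rep_mem _) (mk_eq_iff.1 x.2)
  choose q hq using hq
  have hA1 := (hasSum_coset_iff (g := fun n : ℝ => A γ n * e (n * τ)) (x := Q (rep p.1 + rep p.2))
    (y := Q (rep γ))
    (map_sub_map_int H.lattice.even (rep_mem γ) (mk_eq_iff.1 hγ.symm))
    fun n hn => hA0 γ n (left_ne_zero_of_mul hn)).2 (hA γ)
  rw [← (Equiv.neg ℤ).hasSum_iff] at hA1
  have hB1 := (hasSum_coset_iff (g := fun n : ℝ => B p.1 n * e (n * τ)) (x := -Q (rep p.1))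
    (y := -Q (rep p.1)) ⟨0, by simp⟩
    fun n hn => hB0 p.1 n (left_ne_zero_of_mul hn)).2 (hB p.1)
  have hall := hasSum_mul_of_hasSum (hasSum_mul_of_hasSum hA1 (H.hasSum_thetaN τ p.2)) hB1
  rw [← (Equiv.prodShear (Equiv.refl (ℤ × Coset p.2))
    (fun t => Equiv.addLeft (t.1 + q t.2))).hasSum_iff] at hall
  rw [h0, show FA γ * (FB p.1 * thetaSeries Q (-1) (negPart L w) τ p.2) =
    FA γ * thetaSeries Q (-1) (negPart L w) τ p.2 * FB p.1 by ring]
  refine hall.congr_fun fun s => ?_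
  obtain ⟨⟨m, x⟩, j⟩ := s
  simp only [Function.comp_apply, Equiv.prodShear_apply, Equiv.refl_apply, Equiv.coe_addLeft,
    Equiv.neg_apply, liftTerm, h0, TermIndex.expo]
  have e1 : -((m : ℝ) - Q (rep p.1 + rep p.2)) = Q (rep p.1 + rep p.2) + ((-m : ℤ) : ℝ) := by
    push_cast
    ring
  have e2 : (m : ℝ) - Q (rep p.1 + rep p.2) + Q (x.1 : V) + j =
      -Q (rep p.1) + ((m + q x + j : ℤ) : ℝ) := by
    rw [hq x, hQp]
    push_cast
    ring
  have e3 : (j : ℂ) * τ = ((Q (rep p.1 + rep p.2) + ((-m : ℤ) : ℝ) : ℝ) : ℂ) * τ +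
      -(Q (x.1 : V) : ℂ) * τ + ((-Q (rep p.1) + ((m + q x + j : ℤ) : ℝ) : ℝ) : ℂ) * τ := by
    rw [hq x, hQp]
    push_cast
    ring
  rw [e1, e2, e3, e_add, e_add]
  ring

/-- The product of three Fourier expansions, ordered by the exponents of the product. -/
theorem hasSum_liftTerm [Fintype (Disc Q (posPart L w))] [Fintype (Disc Q (negPart L w))]
    {A : Disc Q L → ℝ → ℂ} {B : Disc Q (posPart L w) → ℝ → ℂ} {FA : Disc Q L → ℂ}
    {FB : Disc Q (posPart L w) → ℂ} {τ : ℍ}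
    (hA0 : ∀ γ n, A γ n ≠ 0 → ∃ m : ℤ, n = Q (rep γ) + m)
    (hB0 : ∀ α n, B α n ≠ 0 → ∃ m : ℤ, n = -Q (rep α) + m)
    (hA : ∀ γ, HasSum (fun n : ℝ => A γ n * e (n * τ)) (FA γ))
    (hB : ∀ α, HasSum (fun n : ℝ => B α n * e (n * τ)) (FB α)) :
    HasSum (fun s : TermIndex L w × ℤ => liftTerm A B s.1 s.2 * e (s.2 * τ))
      (contract L w FA FB (thetaSeries Q (-1) (negPart L w) τ)) := by
  have h1 := hasSum_sigma_fintype
    (f := fun s : Σ p : Disc Q (posPart L w) × Disc Q (negPart L w), (ℤ × Coset p.2) × ℤ =>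
      liftTerm A B ⟨s.1, s.2.1⟩ s.2.2 * e (s.2.2 * τ))
    (fun p => H.hasSum_liftTerm_aux hA0 hB0 hA hB p)
  exact ((Equiv.sigmaProdDistrib (fun p : Disc Q (posPart L w) × Disc Q (negPart L w) =>
    ℤ × Coset p.2) ℤ).hasSum_iff (f := fun s : Σ p : Disc Q (posPart L w) × Disc Q (negPart L w),
      (ℤ × Coset p.2) × ℤ => liftTerm A B ⟨s.1, s.2.1⟩ s.2.2 * e (s.2.2 * τ))).2 h1

/-- The constant term of a product of three Fourier expansions at height `T`. -/
lemma hasSum_integral_contract [Fintype (Disc Q (posPart L w))] [Fintype (Disc Q (negPart L w))]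
    {A : Disc Q L → ℝ → ℂ} {B : Disc Q (posPart L w) → ℝ → ℂ} {FA : ℍ → Disc Q L → ℂ}
    {FB : ℍ → Disc Q (posPart L w) → ℂ} {T : ℝ} (hT : 0 < T)
    (hA0 : ∀ γ n, A γ n ≠ 0 → ∃ m : ℤ, n = Q (rep γ) + m)
    (hB0 : ∀ α n, B α n ≠ 0 → ∃ m : ℤ, n = -Q (rep α) + m)
    (hA : ∀ τ : ℍ, τ.im = T → ∀ γ, HasSum (fun n : ℝ => A γ n * e (n * τ)) (FA τ γ))
    (hB : ∀ τ : ℍ, τ.im = T → ∀ α, HasSum (fun n : ℝ => B α n * e (n * τ)) (FB τ α)) :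
    HasSum (fun s : TermIndex L w × ℤ => if s.2 = 0 then liftTerm A B s.1 s.2 else 0)
      (∫ u in (-1 / 2 : ℝ)..(1 / 2),
        (liftSum L w FA FB ∘ ofComplex) (u + T * Complex.I)) := by
  have hcount : ∀ β : Disc Q (negPart L w), Countable (Coset β) := H.countable_coset
  have h1 := hasSum_integral_period (c := fun s : TermIndex L w × ℤ =>
    liftTerm A B s.1 s.2 * e (s.2 * (T * Complex.I)))
    (j := Prod.snd) (φ := fun u => (liftSum L w FA FB ∘ ofComplex) (u + T * Complex.I))
    (fun u => by
      have hz : 0 < ((u : ℂ) + T * Complex.I).im := by simpa using hT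
      set τ : ℍ := ⟨u + T * Complex.I, hz⟩ with hτ
      have hτi : τ.im = T := by simp [hτ, UpperHalfPlane.im]
      rw [Function.comp_apply, ofComplex_apply_of_im_pos hz]
      refine (H.hasSum_liftTerm hA0 hB0 (hA τ hτi) (hB τ hτi)).congr_fun fun s => ?_
      rw [mul_assoc, ← e_add, ← mul_add, add_comm, hτ])
    (-1 / 2)
  rw [show (-1 / 2 : ℝ) + 1 = 1 / 2 by norm_num] at h1
  refine h1.congr_fun fun s => ?_
  split_ifs with hs
  · simp [hs, e]
  · rfl

end IsSpecialSetting

section CoefficientBounds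

variable {ι : Type*} {κ : ℤ} {a a' : ι → ℝ → ℂ}

variable (κ a a') in
/-- A bound for `coeffAt κ a a' v γ n` that is valid for all `v ≥ 1`. -/
def coeffBound (γ : ι) (n : ℝ) : ℂ := (‖a γ n‖ + ‖a' γ n‖ * nonholFactor κ n 1 : ℝ)

lemma norm_coeffAt_le (h : ∀ γ, a' γ 0 = 0 ∨ 2 < κ) {v : ℝ} (hv : 1 ≤ v) (γ : ι) (n : ℝ) :
    ‖coeffAt κ a a' v γ n‖ ≤ ‖coeffBound κ a a' γ n‖ := by
  have h0 : 0 ≤ nonholFactor κ n 1 := nonholFactor_nonneg κ n one_pos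
  have h1 : 0 ≤ nonholFactor κ n v := nonholFactor_nonneg κ n (one_pos.trans_le hv)
  rw [coeffBound, Complex.norm_real, Real.norm_eq_abs, abs_of_nonneg (by positivity), coeffAt]
  refine (norm_add_le _ _).trans (add_le_add le_rfl ?_)
  rw [norm_mul, Complex.norm_real, Real.norm_eq_abs, abs_of_nonneg h1]
  by_cases hn : n = 0 ∧ a' γ 0 = 0
  · simp [hn.1, hn.2]
  · refine mul_le_mul_of_nonneg_left (nonholFactor_le κ ?_ one_pos hv) (norm_nonneg _)
    have := h γ
    tauto

lemma tendsto_coeffAt (h : ∀ γ, a' γ 0 = 0 ∨ 2 < κ) (γ : ι) (n : ℝ) :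
    Tendsto (fun v => coeffAt κ a a' v γ n) atTop (𝓝 (a γ n)) := by
  by_cases hn : n = 0 ∧ a' γ 0 = 0
  · simp only [coeffAt, hn.1, hn.2, zero_mul, add_zero]
    exact tendsto_const_nhds
  · have h1 : n ≠ 0 ∨ 2 < κ := by
      have := h γ
      tauto
    have h2 := (Complex.continuous_ofReal.tendsto 0).comp (tendsto_nonholFactor κ h1)
    have h3 := (h2.const_mul (a' γ n)).const_add (a γ n)
    simpa [Function.comp_def, coeffAt] using h3

end CoefficientBounds

namespace HasFourierExpansion

variable {V : Type*} [AddCommGroup V] [Module ℝ V] {Q : QuadraticForm ℝ V} {M : AddSubgroup V}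
  {ε : ℤˣ} {κ : ℤ} {f : ℍ → Disc Q M → ℂ} {a a' : Disc Q M → ℝ → ℂ}
  (hf : HasFourierExpansion Q ε M κ f a a')
include hf

lemma summable_coeffBound (γ : Disc Q M) :
    Summable fun n : ℝ => coeffBound κ a a' γ n * e (n * (UpperHalfPlane.I : ℍ)) := by
  have h1 := (hf.summable_plus UpperHalfPlane.I γ).norm
  have h2 := (hasSum_nonholPart (hf.summable_minus UpperHalfPlane.I γ)).summable.norm
  have h3 : Summable fun n : ℝ => ‖coeffBound κ a a' γ n * e (n * (UpperHalfPlane.I : ℍ))‖ := by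
    refine (h1.add h2).congr fun n => ?_
    have h0 : 0 ≤ nonholFactor κ n 1 := nonholFactor_nonneg κ n one_pos
    rw [plusTerm, norm_mul, norm_mul, norm_mul, norm_mul, Complex.norm_real, coeffBound,
      Complex.norm_real, Real.norm_eq_abs, Real.norm_eq_abs, I_im, abs_of_nonneg h0,
      abs_of_nonneg (by positivity)]
    ring
  exact h3.of_norm

lemma exponent_coeffBound {γ : Disc Q M} {n : ℝ} (h : coeffBound κ a a' γ n ≠ 0) :
    ∃ m : ℤ, n = (ε : ℤ) * Q (rep γ) + m := by
  by_cases h0 : a γ n = 0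
  · by_cases h1 : a' γ n = 0
    · simp [coeffBound, h0, h1] at h
    · exact hf.exponent_minus γ n h1
  · exact hf.exponent_plus γ n h0

end HasFourierExpansion

namespace IsSpecialSetting

variable {V : Type*} [AddCommGroup V] [Module ℝ V] [FiniteDimensional ℝ V]
  {Q : QuadraticForm ℝ V} {L : AddSubgroup V} {n : ℕ} {w : Grassmannian Q}
  (H : IsSpecialSetting Q L n w)

include H in
/-- Only finitely many vectors of a coset have bounded length. -/
lemma finite_coset_le (β : Disc Q (negPart L w)) (c : ℝ) :
    {x : Coset β | c ≤ Q (x.1 : V)}.Finite := by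
  have h1 := (H.summable_negPart one_pos).tendsto_cofinite_zero.eventually
    (Iio_mem_nhds (Real.exp_pos c))
  refine Set.Finite.preimage (f := Subtype.val) Subtype.val_injective.injOn
    ((Filter.eventually_cofinite.1 h1).subset fun x (hx : c ≤ Q (x : V)) => ?_)
  simp only [Set.mem_ofPred_eq, not_lt, one_mul]
  exact Real.exp_le_exp.2 hx

section

variable [Fintype (Disc Q (posPart L w))] [Fintype (Disc Q (negPart L w))]
  {κ κ' : ℤ} {f : ℍ → Disc Q L → ℂ} {g : ℍ → Disc Q (posPart L w) → ℂ}
  {a a' : Disc Q L → ℝ → ℂ} {b b' : Disc Q (posPart L w) → ℝ → ℂ}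
  (hf : HasFourierExpansion Q 1 L κ f a a')
  (hg : HasFourierExpansion Q (-1) (posPart L w) κ' g b b')
include H hf hg

/-- The constant terms of the product at height `T` converge to the constant term of the product of
the holomorphic parts. -/
theorem tendsto_integral_liftSum (ha : ∀ γ, a' γ 0 = 0 ∨ 2 < κ) (hb : ∀ α, b' α 0 = 0 ∨ 2 < κ') :
    Tendsto (fun T : ℝ => ∫ u in (-1 / 2 : ℝ)..(1 / 2),
      (liftSum L w f g ∘ ofComplex) (u + T * Complex.I)) atTop
      (𝓝 (∑' t : TermIndex L w, liftTerm a b t 0)) := by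
  have hA0 : ∀ v γ n, coeffAt κ a a' v γ n ≠ 0 → ∃ m : ℤ, n = Q (rep γ) + m := fun v γ n h => by
    simpa using hf.exponent_coeffAt h
  have hB0 : ∀ v α n, coeffAt κ' b b' v α n ≠ 0 → ∃ m : ℤ, n = -Q (rep α) + m := fun v α n h => by
    simpa using hg.exponent_coeffAt h
  let G : ℝ → TermIndex L w × ℤ → ℂ := fun T s => if s.2 = 0 then
    liftTerm (coeffAt κ a a' T) (coeffAt κ' b b' T) s.1 s.2 else 0
  have hint : ∀ T : ℝ, 0 < T → HasSum (G T) (∫ u in (-1 / 2 : ℝ)..(1 / 2),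
      (liftSum L w f g ∘ ofComplex) (u + T * Complex.I)) := by
    intro T hT
    refine H.hasSum_integral_contract hT (hA0 T) (hB0 T) ?_ ?_
    · rintro τ rfl γ
      exact hf.hasSum_coeffAt τ γ
    · rintro τ rfl α
      exact hg.hasSum_coeffAt τ α
  have hlim : ∑' t : TermIndex L w, liftTerm a b t 0 =
      ∑' s : TermIndex L w × ℤ, if s.2 = 0 then liftTerm a b s.1 s.2 else 0 := by
    have hi : Function.Injective fun t : TermIndex L w => ((t, 0) : TermIndex L w × ℤ) :=
      fun t t' h => congrArg Prod.fst h
    rw [← hi.tsum_eq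
      (f := fun s : TermIndex L w × ℤ => if s.2 = 0 then liftTerm a b s.1 s.2 else 0)]
    · simp
    · rintro ⟨t, j⟩ hs
      have : j = 0 := by
        by_contra h
        exact hs (by simp [h])
      exact ⟨t, by rw [this]⟩
  rw [hlim]
  have hbound := (H.hasSum_liftTerm (τ := UpperHalfPlane.I)
    (A := coeffBound κ a a') (B := coeffBound κ' b b')
    (fun γ n h => by simpa using hf.exponent_coeffBound h)
    (fun α n h => by simpa using hg.exponent_coeffBound h)
    (fun γ => (hf.summable_coeffBound γ).hasSum)
    (fun α => (hg.summable_coeffBound α).hasSum)).summable.norm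
  have h1 : Tendsto (fun T => ∑' s, G T s) atTop
      (𝓝 (∑' s : TermIndex L w × ℤ, if s.2 = 0 then liftTerm a b s.1 s.2 else 0)) := by
    refine tendsto_tsum_of_dominated_convergence hbound (fun s => ?_) ?_
    · simp only [G]
      split_ifs
      · exact tendsto_liftTerm (tendsto_coeffAt ha) (tendsto_coeffAt hb) s.1 s.2
      · exact tendsto_const_nhds
    · filter_upwards [eventually_ge_atTop 1] with T hT s
      simp only [G]
      split_ifs with hs
      · rw [norm_mul, hs]
        simpa [e] using norm_liftTerm_le (norm_coeffAt_le ha hT) (norm_coeffAt_le hb hT) s.1 0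
      · simpa using mul_nonneg (norm_nonneg _) (norm_nonneg _)
  refine h1.congr' ?_
  filter_upwards [eventually_gt_atTop 0] with T hT
  exact (hint T hT).tsum_eq

/-- Principal parts are finite and `Q` is negative definite on `N'`, so only finitely many products
contribute to the constant term. -/
lemma finite_liftTerm : {t : TermIndex L w | liftTerm a b t 0 ≠ 0}.Finite := by
  obtain ⟨n₁, h₁⟩ := hf.bddBelow_plus
  obtain ⟨n₂, h₂⟩ := hg.bddBelow_plus
  have hfin : ∀ p : Disc Q (posPart L w) × Disc Q (negPart L w),
      (Set.Icc ⌊n₂ + Q (rep p.1 + rep p.2)⌋ ⌈-n₁ + Q (rep p.1 + rep p.2)⌉ ×ˢ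
        {x : Coset p.2 | n₁ + n₂ ≤ Q (x.1 : V)}).Finite := fun p =>
    (Set.finite_Icc _ _).prod (H.finite_coset_le _ _)
  refine (Set.finite_iUnion fun p => (hfin p).image (Sigma.mk p)).subset ?_
  rintro ⟨p, m, x⟩ ht
  refine Set.mem_iUnion.2 ⟨p, (m, x), ?_, rfl⟩
  have hne := Set.mem_ofPred_eq ▸ ht
  have hA : n₁ ≤ -TermIndex.expo (⟨p, m, x⟩ : TermIndex L w) := by
    by_contra! hlt
    refine hne ?_
    rw [liftTerm]
    rcases res_cases L (sumPart L w) (glue L w p) with ⟨γ, h⟩ | h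
    · rw [h, h₁ _ _ hlt, zero_mul]
    · rw [h, zero_mul]
  have hB : n₂ ≤ TermIndex.expo (⟨p, m, x⟩ : TermIndex L w) + Q (x.1 : V) := by
    by_contra! hlt
    refine hne ?_
    rw [liftTerm, h₂ _ _ (by simpa using hlt), mul_zero]
  have hQ : Q (x.1 : V) ≤ 0 := H.map_nonpos (mem_perp_of_dual x.1.2)
  simp only [TermIndex.expo] at hA hB
  refine ⟨⟨?_, ?_⟩, ?_⟩
  · exact Int.cast_le.1 ((Int.floor_le _).trans (by linarith : _ ≤ (m : ℝ)))
  · exact Int.cast_le.1 ((by linarith : (m : ℝ) ≤ _).trans (Int.le_ceil _))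
  · change n₁ + n₂ ≤ Q (x.1 : V)
    linarith

/-- The constant term in the sense of Fourier series: the three holomorphic expansions are
multiplied out, and the exponents of the product are bounded below. -/
theorem hasConstantTerm_holPart :
    HasConstantTerm (fun τ => contract L w (holPart a τ) (holPart b τ)
      (thetaSeries Q (-1) (negPart L w) τ)) (∑' t : TermIndex L w, liftTerm a b t 0) := by
  obtain ⟨n₁, h₁⟩ := hf.bddBelow_plus
  obtain ⟨n₂, h₂⟩ := hg.bddBelow_plus
  refine ⟨fun j => ∑' t : TermIndex L w, liftTerm a b t j, ⟨⌊n₁ + n₂⌋, fun j hj => ?_⟩,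
    fun τ => ?_, rfl⟩
  · refine (tsum_congr fun t => ?_).trans tsum_zero
    have hQ : Q (t.2.2.1 : V) ≤ 0 := H.map_nonpos (mem_perp_of_dual t.2.2.1.2)
    have hj' : (j : ℝ) < n₁ + n₂ := (Int.cast_lt.2 hj).trans_le (Int.floor_le _)
    rw [liftTerm]
    by_cases hA : -t.expo < n₁
    · rcases res_cases L (sumPart L w) (glue L w t.1) with ⟨γ, h⟩ | h
      · rw [h, h₁ _ _ hA, zero_mul]
      · rw [h, zero_mul]
    · rw [h₂ _ _ (by linarith), mul_zero]
  · have h1 := H.hasSum_liftTerm (τ := τ) (A := a) (B := b)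
      (fun γ n h => by simpa using hf.exponent_plus γ n h)
      (fun α n h => by simpa using hg.exponent_plus α n h)
      (fun γ => (hf.summable_plus τ γ).hasSum) (fun α => (hg.summable_plus τ α).hasSum)
    rw [← (Equiv.prodComm ℤ (TermIndex L w)).hasSum_iff] at h1
    refine (h1.prod_fiberwise fun j => (h1.summable.prod_factor j).hasSum).congr_fun fun j => ?_
    simp only [Function.comp_apply, Equiv.prodComm_apply, Prod.swap_prod_mk]
    rw [tsum_mul_right]

/-- The constant term as an iterated finite sum. -/
lemma tsum_liftTerm_eq_finsum : ∑' t : TermIndex L w, liftTerm a b t 0 =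
    ∑ᶠ (p : Disc Q (posPart L w) × Disc Q (negPart L w)) (m : ℤ),
      res L (sumPart L w) (fun γ => a γ (-(m - Q (rep p.1 + rep p.2)))) (glue L w p) *
        ∑ᶠ x : Coset p.2, b p.1 ((m - Q (rep p.1 + rep p.2)) + Q (x.1 : V)) := by
  have hfin := H.finite_liftTerm hf hg
  have hsum : Summable fun t : TermIndex L w => liftTerm a b t 0 :=
    summable_of_hasFiniteSupport hfin
  obtain ⟨n₂, h₂⟩ := hg.bddBelow_plus
  have hx : ∀ (p : Disc Q (posPart L w) × Disc Q (negPart L w)) (m : ℤ),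
      {x : Coset p.2 | b p.1 ((m - Q (rep p.1 + rep p.2)) + Q (x.1 : V)) ≠ 0}.Finite := by
    intro p m
    refine (H.finite_coset_le p.2 (n₂ - (m - Q (rep p.1 + rep p.2)))).subset fun x hx => ?_
    by_contra hlt
    exact hx (h₂ _ _ (by linarith [not_le.1 (show ¬_ ≤ Q (x.1 : V) from hlt)]))
  rw [hsum.tsum_sigma, tsum_fintype, finsum_eq_sum_of_fintype]
  refine Finset.sum_congr rfl fun p _ => ?_
  have hin : ∀ m : ℤ, ∑' x : Coset p.2, liftTerm a b ⟨p, m, x⟩ 0 =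
      res L (sumPart L w) (fun γ => a γ (-(m - Q (rep p.1 + rep p.2)))) (glue L w p) *
        ∑ᶠ x : Coset p.2, b p.1 ((m - Q (rep p.1 + rep p.2)) + Q (x.1 : V)) := by
    intro m
    simp only [liftTerm, TermIndex.expo, Int.cast_zero, add_zero]
    rw [tsum_mul_left, tsum_eq_finsum (hx p m)]
  rw [(hsum.sigma_factor p).tsum_prod]
  simp only [hin]
  refine tsum_eq_finsum ((hfin.image fun t => t.2.1).subset fun m hm => ?_)
  rw [Function.mem_support, ← hin] at hm
  obtain ⟨x, hx⟩ : ∃ x : Coset p.2, liftTerm a b ⟨p, m, x⟩ 0 ≠ 0 := by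
    by_contra! h
    exact hm ((tsum_congr h).trans tsum_zero)
  exact ⟨⟨p, m, x⟩, hx, rfl⟩

end

end IsSpecialSetting

/-! ### Existence of the regularized integral -/

section Regularized

lemma isCompact_truncFD (T : ℝ) : IsCompact (truncFD T) :=
  ModularGroup.isCompact_truncatedFundamentalDomain T

lemma integrableOn_truncFD {G : ℂ → ℂ} (hG : ContinuousOn G {z : ℂ | 0 < z.im}) (T : ℝ) :
    IntegrableOn (fun τ : ℍ => G τ) (truncFD T) :=
  (hG.comp_continuous UpperHalfPlane.continuous_coe
    fun τ => τ.im_pos).continuousOn.integrableOn_compact (isCompact_truncFD T)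

/-- The integrals over truncated fundamental domains converge if the constant terms of the integrand
grow more slowly than `v`. -/
theorem exists_tendsto_integral_truncFD {G : ℂ → ℂ} (hG : ContinuousOn G {z : ℂ | 0 < z.im})
    {B s : ℝ} (hs : s < 1) (hB : ∀ v : ℝ, 1 ≤ v →
      ‖∫ u in (-1 / 2 : ℝ)..(1 / 2), G (u + v * Complex.I)‖ ≤ B * v ^ s) :
    ∃ c, Tendsto (fun T => ∫ τ in truncFD T, G τ) atTop (𝓝 c) := by
  -- the integrand, extended continuously from `v ≥ 1 / 2` to the plane
  obtain ⟨k, hk, hkv⟩ : ∃ k : ℝ → ℝ → ℂ, Continuous k.uncurry ∧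
      ∀ u v : ℝ, 1 / 2 ≤ v → k u v = ((v : ℂ) ^ 2)⁻¹ * G (u + v * Complex.I) := by
    have hmax : ∀ v : ℝ, 0 < max v (1 / 2) := fun v => lt_max_of_lt_right (by norm_num)
    refine ⟨fun u v => (((max v (1 / 2) : ℝ) : ℂ) ^ 2)⁻¹ *
      G (u + (max v (1 / 2) : ℝ) * Complex.I), ?_, fun u v hv => by simp only [max_eq_left hv]⟩
    refine Continuous.mul (Continuous.inv₀ (by fun_prop) fun p => ?_)
      (hG.comp_continuous (by fun_prop) fun p => by simp)
    have : ((max p.2 (1 / 2) : ℝ) : ℂ) ≠ 0 := by exact_mod_cast (hmax p.2).ne'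
    exact pow_ne_zero 2 this
  have hk' : Continuous (Function.uncurry fun v u : ℝ => k u v) := hk.comp continuous_swap
  have hkc : ∀ u : ℝ, Continuous (k u) := fun u => hk.uncurry_left u
  have hF : ∀ T : ℝ, 1 ≤ T → ∫ τ in truncFD T, G τ =
      (∫ u in (-1 / 2 : ℝ)..(1 / 2), ∫ v in √(1 - u ^ 2)..1, k u v) +
        ∫ v in (1 : ℝ)..T, ∫ u in (-1 / 2 : ℝ)..(1 / 2), k u v := by
    intro T hT
    have hc1 : Continuous fun u : ℝ => ∫ v in √(1 - u ^ 2)..1, k u v := by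
      have := (intervalIntegral.continuous_parametric_intervalIntegral_of_continuous
        (μ := volume) (a₀ := 1) hk (s := fun u : ℝ => √(1 - u ^ 2)) (by fun_prop)).neg
      refine this.congr fun u => ?_
      rw [Pi.neg_apply, ← intervalIntegral.integral_symm]
    have hc2 : Continuous fun u : ℝ => ∫ v in (1 : ℝ)..T, k u v :=
      intervalIntegral.continuous_parametric_intervalIntegral_of_continuous' (μ := volume) hk 1 T
    have hsw : ∫ v in (1 : ℝ)..T, ∫ u in (-1 / 2 : ℝ)..(1 / 2), k u v =
        ∫ u in (-1 / 2 : ℝ)..(1 / 2), ∫ v in (1 : ℝ)..T, k u v :=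
      intervalIntegral_intervalIntegral_swap (F := fun v u => k u v)
        ((hk'.continuousOn.integrableOn_compact
          (isCompact_uIcc.prod isCompact_uIcc)).mono_set
            (Set.prod_mono Set.uIoc_subset_uIcc Set.uIoc_subset_uIcc))
    rw [integral_truncFD hG hT, hsw,
      ← intervalIntegral.integral_add (hc1.intervalIntegrable _ _) (hc2.intervalIntegrable _ _)]
    refine intervalIntegral.integral_congr fun u hu => ?_
    rw [Set.uIcc_of_le (by norm_num)] at hu
    have hu' : |u| ≤ 1 / 2 := abs_le.2 ⟨by linarith [hu.1], hu.2⟩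
    rw [intervalIntegral.integral_add_adjacent_intervals ((hkc u).intervalIntegrable _ _)
      ((hkc u).intervalIntegrable _ _)]
    refine intervalIntegral.integral_congr fun v hv => ?_
    rw [Set.uIcc_of_le ((sqrt_one_sub_sq_le_one u).trans hT)] at hv
    exact (hkv u v ((half_lt_sqrt hu').le.trans hv.1)).symm
  have hφ : Continuous fun v : ℝ => ∫ u in (-1 / 2 : ℝ)..(1 / 2), k u v :=
    intervalIntegral.continuous_parametric_intervalIntegral_of_continuous' (μ := volume) hk'
      (-1 / 2) (1 / 2)
  have hint : IntegrableOn (fun v : ℝ => ∫ u in (-1 / 2 : ℝ)..(1 / 2), k u v) (Set.Ioi 1) := by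
    refine Integrable.mono' ((integrableOn_Ioi_rpow_of_lt (a := s - 2) (by linarith)
      one_pos).const_mul B) hφ.aestronglyMeasurable ?_
    refine (ae_restrict_iff' measurableSet_Ioi).2 (ae_of_all _ fun v (hv : 1 < v) => ?_)
    have hv0 : 0 < v := one_pos.trans hv
    have h1 : ∫ u in (-1 / 2 : ℝ)..(1 / 2), k u v =
        ((v : ℂ) ^ 2)⁻¹ * ∫ u in (-1 / 2 : ℝ)..(1 / 2), G (u + v * Complex.I) := by
      rw [← intervalIntegral.integral_const_mul]
      exact intervalIntegral.integral_congr fun u _ => hkv u v (by linarith)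
    rw [h1, norm_mul, norm_inv, norm_pow, Complex.norm_real, Real.norm_eq_abs, abs_of_pos hv0,
      Real.rpow_sub hv0, Real.rpow_two]
    calc (v ^ 2)⁻¹ * ‖∫ u in (-1 / 2 : ℝ)..(1 / 2), G (u + v * Complex.I)‖
        ≤ (v ^ 2)⁻¹ * (B * v ^ s) := by gcongr; exact hB v hv.le
      _ = B * (v ^ s / v ^ 2) := by ring
  refine ⟨_, (((intervalIntegral_tendsto_integral_Ioi 1 hint tendsto_id).const_add
    (∫ u in (-1 / 2 : ℝ)..(1 / 2), ∫ v in √(1 - u ^ 2)..1, k u v))).congr' ?_⟩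
  filter_upwards [eventually_ge_atTop 1] with T hT
  exact (hF T hT).symm

end Regularized

section FiberSums

/-- A sum over vectors, rearranged by the values of a real function. -/
lemma hasSum_fiber {ι : Type*} {f : ι → ℂ} {s : ℂ} (h : HasSum f s) (φ : ι → ℝ) :
    HasSum (fun r : ℝ => ∑' x : {x // φ x = r}, f x) s := by
  rw [← (Equiv.sigmaFiberEquiv φ).hasSum_iff] at h
  exact h.sigma fun r => (h.summable.sigma_factor r).hasSum

variable {V : Type*} [AddCommGroup V] [Module ℝ V] {Q : QuadraticForm ℝ V} {M : AddSubgroup V}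

/-- The coefficient of `q ^ n`, at height `v`, in the complex conjugate of the theta function of
a positive definite lattice: the number of vectors with `-Q(x) = n`, times `e ^ (4πnv)`. -/
def conjThetaCoeff (v : ℝ) (α : Disc Q M) (n : ℝ) : ℂ :=
  Nat.card {x : Coset α // -Q (x.1 : V) = n} * (Real.exp (4 * Real.pi * n * v) : ℝ)

lemma exists_of_conjThetaCoeff_ne_zero {v : ℝ} {α : Disc Q M} {n : ℝ}
    (h : conjThetaCoeff v α n ≠ 0) : ∃ x : Coset α, -Q (x.1 : V) = n := by
  by_contra! h0
  have : IsEmpty {x : Coset α // -Q (x.1 : V) = n} := ⟨fun x => h0 x.1 x.2⟩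
  simp [conjThetaCoeff] at h

end FiberSums

namespace IsSpecialSetting

variable {V : Type*} [AddCommGroup V] [Module ℝ V] [FiniteDimensional ℝ V]
  {Q : QuadraticForm ℝ V} {L : AddSubgroup V} {n : ℕ} {w : Grassmannian Q}
  (H : IsSpecialSetting Q L n w)
include H

/-- The conjugate of `Θ_P` as a Fourier series with coefficients depending on the height, the
vectors being collected by their length. -/
lemma hasSum_conjThetaCoeff (τ : ℍ) (α : Disc Q (posPart L w)) :
    HasSum (fun r : ℝ => conjThetaCoeff τ.im α r * e (r * τ))
      (conj (thetaSeries Q 1 (posPart L w) τ α)) := by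
  have h1 : Summable fun x : dualLattice Q (posPart L w) => conj (e ((Q (x : V) : ℂ) * τ)) := by
    refine Summable.of_norm ((H.summable_posPart (c := 2 * Real.pi * τ.im)
      (by have := τ.im_pos; positivity)).congr fun x => ?_)
    rw [norm_conj_e_mul, coe_im]
  have h2 : HasSum (fun x : Coset α => conj (e ((Q (x.1 : V) : ℂ) * τ)))
      (conj (thetaSeries Q 1 (posPart L w) τ α)) := by
    rw [thetaP_eq, Complex.conj_tsum]
    exact (h1.subtype {x | (x : Disc Q (posPart L w)) = α}).hasSum
  refine (hasSum_fiber h2 fun x => -Q (x.1 : V)).congr_fun fun r => ?_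
  have h3 : ∀ x : {x : Coset α // -Q (x.1 : V) = r}, conj (e ((Q (x.1.1 : V) : ℂ) * τ)) =
      (Real.exp (4 * Real.pi * r * τ.im) : ℝ) * e (r * τ) := by
    rintro ⟨x, rfl⟩
    rw [conj_e, e, e, Complex.ofReal_exp, ← Complex.exp_add, map_mul, Complex.conj_ofReal]
    congr 1
    have h4 : conj (τ : ℂ) = τ - 2 * τ.im * Complex.I := by
      apply Complex.ext <;> simp
      ring
    rw [h4]
    push_cast
    linear_combination 4 * Real.pi * Q (x.1 : V) * τ.im * Complex.I_sq
  rw [tsum_congr h3, tsum_const, conjThetaCoeff, nsmul_eq_mul, mul_assoc]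

omit [FiniteDimensional ℝ V] H in
lemma norm_conjThetaCoeff_le {v : ℝ} (hv : 1 ≤ v) (α : Disc Q (posPart L w)) (r : ℝ) :
    ‖conjThetaCoeff v α r‖ ≤ ‖conjThetaCoeff 1 α r‖ := by
  by_cases h : conjThetaCoeff v α r = 0
  · rw [h, norm_zero]
    exact norm_nonneg _
  obtain ⟨x, rfl⟩ := exists_of_conjThetaCoeff_ne_zero h
  have hQ : 0 ≤ Q (x.1 : V) := map_nonneg_of_mem w (mem_space_of_dual x.1.2)
  rw [conjThetaCoeff, conjThetaCoeff, norm_mul, norm_mul]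
  refine mul_le_mul_of_nonneg_left ?_ (norm_nonneg _)
  rw [Complex.norm_real, Complex.norm_real, Real.norm_eq_abs, Real.norm_eq_abs, Real.abs_exp,
    Real.abs_exp]
  refine Real.exp_le_exp.2 ?_
  have h1 : 0 ≤ Real.pi * Q (x.1 : V) := mul_nonneg Real.pi_pos.le hQ
  nlinarith

omit [FiniteDimensional ℝ V] in
lemma exponent_conjThetaCoeff {v : ℝ} {α : Disc Q (posPart L w)} {r : ℝ}
    (h : conjThetaCoeff v α r ≠ 0) : ∃ m : ℤ, r = -Q (rep α) + m := by
  obtain ⟨x, rfl⟩ := exists_of_conjThetaCoeff_ne_zero h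
  obtain ⟨m, hm⟩ := map_sub_map_int H.even_posPart (rep_mem _) (mk_eq_iff.1 x.2)
  exact ⟨-m, by rw [hm]; push_cast; ring⟩

/-- The constant terms of `⟨f, Θ_L(·, w)⟩ v ^ (-n/2)` are bounded. -/
theorem exists_norm_integral_le [Fintype (Disc Q (posPart L w))]
    [Fintype (Disc Q (negPart L w))] {κ : ℤ} {f : ℍ → Disc Q L → ℂ} {a a' : Disc Q L → ℝ → ℂ}
    (hf : HasFourierExpansion Q 1 L κ f a a') (ha : ∀ γ, a' γ 0 = 0 ∨ 2 < κ) :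
    ∃ B : ℝ, ∀ v : ℝ, 1 ≤ v → ‖∫ u in (-1 / 2 : ℝ)..(1 / 2),
      (liftSum L w f (fun τ α => conj (thetaSeries Q 1 (posPart L w) τ α)) ∘ ofComplex)
        (u + v * Complex.I)‖ ≤ B := by
  have hbound := (H.hasSum_liftTerm (τ := UpperHalfPlane.I)
    (A := coeffBound κ a a') (B := conjThetaCoeff 1)
    (fun γ n h => by simpa using hf.exponent_coeffBound h)
    (fun α n h => H.exponent_conjThetaCoeff h)
    (fun γ => (hf.summable_coeffBound γ).hasSum)
    (fun α => by simpa using H.hasSum_conjThetaCoeff UpperHalfPlane.I α)).summable.norm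
  obtain ⟨B, hB⟩ := hbound
  refine ⟨B, fun v hv => ?_⟩
  have h1 := H.hasSum_integral_contract (A := coeffAt κ a a' v) (B := conjThetaCoeff v)
    (FA := f) (FB := fun τ α => conj (thetaSeries Q 1 (posPart L w) τ α)) (one_pos.trans_le hv)
    (fun γ n h => by simpa using hf.exponent_coeffAt h)
    (fun α n h => H.exponent_conjThetaCoeff h)
    (by rintro τ rfl γ; exact hf.hasSum_coeffAt τ γ)
    (by rintro τ rfl α; exact H.hasSum_conjThetaCoeff τ α)
  refine h1.norm_le_of_bounded hB fun s => ?_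
  split_ifs with hs
  · rw [norm_mul, hs]
    simpa [e] using norm_liftTerm_le (norm_coeffAt_le ha hv) (norm_conjThetaCoeff_le hv) s.1 0
  · simpa using mul_nonneg (norm_nonneg _) (norm_nonneg _)

end IsSpecialSetting

/-! ### Evaluation of the lift by Stokes' theorem -/

section DbarRules

lemma dbar_mul {F G : ℂ → ℂ} {z : ℂ} (hF : DifferentiableAt ℝ F z) (hG : DifferentiableAt ℝ G z) :
    dbar (fun z => F z * G z) z = dbar F z * G z + F z * dbar G z := by
  simp only [dbar, fderiv_fun_mul hF hG, add_apply,
    smul_apply, smul_eq_mul]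
  ring

lemma dbar_sum {ι : Type*} [Fintype ι] {F : ι → ℂ → ℂ} {z : ℂ}
    (hF : ∀ i, DifferentiableAt ℝ (F i) z) :
    dbar (fun z => ∑ i, F i z) z = ∑ i, dbar (F i) z := by
  simp only [dbar, fderiv_fun_sum fun i _ => hF i, sum_apply, Finset.mul_sum,
    ← Finset.sum_add_distrib, Finset.sum_div]

end DbarRules

namespace IsSpecialSetting

variable {V : Type*} [AddCommGroup V] [Module ℝ V] [FiniteDimensional ℝ V]
  {Q : QuadraticForm ℝ V} {L : AddSubgroup V} {n : ℕ} {w : Grassmannian Q}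
  (H : IsSpecialSetting Q L n w)
  [Fintype (Disc Q L)] [Fintype (Disc Q (posPart L w))] [Fintype (Disc Q (negPart L w))]
  {f : ℍ → Disc Q L → ℂ} {Θt : ℍ → Disc Q (posPart L w) → ℂ}

omit [FiniteDimensional ℝ V] [Fintype (Disc Q L)] [Fintype (Disc Q (posPart L w))]
  [Fintype (Disc Q (negPart L w))] in
lemma contDiffOn_res {m : WithTop ℕ∞}
    (hf : ∀ γ, ContDiffOn ℝ m ((fun τ => f τ γ) ∘ ofComplex) {z : ℂ | 0 < z.im})
    (δ : Disc Q (sumPart L w)) :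
    ContDiffOn ℝ m ((fun τ => res L (sumPart L w) (f τ) δ) ∘ ofComplex) {z : ℂ | 0 < z.im} := by
  rcases res_cases L (sumPart L w) δ with ⟨γ, h⟩ | h
  · simp only [h]
    exact hf γ
  · simp only [h]
    exact contDiffOn_const

include H

omit [Fintype (Disc Q L)] [Fintype (Disc Q (posPart L w))] [Fintype (Disc Q (negPart L w))] in
lemma differentiableOn_thetaSeries (β : Disc Q (negPart L w)) :
    DifferentiableOn ℂ ((fun τ => thetaSeries Q (-1) (negPart L w) τ β) ∘ ofComplex)
      {z : ℂ | 0 < z.im} := by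
  refine (H.differentiableOn_thetaN β).congr fun z hz => ?_
  rw [Function.comp_apply, ofComplex_apply_of_im_pos hz, thetaSeries_neg]

/-- The integrand of the lift, in terms of the components of `f`, `Θ_P` and `Θ_{N⁻}`. -/
lemma pairing_siegelTheta_mul (τ : ℍ) :
    pairing (f τ) (siegelTheta Q L w τ) * ((τ.im ^ (((1 - n : ℤ) : ℝ) / 2) : ℝ) : ℂ) =
      ((τ.im ^ (1 / 2 : ℝ) : ℝ) : ℂ) *
        liftSum L w f (fun τ α => conj (thetaSeries Q 1 (posPart L w) τ α)) τ := by
  rw [H.pairing_siegelTheta, mul_right_comm, ← Complex.ofReal_mul, ← Real.rpow_add τ.im_pos,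
    show (n : ℝ) / 2 + ((1 - n : ℤ) : ℝ) / 2 = 1 / 2 by push_cast; ring]
  rfl

/-- The evaluation of the truncated lift. The function `h = ∑ f_{α + β} Θ̃_α Θ_{N⁻, β}` has weight
`2`, and `-2i v² ∂h/∂τ̄` is the sum of the two integrands: `Θ_P` arises from `∂Θ̃/∂τ̄`, and `ξ f`
from `∂f/∂τ̄`. -/
theorem truncLift_add_truncXiIntegral (hf : IsHarmonicMaass Q 1 L (1 - n) f)
    (hΘ : IsHarmonicMaass Q (-1) (posPart L w) 3 Θt)
    (hξ : xi 3 Θt = thetaSeries Q 1 (posPart L w)) {T : ℝ} (hT : 1 ≤ T) :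
    truncLift L (1 - n) f w T + truncXiIntegral L (1 - n) f w Θt T =
      ∫ u in (-1 / 2 : ℝ)..(1 / 2), (liftSum L w f Θt ∘ ofComplex) (u + T * Complex.I) := by
  let I := Disc Q (posPart L w) × Disc Q (negPart L w)
  let F : I → ℂ → ℂ := fun p => (fun τ => res L (sumPart L w) (f τ) (glue L w p)) ∘ ofComplex
  let G : I → ℂ → ℂ := fun p => (fun τ => Θt τ p.1) ∘ ofComplex
  let N : I → ℂ → ℂ := fun p =>
    (fun τ => thetaSeries Q (-1) (negPart L w) τ p.2) ∘ ofComplex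
  have hF : ∀ p, ContDiffOn ℝ 1 (F p) {z : ℂ | 0 < z.im} := fun p => by
    exact_mod_cast contDiffOn_infty.1 (contDiffOn_res hf.smooth (glue L w p)) 1
  have hG : ∀ p, ContDiffOn ℝ 1 (G p) {z : ℂ | 0 < z.im} := fun p => by
    exact_mod_cast contDiffOn_infty.1 (hΘ.smooth p.1) 1
  have hN0 : ∀ p, DifferentiableOn ℂ (N p) {z : ℂ | 0 < z.im} := fun p =>
    H.differentiableOn_thetaSeries p.2
  have hN : ∀ p, ContDiffOn ℝ 1 (N p) {z : ℂ | 0 < z.im} := fun p =>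
    contDiffOn_of_differentiableOn (hN0 p) 1
  let h : ℂ → ℂ := fun z => ∑ p, F p z * (G p z * N p z)
  have hh : h = liftSum L w f Θt ∘ ofComplex := rfl
  have hhc : ContDiffOn ℝ 1 h {z : ℂ | 0 < z.im} :=
    ContDiffOn.sum fun p _ => (hF p).mul ((hG p).mul (hN p))
  have hdiff : ∀ {K : ℂ → ℂ}, ContDiffOn ℝ 1 K {z : ℂ | 0 < z.im} → ∀ {z : ℂ}, 0 < z.im →
      DifferentiableAt ℝ K z := fun hK _ hz =>
    (hK.contDiffAt (isOpen_im_pos.mem_nhds hz)).differentiableAt one_ne_zero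
  have hdh : ∀ z : ℂ, 0 < z.im → dbar h z =
      ∑ p, F p z * (dbar (G p) z * N p z) + ∑ p, dbar (F p) z * (G p z * N p z) := by
    intro z hz
    have h1 : ∀ p, dbar (fun z => F p z * (G p z * N p z)) z =
        F p z * (dbar (G p) z * N p z) + dbar (F p) z * (G p z * N p z) := fun p => by
      have hGN : DifferentiableAt ℝ (fun z => G p z * N p z) z :=
        (hdiff (hG p) hz).mul (hdiff (hN p) hz)
      rw [dbar_mul (hdiff (hF p) hz) hGN, dbar_mul (hdiff (hG p) hz) (hdiff (hN p) hz),
        dbar_eq_zero (hN0 p) hz]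
      ring
    have h2 : ∀ p, DifferentiableAt ℝ (fun z => F p z * (G p z * N p z)) z := fun p =>
      (hdiff (hF p) hz).mul ((hdiff (hG p) hz).mul (hdiff (hN p) hz))
    rw [← Finset.sum_add_distrib]
    exact (dbar_sum h2).trans (Finset.sum_congr rfl fun p _ => h1 p)
  -- the two integrands
  let G₁ : ℂ → ℂ := fun z =>
    -2 * Complex.I * (z.im : ℂ) ^ 2 * ∑ p, F p z * (dbar (G p) z * N p z)
  let G₂ : ℂ → ℂ := fun z =>
    -2 * Complex.I * (z.im : ℂ) ^ 2 * ∑ p, dbar (F p) z * (G p z * N p z)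
  have hG₁ : ContinuousOn G₁ {z : ℂ | 0 < z.im} :=
    ContinuousOn.mul (by fun_prop) (continuousOn_finsetSum _ fun p _ =>
      (hF p).continuousOn.mul ((continuousOn_dbar (hG p)).mul (hN p).continuousOn))
  have hG₂ : ContinuousOn G₂ {z : ℂ | 0 < z.im} :=
    ContinuousOn.mul (by fun_prop) (continuousOn_finsetSum _ fun p _ =>
      (continuousOn_dbar (hF p)).mul ((hG p).continuousOn.mul (hN p).continuousOn))
  have hlift : truncLift L (1 - n) f w T = ∫ τ in truncFD T, G₁ τ := by
    refine integral_congr_ae (ae_of_all _ fun τ => ?_)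
    simp only
    rw [H.pairing_siegelTheta_mul, liftSum, contract]
    simp only [G₁]
    rw [Finset.mul_sum, Finset.mul_sum]
    refine Finset.sum_congr rfl fun p _ => ?_
    have h1 := dbar_comp_ofComplex Θt 3 p.1 τ τ.im_pos
    rw [hξ] at h1
    have h2 : ((τ.im ^ (1 / 2 : ℝ) : ℝ) : ℂ) =
        (τ.im : ℂ) ^ 2 * ((τ.im ^ (-(((3 : ℤ) : ℝ) / 2)) : ℝ) : ℂ) := by
      rw [← Complex.ofReal_pow, ← Complex.ofReal_mul, ← Real.rpow_natCast,
        ← Real.rpow_add τ.im_pos]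
      norm_num
    simp only [F, G, N, Function.comp_apply, ofComplex_apply, coe_im] at h1 ⊢
    rw [h1, h2]
    linear_combination ((τ.im : ℂ) ^ 2 * ((τ.im ^ (-(((3 : ℤ) : ℝ) / 2)) : ℝ) : ℂ) *
      res L (sumPart L w) (f τ) (glue L w p) * conj (thetaSeries Q 1 (posPart L w) τ p.1) *
      thetaSeries Q (-1) (negPart L w) τ p.2) * Complex.I_sq
  have hxi : truncXiIntegral L (1 - n) f w Θt T = ∫ τ in truncFD T, G₂ τ := by
    refine integral_congr_ae (ae_of_all _ fun τ => ?_)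
    simp only
    rw [pairing, finsum_eq_sum_of_fintype]
    simp only [G₂]
    rw [Finset.sum_mul, Finset.mul_sum]
    refine Finset.sum_congr rfl fun p _ => ?_
    have h1 := dbar_comp_ofComplex (fun σ => res L (sumPart L w) (f σ)) (1 - n) (glue L w p) τ
      τ.im_pos
    have h2 : ((τ.im ^ (2 - ((1 - n : ℤ) : ℝ) / 2) : ℝ) : ℂ) =
        (τ.im : ℂ) ^ 2 * ((τ.im ^ (-(((1 - n : ℤ) : ℝ) / 2)) : ℝ) : ℂ) := by
      rw [← Complex.ofReal_pow, ← Complex.ofReal_mul, ← Real.rpow_natCast,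
        ← Real.rpow_add τ.im_pos]
      norm_num [sub_eq_add_neg]
    simp only [F, G, N, tensor, splitCoords, Function.comp_apply, ofComplex_apply, coe_im] at h1 ⊢
    rw [h1, h2]
    linear_combination ((τ.im : ℂ) ^ 2 * ((τ.im ^ (-(((1 - n : ℤ) : ℝ) / 2)) : ℝ) : ℂ) *
      conj (xi (1 - n) (fun σ => res L (sumPart L w) (f σ)) τ (glue L w p)) * Θt τ p.1 *
      thetaSeries Q (-1) (negPart L w) τ p.2) * Complex.I_sq
  have hT1 : ∀ z : ℂ, 0 < z.im → h (z + 1) = h z := fun z hz => by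
    rw [hh, Function.comp_apply, Function.comp_apply, ofComplex_add_one hz]
    exact H.liftSum_T hf.transforms hΘ.transforms _
  have hS : ∀ z : ℂ, 0 < z.im → h (-1 / z) = z ^ 2 * h z := fun z hz => by
    have h1 : 0 < (-1 / z).im := by
      have := UpperHalfPlane.im_inv_neg_coe_pos ⟨z, hz⟩
      rwa [show (-1 / z) = (-z)⁻¹ by rw [inv_neg, neg_div, one_div]]
    have h2 : ofComplex (-1 / z) = ModularGroup.S • ofComplex z := by
      apply UpperHalfPlane.ext
      rw [modular_S_smul, ofComplex_apply_of_im_pos hz, ofComplex_apply_of_im_pos h1]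
      change -1 / z = (-z)⁻¹
      rw [inv_neg, neg_div, one_div]
    rw [hh, Function.comp_apply, Function.comp_apply, h2, H.liftSum_S hf.transforms hΘ.transforms,
      ofComplex_apply_of_im_pos hz]
  rw [hlift, hxi, ← integral_add (integrableOn_truncFD hG₁ T) (integrableOn_truncFD hG₂ T)]
  have hG12 : ContinuousOn (fun z => G₁ z + G₂ z) {z : ℂ | 0 < z.im} := hG₁.add hG₂
  refine (integral_truncFD hG12 hT).trans ?_
  rw [← hh]
  have hin : ∀ u ∈ Set.uIcc (-1 / 2 : ℝ) (1 / 2), ∫ v in √(1 - u ^ 2)..T,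
      ((v : ℂ) ^ 2)⁻¹ * (G₁ (u + v * Complex.I) + G₂ (u + v * Complex.I)) =
      -2 * Complex.I * ∫ v in √(1 - u ^ 2)..T, dbar h (u + v * Complex.I) := by
    intro u hu
    rw [Set.uIcc_of_le (by norm_num)] at hu
    have hu' : |u| ≤ 1 / 2 := abs_le.2 ⟨by linarith [hu.1], hu.2⟩
    rw [← intervalIntegral.integral_const_mul]
    refine intervalIntegral.integral_congr fun v hv => ?_
    rw [Set.uIcc_of_le ((sqrt_one_sub_sq_le_one u).trans hT)] at hv
    have hv0 : 0 < v := (by norm_num : (0 : ℝ) < 1 / 2).trans ((half_lt_sqrt hu').trans_le hv.1)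
    have hv1 : (v : ℂ) ≠ 0 := by exact_mod_cast hv0.ne'
    have him : ((u : ℂ) + v * Complex.I).im = v := by simp
    simp only [G₁, G₂, him]
    rw [hdh _ (by rw [him]; exact hv0)]
    field_simp
    ring
  rw [intervalIntegral.integral_congr hin, intervalIntegral.integral_const_mul,
    stokes_truncFD hhc hT1 hS hT]
  linear_combination (-∫ u in (-1 / 2 : ℝ)..(1 / 2), h (u + T * Complex.I)) * Complex.I_sq

omit [Fintype (Disc Q L)] in
lemma continuousOn_liftSum_conj (hf : IsHarmonicMaass Q 1 L (1 - n) f)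
    (hΘ : IsHarmonicMaass Q (-1) (posPart L w) 3 Θt)
    (hξ : xi 3 Θt = thetaSeries Q 1 (posPart L w)) :
    ContinuousOn (fun z => liftSum L w f
      (fun τ α => conj (thetaSeries Q 1 (posPart L w) τ α)) (ofComplex z)) {z : ℂ | 0 < z.im} := by
  have hP : ∀ α : Disc Q (posPart L w), ContinuousOn
      (fun z => conj (thetaSeries Q 1 (posPart L w) (ofComplex z) α)) {z : ℂ | 0 < z.im} := by
    intro α
    -- `Θ_P` is continuous, being an image under `ξ`
    have hG : ContDiffOn ℝ 1 ((fun τ => Θt τ α) ∘ ofComplex) {z : ℂ | 0 < z.im} := by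
      exact_mod_cast contDiffOn_infty.1 (hΘ.smooth α) 1
    have hv : ContinuousOn (fun z : ℂ => ((z.im ^ (((3 : ℤ) : ℝ) / 2) : ℝ) : ℂ))
        {z : ℂ | 0 < z.im} :=
      Complex.continuous_ofReal.comp_continuousOn
        (Complex.continuous_im.continuousOn.rpow_const fun z hz => Or.inl (ne_of_gt hz))
    have hD : ContinuousOn (fun z => conj (dbar ((fun τ => Θt τ α) ∘ ofComplex) z))
        {z : ℂ | 0 < z.im} := Complex.continuous_conj.comp_continuousOn (continuousOn_dbar hG)
    have h1 : ContinuousOn (fun z : ℂ => conj (2 * Complex.I *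
        ((z.im ^ (((3 : ℤ) : ℝ) / 2) : ℝ) : ℂ) *
          conj (dbar ((fun τ => Θt τ α) ∘ ofComplex) z))) {z : ℂ | 0 < z.im} :=
      Complex.continuous_conj.comp_continuousOn ((continuousOn_const.mul hv).mul hD)
    refine h1.congr fun z hz => ?_
    simp only [← hξ, ofComplex_apply_of_im_pos hz]
    rfl
  refine continuousOn_finsetSum _ fun p _ => ?_
  have hF := (contDiffOn_res hf.smooth (glue L w p)).continuousOn
  have hN := (H.differentiableOn_thetaSeries p.2).continuousOn
  exact hF.mul ((hP p.1).mul hN)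

/-- The regularized lift converges. -/
theorem exists_tendsto_truncLift (hf : IsHarmonicMaassCusp Q 1 L (1 - n) f)
    (hΘ : IsHarmonicMaass Q (-1) (posPart L w) 3 Θt)
    (hξ : xi 3 Θt = thetaSeries Q 1 (posPart L w)) {a a' : Disc Q L → ℝ → ℂ}
    (hfE : HasFourierExpansion Q 1 L (1 - n) f a a') (ha : ∀ γ, a' γ 0 = 0) :
    ∃ c, Tendsto (truncLift L (1 - n) f w) atTop (𝓝 c) := by
  obtain ⟨B, hB⟩ := H.exists_norm_integral_le hfE fun γ => Or.inl (ha γ)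
  obtain ⟨K, hK, hKdef⟩ : ∃ K : ℂ → ℂ, ContinuousOn K {z : ℂ | 0 < z.im} ∧
      (liftSum L w f (fun τ α => conj (thetaSeries Q 1 (posPart L w) τ α)) ∘ ofComplex) = K :=
    ⟨_, H.continuousOn_liftSum_conj hf.toIsHarmonicMaass hΘ hξ, rfl⟩
  rw [hKdef] at hB
  obtain ⟨G, hG⟩ : ∃ G : ℂ → ℂ, ∀ z, G z = ((z.im ^ (1 / 2 : ℝ) : ℝ) : ℂ) * K z :=
    ⟨_, fun _ => rfl⟩
  have hlift : truncLift L (1 - n) f w = fun T => ∫ τ in truncFD T, G τ := by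
    funext T
    refine integral_congr_ae (ae_of_all _ fun τ => ?_)
    simp only [hG, ← hKdef, Function.comp_apply, ofComplex_apply, coe_im]
    exact H.pairing_siegelTheta_mul τ
  have hGc : ContinuousOn G {z : ℂ | 0 < z.im} := by
    have h1 : ContinuousOn (fun z : ℂ => ((z.im ^ (1 / 2 : ℝ) : ℝ) : ℂ)) {z : ℂ | 0 < z.im} :=
      Complex.continuous_ofReal.comp_continuousOn
        (Complex.continuous_im.continuousOn.rpow_const fun z hz => Or.inl (ne_of_gt hz))
    exact (h1.mul hK).congr fun z _ => hG z
  rw [hlift]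
  refine exists_tendsto_integral_truncFD (s := 1 / 2) (B := B) hGc (by norm_num) fun v hv => ?_
  have hv0 : 0 ≤ v := zero_le_one.trans hv
  have h1 : ∀ u : ℝ, G (u + v * Complex.I) =
      ((v ^ (1 / 2 : ℝ) : ℝ) : ℂ) * K (u + v * Complex.I) := fun u => by
    rw [hG]
    simp
  simp only [h1]
  rw [intervalIntegral.integral_const_mul, norm_mul, Complex.norm_real, Real.norm_eq_abs,
    abs_of_nonneg (by positivity), mul_comm]
  exact mul_le_mul_of_nonneg_right (hB v hv) (by positivity)

end IsSpecialSetting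

end ThetaLift

end

theorem mainTheorem3 {V : Type*} [AddCommGroup V] [Module ℝ V] [FiniteDimensional ℝ V]
    (Q : QuadraticForm ℝ V) (L : AddSubgroup V) (n : ℕ) (hn : 1 ≤ n)
    (hL : ThetaLift.IsEvenLattice Q L 1 n)
    (w : ThetaLift.Grassmannian Q) (hw : ThetaLift.IsSpecial L w)
    (f : ℍ → ThetaLift.Disc Q L → ℂ)
    (hf : ThetaLift.IsHarmonicMaassCusp Q 1 L (1 - n) f)
    (Θt : ℍ → ThetaLift.Disc Q (ThetaLift.posPart L w) → ℂ)
    (hΘt : ThetaLift.IsHarmonicMaassHol Q (-1) (ThetaLift.posPart L w) 3 Θt)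
    (hξ : ThetaLift.xi 3 Θt = ThetaLift.thetaSeries Q 1 (ThetaLift.posPart L w)) :
    (∃ a a', ThetaLift.HasFourierExpansion Q 1 L (1 - n) f a a') ∧
    (∃ b b', ThetaLift.HasFourierExpansion Q (-1) (ThetaLift.posPart L w) 3 Θt b b') ∧
    ∀ a a' b b', ThetaLift.HasFourierExpansion Q 1 L (1 - n) f a a' →
      ThetaLift.HasFourierExpansion Q (-1) (ThetaLift.posPart L w) 3 Θt b b' →
      ∃ C I : ℂ,
        -- the limits defining both sides exist, and the evaluation of the lift
        ThetaLift.HasConstantTerm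
          (fun τ => ThetaLift.pairing
            (ThetaLift.splitCoords L w
              (ThetaLift.res L (ThetaLift.sumPart L w) (ThetaLift.holPart a τ)))
            (fun p => conj (ThetaLift.tensor (ThetaLift.holPart b τ)
              (ThetaLift.thetaSeries Q (-1) (ThetaLift.negPart L w) τ) p))) C ∧
        Tendsto (ThetaLift.truncXiIntegral L (1 - n) f w Θt) atTop (𝓝 I) ∧
        Tendsto (ThetaLift.truncLift L (1 - n) f w) atTop
          (𝓝 (ThetaLift.thetaLift L (1 - n) f w)) ∧
        ThetaLift.thetaLift L (1 - n) f w = C - I ∧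
        -- the constant term as a finite sum over `α`, `β`, over `m - Q(α + β)` in `ℤ - Q(α + β)`, and `x ∈ β`
        C = ∑ᶠ (p : ThetaLift.Disc Q (ThetaLift.posPart L w) ×
              ThetaLift.Disc Q (ThetaLift.negPart L w)) (m : ℤ),
            ThetaLift.res L (ThetaLift.sumPart L w)
                (fun γ => a γ (-(m - Q (ThetaLift.rep p.1 + ThetaLift.rep p.2))))
                (ThetaLift.glue L w p) *
              ∑ᶠ x : ThetaLift.Coset p.2,
                b p.1 ((m - Q (ThetaLift.rep p.1 + ThetaLift.rep p.2)) + Q (x.1 : V)) ∧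
        {t : (Σ p : ThetaLift.Disc Q (ThetaLift.posPart L w) ×
              ThetaLift.Disc Q (ThetaLift.negPart L w), ℤ × ThetaLift.Coset p.2) |
            ThetaLift.res L (ThetaLift.sumPart L w)
                (fun γ => a γ (-(t.2.1 - Q (ThetaLift.rep t.1.1 + ThetaLift.rep t.1.2))))
                (ThetaLift.glue L w t.1) *
              b t.1.1 ((t.2.1 - Q (ThetaLift.rep t.1.1 + ThetaLift.rep t.1.2)) +
                Q (t.2.2.1 : V)) ≠ 0}.Finite := by
  have H : ThetaLift.IsSpecialSetting Q L n w := ⟨hL, hw⟩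
  have := H.finite_disc
  have := H.finite_disc_posPart
  have := H.finite_disc_negPart
  have := Fintype.ofFinite (ThetaLift.Disc Q L)
  have := Fintype.ofFinite (ThetaLift.Disc Q (ThetaLift.posPart L w))
  have := Fintype.ofFinite (ThetaLift.Disc Q (ThetaLift.negPart L w))
  have hκ : (1 - n : ℤ) ≠ 2 := by omega
  refine ⟨hf.toIsHarmonicMaass.exists_hasFourierExpansion hκ hf.xi_mem.toIsModularForm,
    hΘt.toIsHarmonicMaass.exists_hasFourierExpansion (by norm_num) hΘt.xi_mem, ?_⟩
  intro a a' b b' hfE hΘE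
  have ha : ∀ γ, a' γ 0 = 0 := hfE.coeff_zero_eq_zero hκ hf.toIsHarmonicMaass hf.xi_mem
  obtain ⟨c, hc⟩ := H.exists_tendsto_truncLift hf hΘt.toIsHarmonicMaass hξ hfE ha
  have hΦ : ThetaLift.thetaLift L (1 - n) f w = c := hc.limUnder_eq
  -- as `v → ∞`, the constant Fourier coefficient of `∑ f_{α + β} Θ̃_α Θ_{N⁻, β}` tends to the
  -- constant term of the product of the holomorphic parts
  have hC := H.tendsto_integral_liftSum hfE hΘE (fun γ => Or.inl (ha γ))
    (fun _ => Or.inr (by norm_num))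
  refine ⟨_, _, ?_, ((hC.sub hc).congr' ?_), hΦ ▸ hc, ?_, H.tsum_liftTerm_eq_finsum hfE hΘE, ?_⟩
  · convert H.hasConstantTerm_holPart hfE hΘE using 2 with τ
    rw [ThetaLift.pairing, finsum_eq_sum_of_fintype]
    refine Finset.sum_congr rfl fun p _ => ?_
    rw [Complex.conj_conj]
    rfl
  · filter_upwards [eventually_ge_atTop 1] with T hT
    rw [← H.truncLift_add_truncXiIntegral hf.toIsHarmonicMaass hΘt.toIsHarmonicMaass hξ hT]
    ring
  · rw [hΦ, sub_sub_cancel]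
  · simpa only [ThetaLift.liftTerm, ThetaLift.TermIndex.expo, Int.cast_zero, add_zero] using
      H.finite_liftTerm hfE hΘE
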